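/- **Setting.** Let $X'$ be a compact manifold with boundary, $N = X'\setminus\partial X'$. A boundary-defining function is a smooth $x\ge 0$ on $X'$ with $\partial X'=\{x=0\}$ and $dx\neq 0$ on $\partial X'$. Let $\nu_b(X')$ be the space of vector fields on $X'$, smooth up to the boundary, that are tangent to $\partial X'$ along $\partial X'$, and $\nu_{sc}(X') = x\cdot\nu_b(X')$ the space of scattering vector fields. A Riemannian metric $g$ on $N$ is asymptotically conical if, for some boundary-defining function $x_0$, some $a\in C^\infty(X')$ and some symmetric 2-tensor $h$ on $TX'$, smooth up to the boundary and positive definite on $T\partial X'$, one has $g = \frac{dx_0^2}{x_0^4}(1+x_0a)+\frac{h}{x_0^2}$. A b-immersion $\phi:X\to X'$, with $X$ a compact manifold with boundary, is a smooth immersion with $\phi(\partial X)\subseteq\partial X'$ such that $T_pX/T_p\partial X\to T_{\phi(p)}X'/T_{\phi(p)}\partial X'$ is injective for every $p\in\partial X$. Write $\nabla$, $R$, $\|\cdot\|$ for the Levi-Civita connection, the curvature tensor and the norm of $g$. **Data.** Let $g$ be asymptotically conical on $X'$, $x$ a boundary-defining function of $X'$, and $V\in\nu_{sc}(X')$. Suppose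 that near $\partial X'$ $$\|R(p)\|\le \rho(x(p))^2\le c\,x(p)^2 ,$$ where $c$ is a constant, $\rho$ is a function of $x$ alone, $\rho(x)>0$ for $x>0$, and $\rho$ is comparable at comparable distances: for every $K$ there is $L$ such that, for all sufficiently small $t>0$ and all $t'>0$ with $|1/t'-1/t|\le K$, one has $\rho(t')\le L\,\rho(t)$. Let $\phi:X\to X'$ be a b-immersion, $y\in\partial X$, and let $t\mapsto (t,y)$, $0\le t<\varepsilon$, be a smooth curve in $X$ starting at $y$ along which $x\circ\phi = t$ (a coordinate line of a collar of $\partial X$). Let $Z\in\nu_{sc}(X)$ be non-zero at $(t,y)$ for $0<t<\varepsilon$; identify $Z$ with $d\phi(Z)$. **Claim.** For small $t>0$ let $\gamma(s)=\gamma(t,s)$, $s\in\mathbb R$, be the geodesic of $N$ with $\gamma(0)=\phi(t,y)$ and $\dot\gamma(0)=V[\gamma(0)]$, and let $J$ be the Jacobi field along $\gamma$, that is $$\nabla_s\nabla_sJ+R(J,\dot\gamma)\dot\gamma=0,\qquad J(0)=Z[t,y],\quad \nabla_sJ(0)=\nabla_ZV[t,y].$$ Extend $Z[t,y]$ and $\nabla_ZV[t,y]$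 along $\gamma$ by parallel transport. Then $$J(s)=Z+s\,\nabla_ZV+Q(s),\qquad \|Q(s)\|=O(\rho(t)\,t)\quad\text{as } t\to0,$$ uniformly for $0\le s\le 1$: there is a constant $C$ such that, for all sufficiently small $t>0$ and all $s\in[0,1]$, $\|Q(s)\|\le C\,\rho(t)\,t$. -/

import Mathlib

open scoped Manifold ContDiff Topology
open Set Filter

noncomputable section

namespace ScGeom

/-! ### Manifolds with boundary: boundary-defining functions, b- and scattering vector fields -/

section Boundary

variable {n : ℕ} [NeZero n] {M : Type*} [TopologicalSpace M]
  [ChartedSpace (EuclideanHalfSpace n) M]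

/-- The differential `dx` at `p`, applied to a tangent vector. -/
def diff (x : M → ℝ) (p : M) (v : TangentSpace (𝓡∂ n) p) : ℝ :=
  mfderiv (𝓡∂ n) 𝓘(ℝ, ℝ) x p v

/-- `x` is a boundary-defining function: it is smooth up to the boundary, `x ≥ 0`, `∂M = {x = 0}`
and `dx ≠ 0` at the points of `∂M`. -/
structure IsBoundaryDefining (x : M → ℝ) : Prop where
  smooth : ContMDiff (𝓡∂ n) 𝓘(ℝ, ℝ) ∞ x
  nonneg : ∀ p, 0 ≤ x p
  zero_iff : ∀ p, x p = 0 ↔ p ∈ (𝓡∂ n).boundary M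
  diff_ne_zero : ∀ p ∈ (𝓡∂ n).boundary M, ∃ v : TangentSpace (𝓡∂ n) p, diff x p v ≠ 0

/-- For `p ∈ ∂M`, the condition `v ∈ T_p ∂M`: in the chart at `p`, with values in the half-space
`{u | 0 ≤ u 0}`, the component of `v` normal to the boundary vanishes. -/
def IsTangentToBoundary (p : M) (v : TangentSpace (𝓡∂ n) p) : Prop :=
  (show EuclideanSpace ℝ (Fin n) from
    mfderiv (𝓡∂ n) 𝓘(ℝ, EuclideanSpace ℝ (Fin n)) (extChartAt (𝓡∂ n) p) p v) 0 = 0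

/-- A vector field on `M`, smooth up to the boundary. -/
def IsSmoothField [IsManifold (𝓡∂ n) ∞ M] (W : ∀ p : M, TangentSpace (𝓡∂ n) p) : Prop :=
  ContMDiff (𝓡∂ n) (𝓡∂ n).tangent ∞ (fun p : M => (⟨p, W p⟩ : TangentBundle (𝓡∂ n) M))

/-- The space `ν_b` of smooth vector fields on `M` that are tangent to `∂M` along `∂M`. -/
def IsBField [IsManifold (𝓡∂ n) ∞ M] (W : ∀ p : M, TangentSpace (𝓡∂ n) p) : Prop :=
  IsSmoothField W ∧ ∀ p ∈ (𝓡∂ n).boundary M, IsTangentToBoundary p (W p)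

/-- The space `ν_sc = x · ν_b` of scattering vector fields (it does not depend on the
boundary-defining function). -/
def IsScatteringField [IsManifold (𝓡∂ n) ∞ M] (V : ∀ p : M, TangentSpace (𝓡∂ n) p) : Prop :=
  ∃ (x : M → ℝ) (W : ∀ p : M, TangentSpace (𝓡∂ n) p),
    IsBoundaryDefining (n := n) x ∧ IsBField W ∧ ∀ p, V p = x p • W p

end Boundary

/-- A b-immersion `φ : X → X'`: a smooth immersion that maps `∂X` into `∂X'` and, at the points of
`∂X`, induces an injective map `T_pX / T_p∂X → T_{φ(p)}X' / T_{φ(p)}∂X'`. -/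
structure IsBImmersion {m n : ℕ} [NeZero m] [NeZero n]
    {X : Type*} [TopologicalSpace X] [ChartedSpace (EuclideanHalfSpace m) X]
    {X' : Type*} [TopologicalSpace X'] [ChartedSpace (EuclideanHalfSpace n) X']
    (φ : X → X') : Prop where
  smooth : ContMDiff (𝓡∂ m) (𝓡∂ n) ∞ φ
  immersion : ∀ p, Function.Injective (mfderiv (𝓡∂ m) (𝓡∂ n) φ p)
  map_boundary : ∀ p ∈ (𝓡∂ m).boundary X, φ p ∈ (𝓡∂ n).boundary X'
  transverse : ∀ p ∈ (𝓡∂ m).boundary X, ∀ v : TangentSpace (𝓡∂ m) p,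
    IsTangentToBoundary (φ p) (mfderiv (𝓡∂ m) (𝓡∂ n) φ p v) → IsTangentToBoundary p v

/-! ### Riemannian geometry in coordinates -/

section Coordinates

variable {n : ℕ}

/-- The Christoffel symbol
`Γ^k_{ij} = ½ ∑_l G^{kl} (∂_i G_{jl} + ∂_j G_{il} - ∂_l G_{ij})` of the metric
with coefficients `G`. -/
def christoffelSymbol (G : EuclideanSpace ℝ (Fin n) → Matrix (Fin n) (Fin n) ℝ)
    (u : EuclideanSpace ℝ (Fin n)) (k i j : Fin n) : ℝ :=
  (1 / 2 : ℝ) * ∑ l, (G u)⁻¹ k l *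
    (fderiv ℝ (fun u' => G u' j l) u (EuclideanSpace.single i 1)
      + fderiv ℝ (fun u' => G u' i l) u (EuclideanSpace.single j 1)
      - fderiv ℝ (fun u' => G u' i j) u (EuclideanSpace.single l 1))

/-- The vector `Γ(v, w)` with components `∑_{i,j} Γ^k_{ij} v^i w^j`. -/
def christoffel (G : EuclideanSpace ℝ (Fin n) → Matrix (Fin n) (Fin n) ℝ)
    (u v w : EuclideanSpace ℝ (Fin n)) : EuclideanSpace ℝ (Fin n) :=
  WithLp.toLp 2 fun k => ∑ i, ∑ j, christoffelSymbol G u k i j * v i * w j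

/-- The curvature tensor
`R(a, b) w = (D_a Γ)(b, w) - (D_b Γ)(a, w) + Γ(a, Γ(b, w)) - Γ(b, Γ(a, w))`, that is,
`R(A, B) W = ∇_A ∇_B W - ∇_B ∇_A W - ∇_{[A, B]} W`, in coordinates. -/
def coordCurvature (G : EuclideanSpace ℝ (Fin n) → Matrix (Fin n) (Fin n) ℝ)
    (u a b w : EuclideanSpace ℝ (Fin n)) : EuclideanSpace ℝ (Fin n) :=
  fderiv ℝ (fun u' => christoffel G u' b w) u a - fderiv ℝ (fun u' => christoffel G u' a w) u b
    + christoffel G u a (christoffel G u b w) - christoffel G u b (christoffel G u a w)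

end Coordinates

/-! ### Asymptotically conical metrics, covariant derivatives, geodesics and Jacobi fields

A symmetric 2-tensor is given by bilinear forms on all tangent spaces. A metric on the interior of
`M` is such a tensor of which only the values at interior points are used. -/

section Riemannian

variable {n : ℕ} [NeZero n] {M : Type*} [TopologicalSpace M]
  [ChartedSpace (EuclideanHalfSpace n) M] [IsManifold (𝓡∂ n) ∞ M]

/-- `g` is an asymptotically conical metric on `M`: it is a Riemannian metric on the interior and,
for some boundary-defining function `x`, some `a` and some symmetric 2-tensor `h`, both smooth up
to the boundary, with `h` positive definite on `T ∂M`,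
`g = (1 + x a) dx² / x⁴ + h / x²` on the interior. -/
def IsAsymptoticallyConical
    (g : ∀ p : M, TangentSpace (𝓡∂ n) p →L[ℝ] TangentSpace (𝓡∂ n) p →L[ℝ] ℝ) : Prop :=
  (∀ p ∈ (𝓡∂ n).interior M, ∀ v, v ≠ 0 → 0 < g p v v) ∧
  ∃ (x a : M → ℝ) (h : ∀ p : M, TangentSpace (𝓡∂ n) p →L[ℝ] TangentSpace (𝓡∂ n) p →L[ℝ] ℝ),
    IsBoundaryDefining (n := n) x ∧ ContMDiff (𝓡∂ n) 𝓘(ℝ, ℝ) ∞ a ∧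
    ContMDiff (𝓡∂ n)
      ((𝓡∂ n).prod 𝓘(ℝ, EuclideanSpace ℝ (Fin n) →L[ℝ] EuclideanSpace ℝ (Fin n) →L[ℝ] ℝ)) ∞
      (fun p : M => Bundle.TotalSpace.mk'
        (EuclideanSpace ℝ (Fin n) →L[ℝ] EuclideanSpace ℝ (Fin n) →L[ℝ] ℝ)
        (E := fun p : M => TangentSpace (𝓡∂ n) p →L[ℝ] TangentSpace (𝓡∂ n) p →L[ℝ] ℝ) p (h p)) ∧
    (∀ p v w, h p v w = h p w v) ∧
    (∀ p ∈ (𝓡∂ n).boundary M, ∀ v, IsTangentToBoundary p v → v ≠ 0 → 0 < h p v v) ∧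
    ∀ p ∈ (𝓡∂ n).interior M, ∀ v w,
      g p v w = (1 + x p * a p) * (diff x p v * diff x p w) / x p ^ 4 + h p v w / x p ^ 2

/-- The norm `‖v‖ = g(v, v)^{1/2}` of a tangent vector at `p`. -/
def gnorm (g : ∀ p : M, TangentSpace (𝓡∂ n) p →L[ℝ] TangentSpace (𝓡∂ n) p →L[ℝ] ℝ)
    (p : M) (v : TangentSpace (𝓡∂ n) p) : ℝ :=
  Real.sqrt (g p v v)

/-- The components, in the chart `e`, of a tangent vector `v` at `p`. -/
def chartVec (e : OpenPartialHomeomorph M (EuclideanHalfSpace n)) (p : M)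
    (v : TangentSpace (𝓡∂ n) p) : EuclideanSpace ℝ (Fin n) :=
  mfderiv (𝓡∂ n) 𝓘(ℝ, EuclideanSpace ℝ (Fin n)) (e.extend (𝓡∂ n)) p v

/-- The `i`-th coordinate vector field `∂_i` of the chart `e`, at the point with coordinates `u`. -/
def chartBasis (e : OpenPartialHomeomorph M (EuclideanHalfSpace n))
    (u : EuclideanSpace ℝ (Fin n)) (i : Fin n) :
    TangentSpace (𝓡∂ n) ((e.extend (𝓡∂ n)).symm u) :=
  mfderivWithin 𝓘(ℝ, EuclideanSpace ℝ (Fin n)) (𝓡∂ n) (e.extend (𝓡∂ n)).symm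
    (range (𝓡∂ n)) u (EuclideanSpace.single i (1 : ℝ) : EuclideanSpace ℝ (Fin n))

/-- The coefficients `g(∂_i, ∂_j)` of `g` in the chart `e`. -/
def chartMetric (g : ∀ p : M, TangentSpace (𝓡∂ n) p →L[ℝ] TangentSpace (𝓡∂ n) p →L[ℝ] ℝ)
    (e : OpenPartialHomeomorph M (EuclideanHalfSpace n)) (u : EuclideanSpace ℝ (Fin n)) :
    Matrix (Fin n) (Fin n) ℝ :=
  Matrix.of fun i j => g ((e.extend (𝓡∂ n)).symm u) (chartBasis e u i) (chartBasis e u j)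

/-- `w = ∇_v V` at the interior point `p`, for the Levi-Civita connection of `g`: in every chart
around `p`, `w = D_v V + Γ(v, V)`. -/
def IsCovDerivAt (g : ∀ p : M, TangentSpace (𝓡∂ n) p →L[ℝ] TangentSpace (𝓡∂ n) p →L[ℝ] ℝ)
    (V : ∀ p : M, TangentSpace (𝓡∂ n) p) (p : M) (v w : TangentSpace (𝓡∂ n) p) : Prop :=
  ∀ e ∈ IsManifold.maximalAtlas (𝓡∂ n) ∞ M, p ∈ e.source →
    chartVec e p w =
      fderiv ℝ (fun u => chartVec e ((e.extend (𝓡∂ n)).symm u) (V ((e.extend (𝓡∂ n)).symm u)))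
        (e.extend (𝓡∂ n) p) (chartVec e p v)
      + christoffel (chartMetric g e) (e.extend (𝓡∂ n) p) (chartVec e p v) (chartVec e p (V p))

/-- The curvature `R(a, b) w` of `g` at the interior point `p`, computed in the chart at `p`. -/
def curvature (g : ∀ p : M, TangentSpace (𝓡∂ n) p →L[ℝ] TangentSpace (𝓡∂ n) p →L[ℝ] ℝ)
    (p : M) (a b w : TangentSpace (𝓡∂ n) p) : TangentSpace (𝓡∂ n) p :=
  (mfderiv (𝓡∂ n) 𝓘(ℝ, EuclideanSpace ℝ (Fin n)) (extChartAt (𝓡∂ n) p) p).inverse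
    (coordCurvature (chartMetric g (chartAt (EuclideanHalfSpace n) p)) (extChartAt (𝓡∂ n) p p)
      (chartVec (chartAt (EuclideanHalfSpace n) p) p a)
      (chartVec (chartAt (EuclideanHalfSpace n) p) p b)
      (chartVec (chartAt (EuclideanHalfSpace n) p) p w))

/-- The norm of the curvature tensor at `p`, as a trilinear map, satisfies `‖R(p)‖ ≤ B`. -/
def CurvatureNormLE (g : ∀ p : M, TangentSpace (𝓡∂ n) p →L[ℝ] TangentSpace (𝓡∂ n) p →L[ℝ] ℝ)
    (p : M) (B : ℝ) : Prop :=
  ∀ a b w, gnorm g p (curvature g p a b w) ≤ B * gnorm g p a * gnorm g p b * gnorm g p w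

/-- The velocity of a curve. -/
def velocity (γ : ℝ → M) (s : ℝ) : TangentSpace (𝓡∂ n) (γ s) :=
  mfderiv 𝓘(ℝ, ℝ) (𝓡∂ n) γ s (1 : ℝ)

/-- `∇_s Y = DY` for vector fields `Y`, `DY` along the curve `γ` in the interior: in every chart,
`DY = dY/ds + Γ(dγ/ds, Y)`. -/
def IsCovDerivAlong (g : ∀ p : M, TangentSpace (𝓡∂ n) p →L[ℝ] TangentSpace (𝓡∂ n) p →L[ℝ] ℝ)
    (γ : ℝ → M) (Y DY : ∀ s, TangentSpace (𝓡∂ n) (γ s)) : Prop :=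
  ∀ e ∈ IsManifold.maximalAtlas (𝓡∂ n) ∞ M, ∀ s, γ s ∈ e.source →
    HasDerivAt (fun s' => chartVec e (γ s') (Y s'))
      (chartVec e (γ s) (DY s)
        - christoffel (chartMetric g e) (e.extend (𝓡∂ n) (γ s))
            (chartVec e (γ s) (velocity γ s)) (chartVec e (γ s) (Y s))) s

/-- `Y` is parallel along `γ`. -/
def IsParallelAlong (g : ∀ p : M, TangentSpace (𝓡∂ n) p →L[ℝ] TangentSpace (𝓡∂ n) p →L[ℝ] ℝ)
    (γ : ℝ → M) (Y : ∀ s, TangentSpace (𝓡∂ n) (γ s)) : Prop :=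
  IsCovDerivAlong g γ Y fun _ => 0

/-- `γ : ℝ → N` is a geodesic of the interior `N` of `M`. -/
def IsGeodesic (g : ∀ p : M, TangentSpace (𝓡∂ n) p →L[ℝ] TangentSpace (𝓡∂ n) p →L[ℝ] ℝ)
    (γ : ℝ → M) : Prop :=
  ContMDiff 𝓘(ℝ, ℝ) (𝓡∂ n) ∞ γ ∧ (∀ s, γ s ∈ (𝓡∂ n).interior M) ∧
    IsParallelAlong g γ (velocity γ)

/-- `J` is a Jacobi field along `γ`, with `∇_s J = DJ`: it satisfies
`∇_s ∇_s J + R(J, dγ/ds) dγ/ds = 0`. -/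
def IsJacobiField (g : ∀ p : M, TangentSpace (𝓡∂ n) p →L[ℝ] TangentSpace (𝓡∂ n) p →L[ℝ] ℝ)
    (γ : ℝ → M) (J DJ : ∀ s, TangentSpace (𝓡∂ n) (γ s)) : Prop :=
  IsCovDerivAlong g γ J DJ ∧
    IsCovDerivAlong g γ DJ fun s => -curvature g (γ s) (J s) (velocity γ s) (velocity γ s)

end Riemannian

end ScGeom

end

/-! The remainder `Q = J - A - s B` vanishes at `s = 0` together with its covariant derivative, and
its second covariant derivative is `-R(J, γ')γ'`. Integrating twice along `γ`, the norm of `Q` on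
`[0, 1]` is at most the supremum of `‖R‖ ‖J‖ ‖γ'‖²` (`IsJacobiField.gnorm_sub_le`). Three facts make
this supremum `O(ρ(t) t)`.

Bounded initial data (`IsConical.exists_initial_bound`): the lengths of `V`, of `dφ(Z)` and of `∇_Z
V` at `φ(t, y)` stay bounded as `t → 0`. In a boundary chart a scattering field has components
`O(x)`, while `dx` of it is `O(x²)`, which balances the weights `x⁻²` and `x⁻⁴` of the metric. For
`∇_Z V` the Koszul formula is paired with `∇_Z V` itself. The second derivatives of `x` then combine
into the derivative of `dx(V)` along `Z`, which is again `O(x²)`, and the lower bound for `g`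
(`IsConical.exists_elliptic`) controls the remaining slot.

No drift towards other scales: `|dx(v)| ≤ C x² ‖v‖` on the interior (`IsConical.exists_diff_le`), so
`1/x` is Lipschitz for `g`. The geodesic has bounded speed, hence for `0 ≤ s ≤ 1` the value of `1/x`
changes by a bounded amount. This gives `x(γ(s)) ≤ 2t` for small `t`, and the comparability of `ρ`
gives `ρ(x(γ(s))) ≤ L ρ(t)`. In `‖R‖ ≤ ρ · ρ` one factor is estimated by `L ρ(t)` and the other by a
multiple of `t`.

Bounded Jacobi fields: a Gronwall argument for `‖J‖² + ‖∇_s J‖²` (`IsCovDerivAlong.exists_gnorm_le`)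
bounds `J` on the unit interval, uniformly in `t`. The norm calculus along curves rests on metric
compatibility of the Christoffel symbols (`IsCovDerivAlong.hasDerivAt_metric`), another instance of
the Koszul formula. -/

noncomputable section

namespace ScGeom

set_option maxSynthPendingDepth 3
set_option linter.unusedSectionVars false

/-! ### Coordinates in the preferred charts -/

section Charts

variable {n : ℕ} [NeZero n] {M : Type*} [TopologicalSpace M]
  [ChartedSpace (EuclideanHalfSpace n) M]

/-- The components of tangent vectors at `p` in the chart at `q`. -/
def coord (q p : M) : TangentSpace (𝓡∂ n) p →L[ℝ] EuclideanSpace ℝ (Fin n) :=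
  mfderiv (𝓡∂ n) 𝓘(ℝ, EuclideanSpace ℝ (Fin n)) (extChartAt (𝓡∂ n) q) p

/-- The tangent vector with given components in the chart at `q`, at the point of
coordinates `u`. -/
def frame (q : M) (u : EuclideanSpace ℝ (Fin n)) :
    EuclideanSpace ℝ (Fin n) →L[ℝ] TangentSpace (𝓡∂ n) ((extChartAt (𝓡∂ n) q).symm u) :=
  mfderivWithin 𝓘(ℝ, EuclideanSpace ℝ (Fin n)) (𝓡∂ n) (extChartAt (𝓡∂ n) q).symm
    (range (𝓡∂ n)) u

/-- A tensor with two lower indices, in the coordinates of the chart at `q`. -/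
def localForm (g : ∀ p : M, TangentSpace (𝓡∂ n) p →L[ℝ] TangentSpace (𝓡∂ n) p →L[ℝ] ℝ)
    (q : M) (u : EuclideanSpace ℝ (Fin n)) :
    EuclideanSpace ℝ (Fin n) →L[ℝ] EuclideanSpace ℝ (Fin n) →L[ℝ] ℝ :=
  ((ContinuousLinearMap.precomp ℝ (frame q u)).comp (g ((extChartAt (𝓡∂ n) q).symm u))).comp
    (frame q u)

/-- A vector field in the coordinates of the chart at `q`. -/
def localField (W : ∀ p : M, TangentSpace (𝓡∂ n) p) (q : M) (u : EuclideanSpace ℝ (Fin n)) :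
    EuclideanSpace ℝ (Fin n) :=
  coord q ((extChartAt (𝓡∂ n) q).symm u) (W ((extChartAt (𝓡∂ n) q).symm u))

theorem chartVec_chartAt (q p : M) (v : TangentSpace (𝓡∂ n) p) :
    chartVec (chartAt (EuclideanHalfSpace n) q) p v = coord q p v := rfl

theorem localForm_apply (g : ∀ p : M, TangentSpace (𝓡∂ n) p →L[ℝ] TangentSpace (𝓡∂ n) p →L[ℝ] ℝ)
    (q : M) (u a b : EuclideanSpace ℝ (Fin n)) :
    localForm g q u a b = g ((extChartAt (𝓡∂ n) q).symm u) (frame q u a) (frame q u b) := rfl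

theorem chartMetric_chartAt
    (g : ∀ p : M, TangentSpace (𝓡∂ n) p →L[ℝ] TangentSpace (𝓡∂ n) p →L[ℝ] ℝ)
    (q : M) (u : EuclideanSpace ℝ (Fin n)) (i j : Fin n) :
    chartMetric g (chartAt (EuclideanHalfSpace n) q) u i j =
      localForm g q u (EuclideanSpace.single i 1) (EuclideanSpace.single j 1) := rfl

variable [IsManifold (𝓡∂ n) ∞ M]

theorem isManifold_one : IsManifold (𝓡∂ n) 1 M :=
  IsManifold.of_le (n := ∞) (by norm_cast)

theorem coord_frame (q : M) {u : EuclideanSpace ℝ (Fin n)} (hu : u ∈ (extChartAt (𝓡∂ n) q).target)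
    (a : EuclideanSpace ℝ (Fin n)) :
    coord q ((extChartAt (𝓡∂ n) q).symm u) (frame q u a) = a := by
  have := isManifold_one (n := n) (M := M)
  exact DFunLike.congr_fun (mfderiv_extChartAt_comp_mfderivWithin_extChartAt_symm hu) a

theorem frame_localField (q : M) {u : EuclideanSpace ℝ (Fin n)}
    (hu : u ∈ (extChartAt (𝓡∂ n) q).target)
    (v : TangentSpace (𝓡∂ n) ((extChartAt (𝓡∂ n) q).symm u)) :
    frame q u (coord q ((extChartAt (𝓡∂ n) q).symm u) v) = v := by
  have := isManifold_one (n := n) (M := M)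
  exact DFunLike.congr_fun (mfderivWithin_extChartAt_symm_comp_mfderiv_extChartAt hu) v

theorem localForm_coord
    (g : ∀ p : M, TangentSpace (𝓡∂ n) p →L[ℝ] TangentSpace (𝓡∂ n) p →L[ℝ] ℝ)
    (q : M) {p : M} (hp : p ∈ (extChartAt (𝓡∂ n) q).source) (v w : TangentSpace (𝓡∂ n) p) :
    localForm g q (extChartAt (𝓡∂ n) q p) (coord q p v) (coord q p w) = g p v w := by
  obtain ⟨u, hu, rfl⟩ : ∃ u ∈ (extChartAt (𝓡∂ n) q).target, (extChartAt (𝓡∂ n) q).symm u = p :=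
    ⟨_, (extChartAt (𝓡∂ n) q).map_source hp, (extChartAt (𝓡∂ n) q).left_inv hp⟩
  rw [(extChartAt (𝓡∂ n) q).right_inv hu, localForm_apply, frame_localField q hu,
    frame_localField q hu]

theorem hasFDerivWithinAt_comp_symm {F : Type*} [NormedAddCommGroup F] [NormedSpace ℝ F]
    {f : M → F} (q : M) {u : EuclideanSpace ℝ (Fin n)}
    (hu : u ∈ (extChartAt (𝓡∂ n) q).target)
    (hf : MDifferentiableAt (𝓡∂ n) 𝓘(ℝ, F) f ((extChartAt (𝓡∂ n) q).symm u)) :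
    HasFDerivWithinAt (f ∘ (extChartAt (𝓡∂ n) q).symm)
      (ContinuousLinearMap.comp
        (mfderiv (𝓡∂ n) 𝓘(ℝ, F) f ((extChartAt (𝓡∂ n) q).symm u)) (frame q u) :
          EuclideanSpace ℝ (Fin n) →L[ℝ] F) (range (𝓡∂ n)) u := by
  have := isManifold_one (n := n) (M := M)
  have h1 := (mdifferentiableWithinAt_extChartAt_symm (I := 𝓡∂ n) (x := q) hu).hasMFDerivWithinAt
  exact (hf.hasMFDerivAt.comp_hasMFDerivWithinAt u h1).hasFDerivWithinAt

theorem mfderiv_apply_eq_fderivWithin {F : Type*} [NormedAddCommGroup F] [NormedSpace ℝ F]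
    {f : M → F} (q : M) {p : M} (hp : p ∈ (extChartAt (𝓡∂ n) q).source)
    (hf : MDifferentiableAt (𝓡∂ n) 𝓘(ℝ, F) f p) (v : TangentSpace (𝓡∂ n) p) :
    (mfderiv (𝓡∂ n) 𝓘(ℝ, F) f p v : F) =
      fderivWithin ℝ (f ∘ (extChartAt (𝓡∂ n) q).symm) (range (𝓡∂ n)) (extChartAt (𝓡∂ n) q p)
        (coord q p v) := by
  obtain ⟨u, hu, rfl⟩ : ∃ u ∈ (extChartAt (𝓡∂ n) q).target, (extChartAt (𝓡∂ n) q).symm u = p :=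
    ⟨_, (extChartAt (𝓡∂ n) q).map_source hp, (extChartAt (𝓡∂ n) q).left_inv hp⟩
  rw [(extChartAt (𝓡∂ n) q).right_inv hu, (hasFDerivWithinAt_comp_symm q hu hf).fderivWithin
    ((𝓡∂ n).uniqueDiffOn _ (extChartAt_target_subset_range q hu))]
  exact congrArg _ (frame_localField q hu v).symm

theorem contDiffOn_comp_symm {F : Type*} [NormedAddCommGroup F] [NormedSpace ℝ F]
    {f : M → F} (hf : ContMDiff (𝓡∂ n) 𝓘(ℝ, F) ∞ f) (q : M) :
    ContDiffOn ℝ ∞ (f ∘ (extChartAt (𝓡∂ n) q).symm) (extChartAt (𝓡∂ n) q).target :=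
  (hf.comp_contMDiffOn (contMDiffOn_extChartAt_symm q)).contDiffOn

/-- This is the tangent map of the smooth inverse chart applied to a constant field. Derivatives
within the target and within the whole half-space agree because derivatives within the target are
unique. -/
theorem contMDiffOn_frame (q : M) (a : EuclideanSpace ℝ (Fin n)) :
    ContMDiffOn 𝓘(ℝ, EuclideanSpace ℝ (Fin n)) (𝓡∂ n).tangent ∞
      (fun u => (⟨(extChartAt (𝓡∂ n) q).symm u, frame q u a⟩ : TangentBundle (𝓡∂ n) M))
      (extChartAt (𝓡∂ n) q).target := by
  have := isManifold_one (n := n) (M := M)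
  have hs : UniqueMDiffOn 𝓘(ℝ, EuclideanSpace ℝ (Fin n)) (extChartAt (𝓡∂ n) q).target :=
    (uniqueDiffOn_extChartAt_target q).uniqueMDiffOn
  have h1 := (contMDiffOn_extChartAt_symm (I := 𝓡∂ n) (n := ∞) q).contMDiffOn_tangentMapWithin
    (m := ∞) (by norm_cast) hs
  have h2 := fun u (_ : u ∈ (extChartAt (𝓡∂ n) q).target) =>
    (contMDiffWithinAt_vectorSpace_iff_contDiffWithinAt (𝕜 := ℝ) (n := ∞)
      (s := (extChartAt (𝓡∂ n) q).target) (x := u)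
      (V := fun _ : EuclideanSpace ℝ (Fin n) => a)).2 contDiffWithinAt_const
  refine ContMDiffOn.congr (h1.comp h2 fun u hu => hu) fun u hu => ?_
  have h3 := (mdifferentiableWithinAt_extChartAt_symm (I := 𝓡∂ n) (x := q) hu).mfderivWithin_mono
    (hs u hu) (extChartAt_target_subset_range q)
  exact congrArg (fun L => (⟨(extChartAt (𝓡∂ n) q).symm u, L a⟩ : TangentBundle (𝓡∂ n) M)) h3.symm

theorem contDiffOn_localField {W : ∀ p : M, TangentSpace (𝓡∂ n) p} (hW : IsSmoothField W) (q : M) :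
    ContDiffOn ℝ ∞ (localField W q) (extChartAt (𝓡∂ n) q).target := by
  have := isManifold_one (n := n) (M := M)
  have hs : UniqueMDiffOn (𝓡∂ n) (chartAt (EuclideanHalfSpace n) q).source :=
    (chartAt (EuclideanHalfSpace n) q).open_source.uniqueMDiffOn
  have h1 := (contMDiffOn_extChartAt (I := 𝓡∂ n) (n := ∞) (x := q)).contMDiffOn_tangentMapWithin
    (m := ∞) (by norm_cast) hs
  have h2 := (hW.contMDiffOn (s := univ)).comp (contMDiffOn_extChartAt_symm (I := 𝓡∂ n) (n := ∞) q)
    (fun _ _ => mem_univ _)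
  have h3 := h1.comp h2 (fun u hu => by
    simpa using (extChartAt (𝓡∂ n) q).map_target hu)
  have h4 := (contMDiff_snd_tangentBundle_modelSpace (n := ∞) (EuclideanSpace ℝ (Fin n))
    𝓘(ℝ, EuclideanSpace ℝ (Fin n))).comp_contMDiffOn h3
  rw [← contMDiffOn_iff_contDiffOn]
  refine h4.congr fun u hu => ?_
  have h5 := mfderivWithin_of_isOpen (I := 𝓡∂ n) (I' := 𝓘(ℝ, EuclideanSpace ℝ (Fin n)))
    (f := extChartAt (𝓡∂ n) q) (chartAt (EuclideanHalfSpace n) q).open_source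
    (x := (extChartAt (𝓡∂ n) q).symm u)
    (by simpa using (extChartAt (𝓡∂ n) q).map_target hu)
  exact congrArg (fun L => L (W ((extChartAt (𝓡∂ n) q).symm u))) h5.symm

/-- Smoothness of a form with values in finite-dimensional linear maps can be tested on constant
vectors, where it reduces to evaluating the smooth tensor on smooth frame fields. -/
theorem contDiffOn_localForm
    {h : ∀ p : M, TangentSpace (𝓡∂ n) p →L[ℝ] TangentSpace (𝓡∂ n) p →L[ℝ] ℝ}
    (hh : ContMDiff (𝓡∂ n)
      ((𝓡∂ n).prod 𝓘(ℝ, EuclideanSpace ℝ (Fin n) →L[ℝ] EuclideanSpace ℝ (Fin n) →L[ℝ] ℝ)) ∞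
      (fun p : M => Bundle.TotalSpace.mk'
        (EuclideanSpace ℝ (Fin n) →L[ℝ] EuclideanSpace ℝ (Fin n) →L[ℝ] ℝ)
        (E := fun p : M => TangentSpace (𝓡∂ n) p →L[ℝ] TangentSpace (𝓡∂ n) p →L[ℝ] ℝ) p (h p)))
    (q : M) : ContDiffOn ℝ ∞ (localForm h q) (extChartAt (𝓡∂ n) q).target := by
  rw [contDiffOn_clm_apply]
  intro a
  rw [contDiffOn_clm_apply]
  intro b
  rw [← contMDiffOn_iff_contDiffOn]
  intro u hu
  have h1 := (hh.contMDiffOn (s := univ)).comp (contMDiffOn_extChartAt_symm (I := 𝓡∂ n) (n := ∞) q)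
    (fun _ _ => mem_univ _) u hu
  have h2 := ContMDiffWithinAt.clm_bundle_apply₂
    (F₁ := EuclideanSpace ℝ (Fin n)) (F₂ := EuclideanSpace ℝ (Fin n)) (F₃ := ℝ)
    (E₃ := Bundle.Trivial M ℝ) (n := ∞)
     h1 (contMDiffOn_frame q a u hu) (contMDiffOn_frame q b u hu)
  simp only [Bundle.contMDiffWithinAt_totalSpace] at h2
  exact h2.2

theorem mem_interior_iff (q : M) {p : M} (hp : p ∈ (extChartAt (𝓡∂ n) q).source) :
    p ∈ (𝓡∂ n).interior M ↔ 0 < (extChartAt (𝓡∂ n) q p) 0 := by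
  have := isManifold_one (n := n) (M := M)
  have h := (𝓡∂ n).isInteriorPoint_iff_of_mem_atlas (n := 1) one_ne_zero
    (chart_mem_atlas (EuclideanHalfSpace n) q) (by rwa [extChartAt_source] at hp)
  refine Iff.trans h ⟨fun h1 => ?_, fun h1 => ?_⟩
  · have h2 := interior_mono (extChartAt_target_subset_range (I := 𝓡∂ n) q) h1
    rw [interior_range_modelWithCornersEuclideanHalfSpace] at h2
    exact h2
  · have h2 := extChartAt_target_mem_nhdsWithin_of_mem ((extChartAt (𝓡∂ n) q).map_source hp)
    rw [nhdsWithin_eq_nhds.2] at h2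
    · exact mem_interior_iff_mem_nhds.2 h2
    · rw [← mem_interior_iff_mem_nhds, interior_range_modelWithCornersEuclideanHalfSpace]
      exact h1

end Charts

/-! ### The Koszul formula in coordinates -/

section Koszul

variable {n : ℕ}

theorem sum_smul_single (v : EuclideanSpace ℝ (Fin n)) :
    ∑ i, v i • EuclideanSpace.single i (1 : ℝ) = v := by
  have := (EuclideanSpace.basisFun (Fin n) ℝ).sum_repr v
  simpa using this

/-- Pairing with `G` cancels the inverse matrix in the Christoffel symbols. Later estimates
therefore need only `G` and its first derivatives, never bounds on the inverse of a metric that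
degenerates at the boundary. -/
theorem koszul_christoffel
    {G : EuclideanSpace ℝ (Fin n) → EuclideanSpace ℝ (Fin n) →L[ℝ] EuclideanSpace ℝ (Fin n) →L[ℝ] ℝ}
    {u : EuclideanSpace ℝ (Fin n)} (hG : DifferentiableAt ℝ G u)
    (hsymm : ∀ a b, G u a b = G u b a) (hpos : ∀ a, a ≠ 0 → 0 < G u a a)
    {m : EuclideanSpace ℝ (Fin n) → Matrix (Fin n) (Fin n) ℝ}
    (hm : ∀ u i j, m u i j = G u (EuclideanSpace.single i 1) (EuclideanSpace.single j 1))
    (v w ξ : EuclideanSpace ℝ (Fin n)) :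
    2 * G u (christoffel m u v w) ξ =
      fderiv ℝ G u v w ξ + fderiv ℝ G u w v ξ - fderiv ℝ G u ξ v w := by
  set D := fderiv ℝ G u with hD
  have hd : ∀ i j c, fderiv ℝ (fun u' => m u' i j) u c =
      D c (EuclideanSpace.single i 1) (EuclideanSpace.single j 1) := by
    intro i j c
    simp only [hm]
    have h1 : HasFDerivAt (fun u' => G u' (EuclideanSpace.single i 1) (EuclideanSpace.single j 1))
        _ u := (hG.hasFDerivAt.clm_apply (hasFDerivAt_const (EuclideanSpace.single i 1) u)).clm_apply
          (hasFDerivAt_const (EuclideanSpace.single j 1) u)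
    rw [h1.fderiv]
    simp [hD]
  -- A kernel vector of the Gram matrix would be a nonzero null vector of the positive form.
  have hdet : IsUnit (m u).det := by
    rw [isUnit_iff_ne_zero]
    intro h0
    obtain ⟨z, hz, hz0⟩ := Matrix.exists_mulVec_eq_zero_iff.2 h0
    have h1 : G u (WithLp.toLp 2 z) (WithLp.toLp 2 z) = z ⬝ᵥ (m u).mulVec z := by
      conv_lhs => rw [← sum_smul_single (WithLp.toLp 2 z)]
      simp only [map_sum, map_smul, sum_apply, smul_apply,
        dotProduct, Matrix.mulVec, smul_eq_mul, hm, Finset.mul_sum]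
      rw [Finset.sum_comm]
      refine Finset.sum_congr rfl fun i _ => Finset.sum_congr rfl fun j _ => ?_
      ring
    have h2 := hpos (WithLp.toLp 2 z) (by simpa using hz)
    rw [h1, hz0] at h2
    simp at h2
  set Λ : Fin n → ℝ := fun l => D v w (EuclideanSpace.single l 1) + D w v (EuclideanSpace.single l 1)
    - D (EuclideanSpace.single l 1) v w with hΛ
  have hexp : ∀ l, Λ l = ∑ i, ∑ j, (fderiv ℝ (fun u' => m u' j l) u (EuclideanSpace.single i 1)
      + fderiv ℝ (fun u' => m u' i l) u (EuclideanSpace.single j 1)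
      - fderiv ℝ (fun u' => m u' i j) u (EuclideanSpace.single l 1)) * v i * w j := by
    intro l
    simp only [hd, hΛ]
    conv_lhs => rw [← sum_smul_single v, ← sum_smul_single w]
    simp only [map_sum, map_smul, sum_apply, smul_apply,
      smul_eq_mul, Finset.mul_sum]
    rw [Finset.sum_comm (f := fun j i => w j * (v i * _))]
    rw [Finset.sum_comm (f := fun j i => w j * (v i * D (EuclideanSpace.single l 1) _ _))]
    simp only [← Finset.sum_add_distrib, ← Finset.sum_sub_distrib]
    refine Finset.sum_congr rfl fun i _ => Finset.sum_congr rfl fun j _ => ?_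
    ring
  have hΓ : ∀ k, christoffel m u v w k = (1 / 2 : ℝ) * ((m u)⁻¹.mulVec Λ) k := by
    intro k
    simp only [christoffel, christoffelSymbol, Matrix.mulVec, dotProduct, hexp, Finset.mul_sum,
      Finset.sum_mul]
    rw [Finset.sum_comm (f := fun l i => ∑ j, (1 / 2 : ℝ) * ((m u)⁻¹ k l * _))]
    refine Finset.sum_congr rfl fun i _ => ?_
    rw [Finset.sum_comm]
    refine Finset.sum_congr rfl fun l _ => Finset.sum_congr rfl fun j _ => ?_
    ring
  have hl : ∀ l, 2 * G u (christoffel m u v w) (EuclideanSpace.single l 1) = Λ l := by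
    intro l
    have h3 : (m u).mulVec ((m u)⁻¹.mulVec Λ) l = Λ l := by
      rw [Matrix.mulVec_mulVec, Matrix.mul_nonsing_inv _ hdet, Matrix.one_mulVec]
    rw [← h3, ← sum_smul_single (christoffel m u v w), map_sum, sum_apply,
      Finset.mul_sum, Matrix.mulVec, dotProduct]
    refine Finset.sum_congr rfl fun k _ => ?_
    rw [map_smul, smul_apply, hΓ, hm, hsymm, smul_eq_mul]
    ring
  conv_lhs => rw [← sum_smul_single ξ]
  conv_rhs => rw [← sum_smul_single ξ]
  simp only [map_sum, map_smul, sum_apply, smul_apply,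
    smul_eq_mul, Finset.mul_sum, ← Finset.sum_add_distrib, ← Finset.sum_sub_distrib]
  refine Finset.sum_congr rfl fun l _ => ?_
  have := hl l
  simp only [hΛ] at this
  linear_combination ξ l * this

theorem hasDerivAt_line {F F' : Type*} [NormedAddCommGroup F] [NormedSpace ℝ F]
    [NormedAddCommGroup F'] [NormedSpace ℝ F'] {f : F → F'} {u : F} (hf : DifferentiableAt ℝ f u)
    (c : F) : HasDerivAt (fun s : ℝ => f (u + s • c)) (fderiv ℝ f u c) 0 := by
  have hl : HasDerivAt (fun s : ℝ => u + s • c) c 0 := by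
    simpa using ((hasDerivAt_id (0 : ℝ)).smul_const c).const_add u
  exact HasFDerivAt.comp_hasDerivAt_of_eq (0 : ℝ) hf.hasFDerivAt hl (by simp)

theorem hasDerivAt_line_apply {F F' : Type*} [NormedAddCommGroup F] [NormedSpace ℝ F]
    [NormedAddCommGroup F'] [NormedSpace ℝ F'] {f : F → F →L[ℝ] F'} {u : F}
    (hf : DifferentiableAt ℝ f u) (c a : F) :
    HasDerivAt (fun s : ℝ => f (u + s • c) a) (fderiv ℝ f u c a) 0 := by
  simpa using (hasDerivAt_line hf c).clm_apply (hasDerivAt_const 0 a)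

theorem hasDerivAt_line_apply₂ {F F' : Type*} [NormedAddCommGroup F] [NormedSpace ℝ F]
    [NormedAddCommGroup F'] [NormedSpace ℝ F'] {f : F → F →L[ℝ] F →L[ℝ] F'} {u : F}
    (hf : DifferentiableAt ℝ f u) (c a b : F) :
    HasDerivAt (fun s : ℝ => f (u + s • c) a b) (fderiv ℝ f u c a b) 0 := by
  simpa using (hasDerivAt_line_apply hf c a).clm_apply (hasDerivAt_const 0 b)

theorem hasDerivAt_conical {α A B H X : ℝ → ℝ} {α' A' B' H' X' s : ℝ} (hα : HasDerivAt α α' s)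
    (hA : HasDerivAt A A' s) (hB : HasDerivAt B B' s) (hH : HasDerivAt H H' s)
    (hX : HasDerivAt X X' s) (hX0 : X s ≠ 0) :
    HasDerivAt (fun s => α s * (A s * B s) / X s ^ 4 + H s / X s ^ 2)
      ((α' * (A s * B s) + α s * (A' * B s + A s * B')) / X s ^ 4
        - 4 * (α s * (A s * B s)) * X' / X s ^ 5 + H' / X s ^ 2 - 2 * H s * X' / X s ^ 3) s := by
  have h2 := ((hα.fun_mul (hA.fun_mul hB)).fun_div (hX.fun_pow 4) (pow_ne_zero 4 hX0)).fun_add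
    (hH.fun_div (hX.fun_pow 2) (pow_ne_zero 2 hX0))
  refine h2.congr_deriv ?_
  field_simp
  push_cast
  ring

/-- Restricting to the line through `u` in direction `c` turns this into the one-variable quotient
rule, and uniqueness of derivatives transfers the result back. -/
theorem fderiv_conical {F : Type*} [NormedAddCommGroup F] [NormedSpace ℝ F]
    {G h : F → F →L[ℝ] F →L[ℝ] ℝ} {X α : F → ℝ} {u : F} (hG : DifferentiableAt ℝ G u)
    (hX : ContDiffAt ℝ 2 X u) (hα : DifferentiableAt ℝ α u) (hh : DifferentiableAt ℝ h u)
    (hX0 : X u ≠ 0)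
    (hGe : ∀ᶠ u' in 𝓝 u, ∀ a b, G u' a b =
      α u' * (fderiv ℝ X u' a * fderiv ℝ X u' b) / X u' ^ 4 + h u' a b / X u' ^ 2) (c a b : F) :
    fderiv ℝ G u c a b =
      (fderiv ℝ α u c * (fderiv ℝ X u a * fderiv ℝ X u b)
        + α u * (fderiv ℝ (fderiv ℝ X) u c a * fderiv ℝ X u b
          + fderiv ℝ X u a * fderiv ℝ (fderiv ℝ X) u c b)) / X u ^ 4
      - 4 * (α u * (fderiv ℝ X u a * fderiv ℝ X u b)) * fderiv ℝ X u c / X u ^ 5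
      + fderiv ℝ h u c a b / X u ^ 2 - 2 * h u a b * fderiv ℝ X u c / X u ^ 3 := by
  have hu : u + (0 : ℝ) • c = u := by simp
  have hdX : DifferentiableAt ℝ (fderiv ℝ X) u :=
    (hX.fderiv_right (m := 1) (by norm_num)).differentiableAt (by norm_num)
  have hXs := hasDerivAt_line (hX.differentiableAt (by norm_num)) c
  have h2 := hasDerivAt_conical (hasDerivAt_line hα c) (hasDerivAt_line_apply hdX c a)
    (hasDerivAt_line_apply hdX c b) (hasDerivAt_line_apply₂ hh c a b) hXs (by rwa [hu])
  have h1 := hasDerivAt_line_apply₂ hG c a b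
  have ht : Tendsto (fun s : ℝ => u + s • c) (𝓝 0) (𝓝 u) := by
    have : Continuous fun s : ℝ => u + s • c := by fun_prop
    simpa using this.tendsto 0
  have h3 := h1.unique (h2.congr_of_eventuallyEq ?_)
  · rw [h3]
    simp only [hu]
  · filter_upwards [ht.eventually hGe] with s hs
    exact hs a b

/-- A count of powers of `r`. Once each quantity is divided by its weight, all negative powers
cancel. Two terms survive at order zero, those containing `F` and `h₁`, and the others keep a factor
`r ≤ 1`. The absolute values of the coefficients in `key` add up to 20. -/
theorem koszul_conical_bound {r K N α αv αV αξ Xv XV Xξ F h₁ h₂ h₃ h₄ k₁ k₂ k₃ : ℝ}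
    (hr : 0 < r) (hr1 : r ≤ 1) (hK : 1 ≤ K) (hN : 0 ≤ N) (hα : |α| ≤ K) (hαv : |αv| ≤ K * r)
    (hαV : |αV| ≤ K * r) (hαξ : |αξ| ≤ K * r * N) (hXv : |Xv| ≤ K * r ^ 2)
    (hXV : |XV| ≤ K * r ^ 2) (hXξ : |Xξ| ≤ K * r ^ 2 * N) (hF : |F| ≤ K * r ^ 2)
    (hh₁ : |h₁| ≤ K * r ^ 2 * N) (hh₂ : |h₂| ≤ K * r ^ 3 * N) (hh₃ : |h₃| ≤ K * r ^ 3 * N)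
    (hh₄ : |h₄| ≤ K * r ^ 3 * N) (hk₁ : |k₁| ≤ K * r ^ 2 * N) (hk₂ : |k₂| ≤ K * r ^ 2 * N)
    (hk₃ : |k₃| ≤ K * r ^ 2) :
    |2 * α * Xξ * (F - 2 * Xv * XV / r) / r ^ 4
      + (αv * (XV * Xξ) + αV * (Xv * Xξ) - αξ * (Xv * XV)) / r ^ 4
      + (2 * h₁ + h₂ + h₃ - h₄) / r ^ 2
      - 2 * (k₁ * Xv + k₂ * XV - k₃ * Xξ) / r ^ 3| ≤ 20 * K ^ 4 * N := by
  have hr0 := hr.ne'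
  have scale : ∀ {a B : ℝ} (k : ℕ), |a| ≤ B * r ^ k → ∃ b, a = b * r ^ k ∧ |b| ≤ B := by
    intro a B k h
    refine ⟨a / r ^ k, by field_simp, ?_⟩
    rw [abs_div, abs_of_pos (pow_pos hr k)]
    exact (div_le_iff₀ (pow_pos hr k)).2 h
  obtain ⟨av, rfl, bav⟩ := scale (B := K) 1 (by simpa using hαv)
  obtain ⟨aV, rfl, baV⟩ := scale (B := K) 1 (by simpa using hαV)
  obtain ⟨aξ, rfl, baξ⟩ := scale (B := K * N) 1 (hαξ.trans_eq (by ring))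
  obtain ⟨xv, rfl, bxv⟩ := scale (B := K) 2 hXv
  obtain ⟨xV, rfl, bxV⟩ := scale (B := K) 2 hXV
  obtain ⟨xξ, rfl, bxξ⟩ := scale (B := K * N) 2 (hXξ.trans_eq (by ring))
  obtain ⟨f, rfl, bf⟩ := scale (B := K) 2 hF
  obtain ⟨l₁, rfl, bl₁⟩ := scale (B := K * N) 2 (hh₁.trans_eq (by ring))
  obtain ⟨l₂, rfl, bl₂⟩ := scale (B := K * N) 3 (hh₂.trans_eq (by ring))
  obtain ⟨l₃, rfl, bl₃⟩ := scale (B := K * N) 3 (hh₃.trans_eq (by ring))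
  obtain ⟨l₄, rfl, bl₄⟩ := scale (B := K * N) 3 (hh₄.trans_eq (by ring))
  obtain ⟨m₁, rfl, bm₁⟩ := scale (B := K * N) 2 (hk₁.trans_eq (by ring))
  obtain ⟨m₂, rfl, bm₂⟩ := scale (B := K * N) 2 (hk₂.trans_eq (by ring))
  obtain ⟨m₃, rfl, bm₃⟩ := scale (B := K) 2 (hk₃.trans_eq (by ring))
  clear hαv hαV hαξ hXv hXV hXξ hF hh₁ hh₂ hh₃ hh₄ hk₁ hk₂ hk₃ scale
  have hK0 : 0 ≤ K := by linarith
  have hKN : 0 ≤ K * N := by positivity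
  have rab : |r| ≤ 1 := by rwa [abs_of_pos hr]
  have mul2 : ∀ {a b A B : ℝ}, |a| ≤ A → |b| ≤ B → |a * b| ≤ A * B := by
    intro a b A B ha hb
    rw [abs_mul]
    exact mul_le_mul ha hb (abs_nonneg _) ((abs_nonneg _).trans ha)
  have e1 := mul2 (mul2 hα bxξ) bf
  have e2 := mul2 (mul2 (mul2 (mul2 rab hα) bxξ) bxv) bxV
  have e3 := mul2 rab (mul2 bav (mul2 bxV bxξ))
  have e4 := mul2 rab (mul2 baV (mul2 bxv bxξ))
  have e5 := mul2 rab (mul2 baξ (mul2 bxv bxV))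
  have e6 := mul2 rab bl₂
  have e7 := mul2 rab bl₃
  have e8 := mul2 rab bl₄
  have e9 := mul2 rab (mul2 bm₁ bxv)
  have e10 := mul2 rab (mul2 bm₂ bxV)
  have e11 := mul2 rab (mul2 bm₃ bxξ)
  have key : 2 * α * (xξ * r ^ 2) * (f * r ^ 2 - 2 * (xv * r ^ 2) * (xV * r ^ 2) / r) / r ^ 4
      + (av * r ^ 1 * (xV * r ^ 2 * (xξ * r ^ 2)) + aV * r ^ 1 * (xv * r ^ 2 * (xξ * r ^ 2))
        - aξ * r ^ 1 * (xv * r ^ 2 * (xV * r ^ 2))) / r ^ 4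
      + (2 * (l₁ * r ^ 2) + l₂ * r ^ 3 + l₃ * r ^ 3 - l₄ * r ^ 3) / r ^ 2
      - 2 * (m₁ * r ^ 2 * (xv * r ^ 2) + m₂ * r ^ 2 * (xV * r ^ 2) - m₃ * r ^ 2 * (xξ * r ^ 2))
        / r ^ 3
      = 2 * (α * xξ * f) - 4 * (r * α * xξ * xv * xV) + r * (av * (xV * xξ)) + r * (aV * (xv * xξ))
        - r * (aξ * (xv * xV)) + 2 * l₁ + r * l₂ + r * l₃ - r * l₄
        - 2 * (r * (m₁ * xv)) - 2 * (r * (m₂ * xV)) + 2 * (r * (m₃ * xξ)) := by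
    field_simp
    ring
  rw [key]
  have p1 : K * N ≤ K ^ 4 * N :=
    mul_le_mul_of_nonneg_right (le_self_pow₀ hK (by norm_num)) hN
  have p2 : K ^ 3 * N ≤ K ^ 4 * N :=
    mul_le_mul_of_nonneg_right (pow_le_pow_right₀ hK (by norm_num)) hN
  have p3 : K ^ 2 * N ≤ K ^ 4 * N :=
    mul_le_mul_of_nonneg_right (pow_le_pow_right₀ hK (by norm_num)) hN
  clear bav baV baξ bxv bxV bxξ bf bl₂ bl₃ bl₄ bm₁ bm₂ bm₃ rab mul2 key hα
  rw [abs_le] at bl₁ e1 e2 e3 e4 e5 e6 e7 e8 e9 e10 e11 ⊢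
  constructor <;> linarith

/-- The norm `N` of `w = ∇_v V` is estimated by testing the Koszul formula on `w` itself: this gives
`2 N² ≤ 20 (K⁴)⁴ N`, and one factor `N` is divided out. -/
theorem sqrt_covDeriv_le
    {G h : EuclideanSpace ℝ (Fin n) →
      EuclideanSpace ℝ (Fin n) →L[ℝ] EuclideanSpace ℝ (Fin n) →L[ℝ] ℝ}
    {X α : EuclideanSpace ℝ (Fin n) → ℝ} {u : EuclideanSpace ℝ (Fin n)}
    {V : EuclideanSpace ℝ (Fin n) → EuclideanSpace ℝ (Fin n)}
    (hG : DifferentiableAt ℝ G u)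
    (hsymm : ∀ a b, G u a b = G u b a) (hpos : ∀ a, a ≠ 0 → 0 < G u a a)
    {m : EuclideanSpace ℝ (Fin n) → Matrix (Fin n) (Fin n) ℝ}
    (hm : ∀ u i j, m u i j = G u (EuclideanSpace.single i 1) (EuclideanSpace.single j 1))
    (hX : ContDiffAt ℝ 2 X u) (hα : DifferentiableAt ℝ α u) (hh : DifferentiableAt ℝ h u)
    (hV : DifferentiableAt ℝ V u)
    (hGe : ∀ᶠ u' in 𝓝 u, ∀ a b, G u' a b =
      α u' * (fderiv ℝ X u' a * fderiv ℝ X u' b) / X u' ^ 4 + h u' a b / X u' ^ 2)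
    {K : ℝ} (hK : 1 ≤ K) (hX0 : 0 < X u) (hX1 : X u ≤ 1) (v : EuclideanSpace ℝ (Fin n))
    (bα : |α u| ≤ K) (bα' : ‖fderiv ℝ α u‖ ≤ K) (bh : ∀ a b, |h u a b| ≤ K * ‖a‖ * ‖b‖)
    (bh' : ∀ a b c, |fderiv ℝ h u a b c| ≤ K * ‖a‖ * ‖b‖ * ‖c‖)
    (bv : ‖v‖ ≤ K * X u) (bV : ‖V u‖ ≤ K * X u) (bV' : ‖fderiv ℝ V u v‖ ≤ K * X u)
    (bXv : |fderiv ℝ X u v| ≤ K * X u ^ 2) (bXV : |fderiv ℝ X u (V u)| ≤ K * X u ^ 2)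
    (bF : |fderiv ℝ (fun u' => fderiv ℝ X u' (V u')) u v| ≤ K * X u ^ 2)
    (bξ : ∀ ξ, ‖ξ‖ ≤ K * X u * √(G u ξ ξ)) (bXξ : ∀ ξ, |fderiv ℝ X u ξ| ≤ K * X u ^ 2 * √(G u ξ ξ)) :
    √(G u (fderiv ℝ V u v + christoffel m u v (V u)) (fderiv ℝ V u v + christoffel m u v (V u)))
      ≤ 10 * (K ^ 4) ^ 4 := by
  set w := fderiv ℝ V u v + christoffel m u v (V u) with hw
  set N := √(G u w w) with hN
  have hdX : DifferentiableAt ℝ (fderiv ℝ X) u :=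
    (hX.fderiv_right (m := 1) (by norm_num)).differentiableAt (by norm_num)
  have hF : fderiv ℝ (fun u' => fderiv ℝ X u' (V u')) u v =
      fderiv ℝ (fderiv ℝ X) u v (V u) + fderiv ℝ X u (fderiv ℝ V u v) := by
    rw [(hdX.hasFDerivAt.clm_apply hV.hasFDerivAt).fderiv]
    simp [add_comm]
  -- By symmetry of the Hessian the terms with `D²X(v, w)` and `D²X(V, w)` cancel. Only `D²X(v, V)`
  -- remains, and `hF` joins it with `dX(D_v V)`.
  have hs : IsSymmSndFDerivAt ℝ X u := hX.isSymmSndFDerivAt (by simp)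
  have s1 := hs.eq v (V u)
  have s2 := hs.eq v w
  have s3 := hs.eq w (V u)
  have hk := koszul_christoffel hG hsymm hpos hm v (V u) w
  have hX0' := hX0.ne'
  have hfc := fun c a b => fderiv_conical hG hX hα hh hX0' hGe c a b
  rw [hfc, hfc, hfc] at hk
  have hG1 := hGe.self_of_nhds (fderiv ℝ V u v) w
  have key : 2 * G u w w = 2 * α u * fderiv ℝ X u w * (fderiv ℝ (fun u' => fderiv ℝ X u' (V u')) u v
        - 2 * fderiv ℝ X u v * fderiv ℝ X u (V u) / X u) / X u ^ 4
      + (fderiv ℝ α u v * (fderiv ℝ X u (V u) * fderiv ℝ X u w)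
        + fderiv ℝ α u (V u) * (fderiv ℝ X u v * fderiv ℝ X u w)
        - fderiv ℝ α u w * (fderiv ℝ X u v * fderiv ℝ X u (V u))) / X u ^ 4
      + (2 * h u (fderiv ℝ V u v) w + fderiv ℝ h u v (V u) w + fderiv ℝ h u (V u) v w
        - fderiv ℝ h u w v (V u)) / X u ^ 2
      - 2 * (h u (V u) w * fderiv ℝ X u v + h u v w * fderiv ℝ X u (V u)
        - h u v (V u) * fderiv ℝ X u w) / X u ^ 3 := by
    have e : 2 * G u w w = 2 * G u (fderiv ℝ V u v) w + 2 * G u (christoffel m u v (V u)) w := by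
      rw [← mul_add, ← add_apply, ← map_add]
    rw [e, hk, hG1, hF, ← s1, ← s2, s3]
    field_simp
    ring
  have hNn : 0 ≤ N := Real.sqrt_nonneg _
  have hK0 : 0 ≤ K := by linarith
  have hr0 : 0 ≤ X u := hX0.le
  have hww : 0 ≤ G u w w := by
    rcases eq_or_ne w 0 with h | h
    · simp [h]
    · exact (hpos w h).le
  have lin : ∀ {L : EuclideanSpace ℝ (Fin n) →L[ℝ] ℝ} {a : EuclideanSpace ℝ (Fin n)} {A B : ℝ},
      ‖L‖ ≤ A → ‖a‖ ≤ B → |L a| ≤ A * B := by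
    intro L a A B hL ha
    exact (L.le_opNorm a).trans (mul_le_mul hL ha (norm_nonneg _) ((norm_nonneg _).trans hL))
  have bil : ∀ {a b : EuclideanSpace ℝ (Fin n)} {B C : ℝ},
      ‖a‖ ≤ B → ‖b‖ ≤ C → |h u a b| ≤ K * B * C := by
    intro a b B C ha hb
    have hB := (norm_nonneg _).trans ha
    exact (bh a b).trans (by gcongr)
  have tri : ∀ {a b c : EuclideanSpace ℝ (Fin n)} {A B C : ℝ},
      ‖a‖ ≤ A → ‖b‖ ≤ B → ‖c‖ ≤ C → |fderiv ℝ h u a b c| ≤ K * A * B * C := by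
    intro a b c A B C ha hb hc
    have hA := (norm_nonneg _).trans ha
    have hB := (norm_nonneg _).trans hb
    exact (bh' a b c).trans (by gcongr)
  have bw := bξ w
  have bXw := bXξ w
  rw [← hN] at bw bXw
  -- `K ^ 4` is a common constant for all products below; the terms with the derivative of `h` use
  -- it in full.
  have k1 : K ≤ K ^ 4 := le_self_pow₀ hK (by norm_num)
  have k2 : K ^ 2 ≤ K ^ 4 := pow_le_pow_right₀ hK (by norm_num)
  have k3 : K ^ 3 ≤ K ^ 4 := pow_le_pow_right₀ hK (by norm_num)
  have fin := koszul_conical_bound (r := X u) (K := K ^ 4) (N := N) (α := α u)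
    (αv := fderiv ℝ α u v) (αV := fderiv ℝ α u (V u)) (αξ := fderiv ℝ α u w)
    (Xv := fderiv ℝ X u v) (XV := fderiv ℝ X u (V u)) (Xξ := fderiv ℝ X u w)
    (F := fderiv ℝ (fun u' => fderiv ℝ X u' (V u')) u v) (h₁ := h u (fderiv ℝ V u v) w)
    (h₂ := fderiv ℝ h u v (V u) w) (h₃ := fderiv ℝ h u (V u) v w) (h₄ := fderiv ℝ h u w v (V u))
    (k₁ := h u (V u) w) (k₂ := h u v w) (k₃ := h u v (V u)) hX0 hX1 (one_le_pow₀ hK) hNn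
    (bα.trans k1)
    ((lin bα' bv).trans (le_trans (by ring_nf; rfl) (mul_le_mul_of_nonneg_right k2 hr0)))
    ((lin bα' bV).trans (le_trans (by ring_nf; rfl) (mul_le_mul_of_nonneg_right k2 hr0)))
    ((lin bα' bw).trans (le_trans (b := K ^ 2 * X u * N) (by ring_nf; rfl) (by gcongr)))
    (bXv.trans (by gcongr)) (bXV.trans (by gcongr)) (bXw.trans (by gcongr)) (bF.trans (by gcongr))
    ((bil bV' bw).trans (le_trans (b := K ^ 3 * X u ^ 2 * N) (by ring_nf; rfl) (by gcongr)))
    ((tri bv bV bw).trans_eq (by ring))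
    ((tri bV bv bw).trans_eq (by ring))
    ((tri bw bv bV).trans_eq (by ring))
    ((bil bV bw).trans (le_trans (b := K ^ 3 * X u ^ 2 * N) (by ring_nf; rfl) (by gcongr)))
    ((bil bv bw).trans (le_trans (b := K ^ 3 * X u ^ 2 * N) (by ring_nf; rfl) (by gcongr)))
    ((bil bv bV).trans (le_trans (b := K ^ 3 * X u ^ 2) (by ring_nf; rfl) (by gcongr)))
  rw [← key, abs_of_nonneg (by positivity), ← Real.mul_self_sqrt hww, ← hN] at fin
  rcases hNn.eq_or_lt with h0 | h0
  · rw [← h0]; positivity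
  · refine le_of_mul_le_mul_right ?_ h0
    linarith

end Koszul

/-! ### Calculus on the half-space -/

section HalfSpace

variable {n : ℕ} [NeZero n] {F : Type*} [NormedAddCommGroup F] [NormedSpace ℝ F]

theorem mem_range_iff {u : EuclideanSpace ℝ (Fin n)} : u ∈ range (𝓡∂ n) ↔ 0 ≤ u 0 := by
  rw [range_modelWithCornersEuclideanHalfSpace]; rfl

theorem range_mem_nhds {u : EuclideanSpace ℝ (Fin n)} (hu : 0 < u 0) : range (𝓡∂ n) ∈ 𝓝 u := by
  rw [← mem_interior_iff_mem_nhds, interior_range_modelWithCornersEuclideanHalfSpace]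
  exact hu

/-- The projection of the half-space to its boundary. -/
def boundaryProj (u : EuclideanSpace ℝ (Fin n)) : EuclideanSpace ℝ (Fin n) :=
  u - u 0 • EuclideanSpace.single 0 1

theorem boundaryProj_zero (u : EuclideanSpace ℝ (Fin n)) : boundaryProj u 0 = 0 := by
  simp [boundaryProj]

theorem continuous_boundaryProj : Continuous (boundaryProj (n := n)) := by
  unfold boundaryProj; fun_prop

theorem tendsto_boundaryProj {u₀ : EuclideanSpace ℝ (Fin n)} (h₀ : u₀ 0 = 0) :
    Tendsto boundaryProj (𝓝[range (𝓡∂ n)] u₀) (𝓝[range (𝓡∂ n)] u₀) := by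
  refine tendsto_nhdsWithin_of_tendsto_nhds_of_eventually_within _ ?_
    (Eventually.of_forall fun u => mem_range_iff.2 (boundaryProj_zero u).ge)
  have := (continuous_boundaryProj (n := n)).tendsto u₀
  have e : boundaryProj u₀ = u₀ := by simp [boundaryProj, h₀]
  rw [e] at this
  exact this.mono_left nhdsWithin_le_nhds

/-- The line from `u` in direction `v` stays in the boundary hyperplane, where `f` vanishes near
`u`. -/
theorem fderivWithin_tangent_eq_zero {f : EuclideanSpace ℝ (Fin n) → F}
    {u v : EuclideanSpace ℝ (Fin n)}
    (hf : DifferentiableWithinAt ℝ f (range (𝓡∂ n)) u) (hu : u 0 = 0)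
    (hz : ∀ᶠ u' in 𝓝[range (𝓡∂ n)] u, u' 0 = 0 → f u' = 0) (hv : v 0 = 0) :
    fderivWithin ℝ f (range (𝓡∂ n)) u v = 0 := by
  have hl : HasDerivAt (fun s : ℝ => u + s • v) v 0 := by
    simpa using ((hasDerivAt_id (0 : ℝ)).smul_const v).const_add u
  have h0 : ∀ s : ℝ, (u + s • v) 0 = 0 := fun s => by simp [hu, hv]
  have hm : ∀ s : ℝ, u + s • v ∈ range (𝓡∂ n) := fun s => mem_range_iff.2 (h0 s).ge
  have h1 : HasDerivWithinAt (fun s : ℝ => f (u + s • v))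
      (fderivWithin ℝ f (range (𝓡∂ n)) u v) univ 0 :=
    HasFDerivWithinAt.comp_hasDerivWithinAt_of_eq (0 : ℝ) hf.hasFDerivWithinAt
      hl.hasDerivWithinAt (fun s _ => hm s) (by simp)
  have ht : Tendsto (fun s : ℝ => u + s • v) (𝓝 0) (𝓝[range (𝓡∂ n)] u) :=
    tendsto_nhdsWithin_of_tendsto_nhds_of_eventually_within _
      (by simpa using hl.continuousAt.tendsto) (Eventually.of_forall hm)
  have h2 : HasDerivAt (fun s : ℝ => f (u + s • v)) 0 0 := by
    refine (hasDerivAt_const (0 : ℝ) (0 : F)).congr_of_eventuallyEq ?_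
    filter_upwards [ht.eventually hz] with s hs
    exact hs (h0 s)
  exact (hasDerivWithinAt_univ.1 h1).unique h2

/-- The mean value inequality between a point and its projection to the boundary, inside a convex
half-ball on which the derivative is `δ`-close to its value at `u₀`. -/
theorem norm_sub_normal_derivative_le {f : EuclideanSpace ℝ (Fin n) → F}
    {u₀ : EuclideanSpace ℝ (Fin n)} (hf : ContDiffWithinAt ℝ 1 f (range (𝓡∂ n)) u₀)
    (h₀ : u₀ 0 = 0) (hz : ∀ᶠ u in 𝓝[range (𝓡∂ n)] u₀, u 0 = 0 → f u = 0) {δ : ℝ} (hδ : 0 < δ) :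
    ∀ᶠ u in 𝓝[range (𝓡∂ n)] u₀,
      ‖f u - u 0 • fderivWithin ℝ f (range (𝓡∂ n)) u₀ (EuclideanSpace.single 0 1)‖ ≤ δ * u 0 := by
  have hm₀ : u₀ ∈ range (𝓡∂ n) := mem_range_iff.2 h₀.ge
  have h1 : ∀ᶠ u in 𝓝[range (𝓡∂ n)] u₀, ContDiffWithinAt ℝ 1 f (range (𝓡∂ n)) u := by
    simpa only [insert_eq_of_mem hm₀] using hf.eventually (by simp)
  have h2 : ContinuousWithinAt (fderivWithin ℝ f (range (𝓡∂ n))) (range (𝓡∂ n)) u₀ :=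
    (hf.fderivWithin_right (m := 0) (𝓡∂ n).uniqueDiffOn (by norm_num) hm₀).continuousWithinAt
  have h3 : ∀ᶠ u in 𝓝[range (𝓡∂ n)] u₀,
      ‖fderivWithin ℝ f (range (𝓡∂ n)) u - fderivWithin ℝ f (range (𝓡∂ n)) u₀‖ < δ := by
    filter_upwards [h2 (Metric.ball_mem_nhds _ hδ)] with u hu
    simpa [dist_eq_norm] using hu
  obtain ⟨r, hr, hball⟩ := Metric.mem_nhdsWithin_iff.1 (h1.and h3)
  have hcv : Convex ℝ (Metric.ball u₀ r ∩ range (𝓡∂ n)) :=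
    (convex_ball _ _).inter (𝓡∂ n).convex_range
  have hmem : ∀ᶠ u in 𝓝[range (𝓡∂ n)] u₀, u ∈ Metric.ball u₀ r ∩ range (𝓡∂ n) :=
    inter_mem (mem_nhdsWithin_of_mem_nhds (Metric.ball_mem_nhds _ hr)) self_mem_nhdsWithin
  filter_upwards [hmem, (tendsto_boundaryProj h₀).eventually hmem,
    (tendsto_boundaryProj h₀).eventually hz] with u hu1 hu2 hu3
  have h4 := hcv.norm_image_sub_le_of_norm_hasFDerivWithin_le'
    (f := f) (f' := fderivWithin ℝ f (range (𝓡∂ n)))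
    (φ := fderivWithin ℝ f (range (𝓡∂ n)) u₀) (C := δ)
    (fun w hw => (((hball hw).1.differentiableWithinAt (by simp)).hasFDerivWithinAt).mono
      inter_subset_right)
    (fun w hw => (hball hw).2.le) hu2 hu1
  have h5 : u - boundaryProj u = u 0 • EuclideanSpace.single 0 1 := by simp [boundaryProj]
  rw [hu3 (boundaryProj_zero u), sub_zero, h5, map_smul, norm_smul] at h4
  have h6 : 0 ≤ u 0 := mem_range_iff.1 hu1.2
  simpa [abs_of_nonneg h6] using h4

theorem norm_le_mul_normal_coordinate {f : EuclideanSpace ℝ (Fin n) → F}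
    {u₀ : EuclideanSpace ℝ (Fin n)} (hf : ContDiffWithinAt ℝ 1 f (range (𝓡∂ n)) u₀)
    (h₀ : u₀ 0 = 0) (hz : ∀ᶠ u in 𝓝[range (𝓡∂ n)] u₀, u 0 = 0 → f u = 0) :
    ∃ K, 0 ≤ K ∧ ∀ᶠ u in 𝓝[range (𝓡∂ n)] u₀, ‖f u‖ ≤ K * u 0 := by
  refine ⟨‖fderivWithin ℝ f (range (𝓡∂ n)) u₀ (EuclideanSpace.single 0 1)‖ + 1, by positivity, ?_⟩
  filter_upwards [norm_sub_normal_derivative_le hf h₀ hz one_pos, self_mem_nhdsWithin] with u hu hm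
  have h6 : 0 ≤ u 0 := mem_range_iff.1 hm
  have := norm_le_norm_sub_add (f u)
    (u 0 • fderivWithin ℝ f (range (𝓡∂ n)) u₀ (EuclideanSpace.single 0 1))
  rw [norm_smul, Real.norm_of_nonneg h6] at this
  nlinarith

/-- Tangential derivatives vanish, so a nonzero differential has a nonzero normal derivative `d`.
Nonnegativity along the inward normal line forces `d > 0`, and an expansion with error `d / 2` times
the normal coordinate gives the lower bound. -/
theorem normal_coordinate_le {f : EuclideanSpace ℝ (Fin n) → ℝ}
    {u₀ : EuclideanSpace ℝ (Fin n)} (hf : ContDiffWithinAt ℝ 1 f (range (𝓡∂ n)) u₀)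
    (h₀ : u₀ 0 = 0) (hz : ∀ᶠ u in 𝓝[range (𝓡∂ n)] u₀, u 0 = 0 → f u = 0)
    (hpos : ∀ᶠ u in 𝓝[range (𝓡∂ n)] u₀, 0 ≤ f u)
    (hd : ∃ v, fderivWithin ℝ f (range (𝓡∂ n)) u₀ v ≠ 0) :
    0 < fderivWithin ℝ f (range (𝓡∂ n)) u₀ (EuclideanSpace.single 0 1) ∧
    ∃ c, 0 < c ∧ ∀ᶠ u in 𝓝[range (𝓡∂ n)] u₀, c * u 0 ≤ f u := by
  have hm₀ : u₀ ∈ range (𝓡∂ n) := mem_range_iff.2 h₀.ge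
  set d := fderivWithin ℝ f (range (𝓡∂ n)) u₀ (EuclideanSpace.single 0 1) with hd'
  have hd0 : d ≠ 0 := by
    intro h
    obtain ⟨v, hv⟩ := hd
    have h1 := fderivWithin_tangent_eq_zero (hf.differentiableWithinAt (by simp)) h₀ hz
      (boundaryProj_zero v)
    rw [boundaryProj, map_sub, map_smul, ← hd', h, smul_zero, sub_zero] at h1
    exact hv h1
  have h1 := norm_sub_normal_derivative_le hf h₀ hz (half_pos (abs_pos.2 hd0))
  rw [← hd'] at h1
  have hdpos : 0 < d := by
    by_contra hneg
    have hneg' : d < 0 := lt_of_le_of_ne (not_lt.1 hneg) hd0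
    have ht : Tendsto (fun s : ℝ => u₀ + s • EuclideanSpace.single (0 : Fin n) (1 : ℝ)) (𝓝[>] 0)
        (𝓝[range (𝓡∂ n)] u₀) := by
      refine tendsto_nhdsWithin_of_tendsto_nhds_of_eventually_within _ ?_ ?_
      · have : Continuous fun s : ℝ => u₀ + s • EuclideanSpace.single (0 : Fin n) (1 : ℝ) := by
          fun_prop
        simpa using (this.tendsto 0).mono_left nhdsWithin_le_nhds
      · filter_upwards [self_mem_nhdsWithin] with s hs
        have hs' : (0 : ℝ) < s := hs
        exact mem_range_iff.2 (by simp [h₀, hs'.le])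
    obtain ⟨s, hs1, hs2, hs3⟩ :=
      ((ht.eventually h1).and ((ht.eventually hpos).and self_mem_nhdsWithin)).exists
    have hs' : (0 : ℝ) < s := hs3
    have e : (u₀ + s • EuclideanSpace.single (0 : Fin n) (1 : ℝ)) 0 = s := by simp [h₀]
    rw [e, Real.norm_eq_abs, abs_le, abs_of_neg hneg', smul_eq_mul] at hs1
    nlinarith [hs1.2]
  refine ⟨hdpos, d / 2, half_pos hdpos, ?_⟩
  filter_upwards [h1] with u hu
  rw [Real.norm_eq_abs, abs_le, abs_of_pos hdpos, smul_eq_mul] at hu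
  linarith [hu.1]

/-- Near a boundary point, `dX - (∂₀X) du₀` is `O(u₀)` if `X` vanishes on the boundary. -/
theorem fderivWithin_sub_normal_le {f : EuclideanSpace ℝ (Fin n) → ℝ}
    {u₀ : EuclideanSpace ℝ (Fin n)} (hf : ContDiffWithinAt ℝ 2 f (range (𝓡∂ n)) u₀)
    (h₀ : u₀ 0 = 0) (hz : ∀ᶠ u in 𝓝[range (𝓡∂ n)] u₀, u 0 = 0 → f u = 0) :
    ∃ K, 0 ≤ K ∧ ∀ᶠ u in 𝓝[range (𝓡∂ n)] u₀, ∀ v : EuclideanSpace ℝ (Fin n),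
      |fderivWithin ℝ f (range (𝓡∂ n)) u v
        - v 0 * fderivWithin ℝ f (range (𝓡∂ n)) u (EuclideanSpace.single 0 1)|
          ≤ K * u 0 * ‖v‖ := by
  have hm₀ : u₀ ∈ range (𝓡∂ n) := mem_range_iff.2 h₀.ge
  set L : EuclideanSpace ℝ (Fin n) → EuclideanSpace ℝ (Fin n) →L[ℝ] ℝ := fun u =>
    fderivWithin ℝ f (range (𝓡∂ n)) u
      - fderivWithin ℝ f (range (𝓡∂ n)) u (EuclideanSpace.single 0 1) • EuclideanSpace.proj 0 with hL
  have hd : ContDiffWithinAt ℝ 1 (fderivWithin ℝ f (range (𝓡∂ n))) (range (𝓡∂ n)) u₀ :=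
    hf.fderivWithin_right (m := 1) (𝓡∂ n).uniqueDiffOn (by norm_num) hm₀
  have hLd : ContDiffWithinAt ℝ 1 L (range (𝓡∂ n)) u₀ :=
    hd.sub ((hd.clm_apply contDiffWithinAt_const).smul contDiffWithinAt_const)
  have h1 : ∀ᶠ u in 𝓝[range (𝓡∂ n)] u₀, ContDiffWithinAt ℝ 2 f (range (𝓡∂ n)) u := by
    simpa only [insert_eq_of_mem hm₀] using hf.eventually (by simp)
  -- `L` is the tangential part of the differential. It vanishes on the boundary, so it is itself
  -- bounded by the normal coordinate.
  obtain ⟨K, hK, h2⟩ := norm_le_mul_normal_coordinate hLd h₀ (by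
    filter_upwards [h1, eventually_eventually_nhdsWithin.2 hz] with u hu hzu hu0
    ext v
    have h3 := fderivWithin_tangent_eq_zero (hu.differentiableWithinAt (by simp)) hu0 hzu
      (boundaryProj_zero v)
    rw [boundaryProj, map_sub, map_smul, smul_eq_mul] at h3
    simp only [hL, sub_apply, smul_apply, PiLp.proj_apply, smul_eq_mul, zero_apply]
    linarith)
  refine ⟨K, hK, ?_⟩
  filter_upwards [h2] with u hu v
  have h3 := (L u).le_of_opNorm_le hu v
  rw [Real.norm_eq_abs] at h3
  rwa [hL, sub_apply, smul_apply, PiLp.proj_apply, smul_eq_mul, mul_comm _ (v 0)] at h3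

end HalfSpace

/-! ### Positive definite forms -/

section Forms

variable {F : Type*} [NormedAddCommGroup F] [NormedSpace ℝ F]

/-- Compactness of the unit sphere: where `h v v ≤ 0`, the function `l²` has a positive lower bound
`m`, so `Λ = (‖h‖ + 1) / m` outweighs the negative part of `h`. A second minimum over the sphere and
homogeneity give `c`. -/
theorem exists_coercive_add [FiniteDimensional ℝ F] (h : F →L[ℝ] F →L[ℝ] ℝ) (l : F →L[ℝ] ℝ)
    (hpos : ∀ v, l v = 0 → v ≠ 0 → 0 < h v v) :
    ∃ Λ c : ℝ, 0 < c ∧ 0 ≤ Λ ∧ ∀ v, c * ‖v‖ ^ 2 ≤ h v v + Λ * l v ^ 2 := by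
  have hq : Continuous fun v => h v v := h.continuous.clm_apply continuous_id
  have hcS : IsCompact (Metric.sphere (0 : F) 1) := isCompact_sphere _ _
  obtain ⟨m, hm, hm'⟩ := (hcS.inter_right (isClosed_le hq continuous_const)).exists_forall_le'
    (f := fun v => l v ^ 2) (s := Metric.sphere (0 : F) 1 ∩ {v | h v v ≤ 0}) (a := 0)
    (by fun_prop) (fun v hv => by
      have hv0 : v ≠ 0 := ne_zero_of_mem_unit_sphere ⟨v, hv.1⟩
      have : l v ≠ 0 := fun h0 => not_lt.2 hv.2 (hpos v h0 hv0)
      positivity)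
  have hb : ∀ v, ‖v‖ = 1 → -‖h‖ ≤ h v v := by
    intro v hv
    have := (h v).le_opNorm v
    have h2 := h.le_opNorm v
    rw [hv, mul_one] at this h2
    have h3 := neg_abs_le (h v v)
    rw [Real.norm_eq_abs] at this
    linarith
  set Λ := (‖h‖ + 1) / m with hΛ
  have hΛ0 : 0 ≤ Λ := by positivity
  obtain ⟨c, hc, hc'⟩ := hcS.exists_forall_le' (f := fun v => h v v + Λ * l v ^ 2) (a := 0)
    (by fun_prop) (fun v hv => by
      rcases le_or_gt (h v v) 0 with h0 | h0
      · have h1 := hm' v ⟨hv, h0⟩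
        have h2 := hb v (by simpa using hv)
        have h3 : Λ * m = ‖h‖ + 1 := by rw [hΛ]; field_simp
        have h4 : Λ * m ≤ Λ * l v ^ 2 := mul_le_mul_of_nonneg_left h1 hΛ0
        linarith
      · positivity)
  refine ⟨Λ, c, hc, hΛ0, fun v => ?_⟩
  rcases eq_or_ne v 0 with rfl | hv
  · simp
  · have hn : ‖v‖ ≠ 0 := norm_ne_zero_iff.2 hv
    have := hc' (‖v‖⁻¹ • v) (by simp [norm_smul, hn])
    simp only [map_smul, smul_apply, smul_eq_mul] at this
    have h2 : h v v + Λ * l v ^ 2 =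
        ‖v‖ ^ 2 * (‖v‖⁻¹ * (‖v‖⁻¹ * h v v) + Λ * (‖v‖⁻¹ * l v) ^ 2) := by
      field_simp
    rw [h2, mul_comm c]
    gcongr

theorem eventually_coercive {b : F → F →L[ℝ] F →L[ℝ] ℝ} {s : Set F} {u₀ : F} {c : ℝ} (hc : 0 < c)
    (hb : ContinuousWithinAt b s u₀) (h₀ : ∀ v, c * ‖v‖ ^ 2 ≤ b u₀ v v) :
    ∀ᶠ u in 𝓝[s] u₀, ∀ v, c / 2 * ‖v‖ ^ 2 ≤ b u v v := by
  have hn : ContinuousWithinAt (fun u => ‖b u - b u₀‖) s u₀ :=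
    (hb.sub continuousWithinAt_const).norm
  filter_upwards [hn.eventually_lt_const (u := c / 2) (by simpa using hc)] with u hu v
  have h1 : ‖b u - b u₀‖ ≤ c / 2 := hu.le
  have h2 := ((b u - b u₀) v).le_of_opNorm_le ((b u - b u₀).le_of_opNorm_le h1 v) v
  rw [sub_apply, sub_apply, Real.norm_eq_abs, abs_le] at h2
  have := h₀ v
  nlinarith [h2.1]

end Forms

/-! ### Boundary-defining functions in coordinates -/

section BoundaryDefining

variable {n : ℕ} [NeZero n] {M : Type*} [TopologicalSpace M]
  [ChartedSpace (EuclideanHalfSpace n) M] [IsManifold (𝓡∂ n) ∞ M]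

theorem mem_boundary_iff (q : M) {p : M} (hp : p ∈ (extChartAt (𝓡∂ n) q).source) :
    p ∈ (𝓡∂ n).boundary M ↔ (extChartAt (𝓡∂ n) q p) 0 = 0 := by
  have h1 : 0 ≤ (extChartAt (𝓡∂ n) q p) 0 :=
    mem_range_iff.1 (extChartAt_target_subset_range q ((extChartAt (𝓡∂ n) q).map_source hp))
  rw [← (𝓡∂ n).compl_interior, mem_compl_iff, mem_interior_iff q hp, not_lt]
  exact ⟨fun h => le_antisymm h h1, fun h => h.le⟩

theorem symm_mem_interior_iff (q : M) {u : EuclideanSpace ℝ (Fin n)}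
    (hu : u ∈ (extChartAt (𝓡∂ n) q).target) :
    (extChartAt (𝓡∂ n) q).symm u ∈ (𝓡∂ n).interior M ↔ 0 < u 0 := by
  rw [mem_interior_iff q ((extChartAt (𝓡∂ n) q).map_target hu), (extChartAt (𝓡∂ n) q).right_inv hu]

theorem symm_mem_boundary_iff (q : M) {u : EuclideanSpace ℝ (Fin n)}
    (hu : u ∈ (extChartAt (𝓡∂ n) q).target) :
    (extChartAt (𝓡∂ n) q).symm u ∈ (𝓡∂ n).boundary M ↔ u 0 = 0 := by
  rw [mem_boundary_iff q ((extChartAt (𝓡∂ n) q).map_target hu), (extChartAt (𝓡∂ n) q).right_inv hu]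

theorem exists_coord_eq (q : M) {p : M} (hp : p ∈ (extChartAt (𝓡∂ n) q).source)
    (a : EuclideanSpace ℝ (Fin n)) : ∃ v : TangentSpace (𝓡∂ n) p, coord q p v = a := by
  obtain ⟨u, hu, rfl⟩ : ∃ u ∈ (extChartAt (𝓡∂ n) q).target, (extChartAt (𝓡∂ n) q).symm u = p :=
    ⟨_, (extChartAt (𝓡∂ n) q).map_source hp, (extChartAt (𝓡∂ n) q).left_inv hp⟩
  exact ⟨frame q u a, coord_frame q hu a⟩

theorem target_mem_nhds (q : M) {u : EuclideanSpace ℝ (Fin n)}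
    (hu : u ∈ (extChartAt (𝓡∂ n) q).target) (h0 : 0 < u 0) :
    (extChartAt (𝓡∂ n) q).target ∈ 𝓝 u := by
  have h2 := extChartAt_target_mem_nhdsWithin_of_mem hu
  rwa [nhdsWithin_eq_nhds.2 (range_mem_nhds h0)] at h2

theorem contDiffWithinAt_range {F : Type*} [NormedAddCommGroup F] [NormedSpace ℝ F]
    {f : EuclideanSpace ℝ (Fin n) → F} (q : M)
    (hf : ContDiffOn ℝ ∞ f (extChartAt (𝓡∂ n) q).target) {u : EuclideanSpace ℝ (Fin n)}
    (hu : u ∈ (extChartAt (𝓡∂ n) q).target) : ContDiffWithinAt ℝ ∞ f (range (𝓡∂ n)) u :=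
  (hf u hu).mono_of_mem_nhdsWithin (extChartAt_target_mem_nhdsWithin_of_mem hu)

theorem diff_eq_fderivWithin {x : M → ℝ} (hx : ContMDiff (𝓡∂ n) 𝓘(ℝ, ℝ) ∞ x) (q : M) {p : M}
    (hp : p ∈ (extChartAt (𝓡∂ n) q).source) (v : TangentSpace (𝓡∂ n) p) :
    diff x p v = fderivWithin ℝ (x ∘ (extChartAt (𝓡∂ n) q).symm) (range (𝓡∂ n))
      (extChartAt (𝓡∂ n) q p) (coord q p v) :=
  mfderiv_apply_eq_fderivWithin q hp ((hx p).mdifferentiableAt (by simp)) v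

variable {x : M → ℝ}

theorem IsBoundaryDefining.pos (hx : IsBoundaryDefining (n := n) x) {p : M}
    (hp : p ∈ (𝓡∂ n).interior M) : 0 < x p := by
  refine lt_of_le_of_ne (hx.nonneg p) fun h => ?_
  have h1 := (hx.zero_iff p).1 h.symm
  rw [← (𝓡∂ n).compl_interior] at h1
  exact h1 hp

theorem eventually_symm_zero {F : Type*} [Zero F] {f : M → F} (hf : ∀ p ∈ (𝓡∂ n).boundary M, f p = 0)
    (q : M) {u : EuclideanSpace ℝ (Fin n)} (hu : u ∈ (extChartAt (𝓡∂ n) q).target) :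
    ∀ᶠ u' in 𝓝[range (𝓡∂ n)] u, u' 0 = 0 → (f ∘ (extChartAt (𝓡∂ n) q).symm) u' = 0 := by
  filter_upwards [extChartAt_target_mem_nhdsWithin_of_mem hu] with u' hu' h0
  exact hf _ ((symm_mem_boundary_iff q hu').2 h0)

theorem diff_eq_zero_of_tangent (hx : ContMDiff (𝓡∂ n) 𝓘(ℝ, ℝ) ∞ x)
    (hx0 : ∀ p ∈ (𝓡∂ n).boundary M, x p = 0) {p : M}
    (hp : p ∈ (𝓡∂ n).boundary M) {v : TangentSpace (𝓡∂ n) p} (hv : IsTangentToBoundary p v) :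
    diff x p v = 0 := by
  have hu := mem_extChartAt_target (I := 𝓡∂ n) p
  rw [diff_eq_fderivWithin hx p (mem_extChartAt_source p)]
  exact fderivWithin_tangent_eq_zero
    ((contDiffWithinAt_range p (contDiffOn_comp_symm hx p) hu).differentiableWithinAt (by simp))
    ((mem_boundary_iff p (mem_extChartAt_source p)).1 hp) (eventually_symm_zero hx0 p hu) hv

theorem IsBoundaryDefining.exists_fderivWithin_ne_zero (hx : IsBoundaryDefining (n := n) x) {p : M}
    (hp : p ∈ (𝓡∂ n).boundary M) :
    ∃ v, fderivWithin ℝ (x ∘ (extChartAt (𝓡∂ n) p).symm) (range (𝓡∂ n)) (extChartAt (𝓡∂ n) p p) v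
      ≠ 0 := by
  obtain ⟨v, hv⟩ := hx.diff_ne_zero p hp
  exact ⟨_, by rwa [← diff_eq_fderivWithin hx.smooth p (mem_extChartAt_source p) v]⟩

/-- The normal coordinate serves as an intermediary between the given boundary-defining function and
the one in the normal form of the metric. -/
theorem IsBoundaryDefining.exists_comparison (hx : IsBoundaryDefining (n := n) x) {p : M}
    (hp : p ∈ (𝓡∂ n).boundary M) :
    ∃ c K, 0 < c ∧ 0 ≤ K ∧ ∀ᶠ u in 𝓝[range (𝓡∂ n)] (extChartAt (𝓡∂ n) p p),
      c * u 0 ≤ x ((extChartAt (𝓡∂ n) p).symm u) ∧ x ((extChartAt (𝓡∂ n) p).symm u) ≤ K * u 0 := by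
  have hu := mem_extChartAt_target (I := 𝓡∂ n) p
  have h0 := (mem_boundary_iff p (mem_extChartAt_source p)).1 hp
  have hz := eventually_symm_zero (fun p hp => (hx.zero_iff p).2 hp) p hu
  have hd := (contDiffWithinAt_range p (contDiffOn_comp_symm hx.smooth p) hu).of_le
    (m := 1) (by norm_cast)
  obtain ⟨K, hK, h1⟩ := norm_le_mul_normal_coordinate hd h0 hz
  obtain ⟨-, c, hc, h2⟩ := normal_coordinate_le hd h0 hz
    (Eventually.of_forall fun u => hx.nonneg _) (hx.exists_fderivWithin_ne_zero hp)
  refine ⟨c, K, hc, hK, ?_⟩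
  filter_upwards [h1, h2] with u h1 h2
  exact ⟨h2, (le_abs_self _).trans h1⟩

/-- Up to an error bounded by the normal coordinate, each differential is its normal derivative
times `du₀`. The normal derivative of `x'` is bounded below near `p`, so `v 0` is controlled by
`dx'(v)` and the error. -/
theorem IsBoundaryDefining.exists_diff_comparison {x' : M → ℝ}
    (hx : IsBoundaryDefining (n := n) x) (hx' : IsBoundaryDefining (n := n) x') {p : M}
    (hp : p ∈ (𝓡∂ n).boundary M) :
    ∃ C, 0 ≤ C ∧ ∀ᶠ u in 𝓝[range (𝓡∂ n)] (extChartAt (𝓡∂ n) p p),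
      ∀ v : EuclideanSpace ℝ (Fin n),
      |fderivWithin ℝ (x ∘ (extChartAt (𝓡∂ n) p).symm) (range (𝓡∂ n)) u v| ≤
        C * (|fderivWithin ℝ (x' ∘ (extChartAt (𝓡∂ n) p).symm) (range (𝓡∂ n)) u v| + u 0 * ‖v‖) := by
  have hu := mem_extChartAt_target (I := 𝓡∂ n) p
  have h0 := (mem_boundary_iff p (mem_extChartAt_source p)).1 hp
  have hm₀ : extChartAt (𝓡∂ n) p p ∈ range (𝓡∂ n) := mem_range_iff.2 h0.ge
  have hz := eventually_symm_zero (fun p hp => (hx.zero_iff p).2 hp) p hu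
  have hz' := eventually_symm_zero (fun p hp => (hx'.zero_iff p).2 hp) p hu
  have hd := (contDiffWithinAt_range p (contDiffOn_comp_symm hx.smooth p) hu)
  have hd' := (contDiffWithinAt_range p (contDiffOn_comp_symm hx'.smooth p) hu)
  obtain ⟨K, hK, h1⟩ := fderivWithin_sub_normal_le (hd.of_le (by norm_cast)) h0 hz
  obtain ⟨K', hK', h1'⟩ := fderivWithin_sub_normal_le (hd'.of_le (by norm_cast)) h0 hz'
  obtain ⟨hpos, -⟩ := normal_coordinate_le (hd'.of_le (by norm_cast)) h0 hz'
    (Eventually.of_forall fun u => hx'.nonneg _) (hx'.exists_fderivWithin_ne_zero hp)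
  have hc := ((hd.fderivWithin_right (m := 0) (𝓡∂ n).uniqueDiffOn (by simp)
    hm₀).clm_apply (contDiffWithinAt_const (c := EuclideanSpace.single (0 : Fin n) (1 : ℝ)))).continuousWithinAt.abs
  have hc' := ((hd'.fderivWithin_right (m := 0) (𝓡∂ n).uniqueDiffOn (by simp)
    hm₀).clm_apply (contDiffWithinAt_const (c := EuclideanSpace.single (0 : Fin n) (1 : ℝ)))).continuousWithinAt
  set d := fderivWithin ℝ (x' ∘ (extChartAt (𝓡∂ n) p).symm) (range (𝓡∂ n)) (extChartAt (𝓡∂ n) p p)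
    (EuclideanSpace.single 0 1) with hd_def
  set m := |fderivWithin ℝ (x ∘ (extChartAt (𝓡∂ n) p).symm) (range (𝓡∂ n)) (extChartAt (𝓡∂ n) p p)
    (EuclideanSpace.single 0 1)| + 1 with hm_def
  have hm : 0 ≤ m := by positivity
  refine ⟨m * (2 / d) * (1 + K') + K, by positivity, ?_⟩
  filter_upwards [h1, h1', hc.eventually_lt_const (lt_add_one _),
    hc'.eventually_const_lt (half_lt_self hpos), self_mem_nhdsWithin] with u h1 h1' h2 h2' hmem v
  have hu0 : 0 ≤ u 0 := mem_range_iff.1 hmem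
  have e1 := h1 v
  have e2 := h1' v
  set A := fderivWithin ℝ (x ∘ (extChartAt (𝓡∂ n) p).symm) (range (𝓡∂ n)) u v
  set B := fderivWithin ℝ (x' ∘ (extChartAt (𝓡∂ n) p).symm) (range (𝓡∂ n)) u v
  set A0 := fderivWithin ℝ (x ∘ (extChartAt (𝓡∂ n) p).symm) (range (𝓡∂ n)) u
    (EuclideanSpace.single 0 1)
  set B0 := fderivWithin ℝ (x' ∘ (extChartAt (𝓡∂ n) p).symm) (range (𝓡∂ n)) u
    (EuclideanSpace.single 0 1)
  have hw : 0 ≤ u 0 * ‖v‖ := by positivity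
  have f1 : |v 0| * (d / 2) ≤ |B| + K' * (u 0 * ‖v‖) := by
    have : |v 0 * B0| ≤ |B| + |B - v 0 * B0| := by
      have := abs_sub B (B - v 0 * B0)
      simpa using this
    rw [abs_mul, abs_of_pos ((half_pos hpos).trans h2')] at this
    have h3 : |v 0| * (d / 2) ≤ |v 0| * B0 := by gcongr
    linarith
  have f2 : |v 0| ≤ 2 / d * ((1 + K') * (|B| + u 0 * ‖v‖)) := by
    have h3 : |B| + K' * (u 0 * ‖v‖) ≤ (1 + K') * (|B| + u 0 * ‖v‖) := by
      nlinarith [abs_nonneg B]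
    have h4 : |v 0| = 2 / d * (|v 0| * (d / 2)) := by field_simp
    rw [h4]
    exact mul_le_mul_of_nonneg_left (f1.trans h3) (by positivity)
  have f3 : |A| ≤ |v 0| * m + K * (u 0 * ‖v‖) := by
    have : |A| ≤ |v 0 * A0| + |A - v 0 * A0| := by
      have := abs_add_le (v 0 * A0) (A - v 0 * A0)
      simpa using this
    rw [abs_mul] at this
    have h3 : |v 0| * |A0| ≤ |v 0| * m := by gcongr
    linarith
  have f4 : |v 0| * m ≤ 2 / d * ((1 + K') * (|B| + u 0 * ‖v‖)) * m := by gcongr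
  have f5 : K * (u 0 * ‖v‖) ≤ K * (|B| + u 0 * ‖v‖) := by
    gcongr
    linarith [abs_nonneg B]
  calc |A| ≤ 2 / d * ((1 + K') * (|B| + u 0 * ‖v‖)) * m + K * (|B| + u 0 * ‖v‖) := by linarith
    _ = _ := by ring

end BoundaryDefining

/-! ### Asymptotically conical metrics in coordinates -/

section Conical

variable {n : ℕ} [NeZero n] {M : Type*} [TopologicalSpace M]
  [ChartedSpace (EuclideanHalfSpace n) M] [IsManifold (𝓡∂ n) ∞ M]

/-- `g` is a metric on the interior, of the form `(1 + x a) dx² / x⁴ + h / x²`. -/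
structure IsConical (g : ∀ p : M, TangentSpace (𝓡∂ n) p →L[ℝ] TangentSpace (𝓡∂ n) p →L[ℝ] ℝ)
    (x a : M → ℝ) (h : ∀ p : M, TangentSpace (𝓡∂ n) p →L[ℝ] TangentSpace (𝓡∂ n) p →L[ℝ] ℝ) :
    Prop where
  pos : ∀ p ∈ (𝓡∂ n).interior M, ∀ v, v ≠ 0 → 0 < g p v v
  bdf : IsBoundaryDefining (n := n) x
  smooth_left : ContMDiff (𝓡∂ n) 𝓘(ℝ, ℝ) ∞ a
  smooth_right : ContMDiff (𝓡∂ n)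
      ((𝓡∂ n).prod 𝓘(ℝ, EuclideanSpace ℝ (Fin n) →L[ℝ] EuclideanSpace ℝ (Fin n) →L[ℝ] ℝ)) ∞
      (fun p : M => Bundle.TotalSpace.mk'
        (EuclideanSpace ℝ (Fin n) →L[ℝ] EuclideanSpace ℝ (Fin n) →L[ℝ] ℝ)
        (E := fun p : M => TangentSpace (𝓡∂ n) p →L[ℝ] TangentSpace (𝓡∂ n) p →L[ℝ] ℝ) p (h p))
  symm : ∀ p v w, h p v w = h p w v
  pos_boundary : ∀ p ∈ (𝓡∂ n).boundary M, ∀ v, IsTangentToBoundary p v → v ≠ 0 → 0 < h p v v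
  eq : ∀ p ∈ (𝓡∂ n).interior M, ∀ v w,
      g p v w = (1 + x p * a p) * (diff x p v * diff x p w) / x p ^ 4 + h p v w / x p ^ 2

theorem IsAsymptoticallyConical.exists_isConical
    {g : ∀ p : M, TangentSpace (𝓡∂ n) p →L[ℝ] TangentSpace (𝓡∂ n) p →L[ℝ] ℝ}
    (hg : IsAsymptoticallyConical g) : ∃ x a h, IsConical g x a h := by
  obtain ⟨h1, x, a, h, h2, h3, h4, h5, h6, h7⟩ := hg
  exact ⟨x, a, h, h1, h2, h3, h4, h5, h6, h7⟩

variable {g h : ∀ p : M, TangentSpace (𝓡∂ n) p →L[ℝ] TangentSpace (𝓡∂ n) p →L[ℝ] ℝ} {x a : M → ℝ}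

theorem IsConical.metric_symm (hg : IsConical g x a h) {p : M} (hp : p ∈ (𝓡∂ n).interior M)
    (v w : TangentSpace (𝓡∂ n) p) : g p v w = g p w v := by
  rw [hg.eq p hp, hg.eq p hp, hg.symm, mul_comm (diff x p v)]

theorem IsConical.metric_nonneg (hg : IsConical g x a h) {p : M} (hp : p ∈ (𝓡∂ n).interior M)
    (v : TangentSpace (𝓡∂ n) p) : 0 ≤ g p v v := by
  rcases eq_or_ne v 0 with rfl | hv
  · simp
  · exact (hg.pos p hp v hv).le

theorem IsConical.localForm_symm (hg : IsConical g x a h) (q : M) {u : EuclideanSpace ℝ (Fin n)}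
    (hu : u ∈ (extChartAt (𝓡∂ n) q).target) (h0 : 0 < u 0) (v w : EuclideanSpace ℝ (Fin n)) :
    localForm g q u v w = localForm g q u w v :=
  hg.metric_symm ((symm_mem_interior_iff q hu).2 h0) _ _

theorem IsConical.localForm_pos (hg : IsConical g x a h) (q : M) {u : EuclideanSpace ℝ (Fin n)}
    (hu : u ∈ (extChartAt (𝓡∂ n) q).target) (h0 : 0 < u 0) (v : EuclideanSpace ℝ (Fin n))
    (hv : v ≠ 0) : 0 < localForm g q u v v := by
  refine hg.pos _ ((symm_mem_interior_iff q hu).2 h0) _ fun h1 => hv ?_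
  rw [← coord_frame q hu v]
  exact (congrArg _ h1).trans (map_zero _)

theorem IsConical.localForm_eq (hg : IsConical g x a h) (q : M) {u : EuclideanSpace ℝ (Fin n)}
    (hu : u ∈ (extChartAt (𝓡∂ n) q).target) (h0 : 0 < u 0) (v w : EuclideanSpace ℝ (Fin n)) :
    localForm g q u v w =
      (1 + (x ∘ (extChartAt (𝓡∂ n) q).symm) u * (a ∘ (extChartAt (𝓡∂ n) q).symm) u) *
        (fderivWithin ℝ (x ∘ (extChartAt (𝓡∂ n) q).symm) (range (𝓡∂ n)) u v *
          fderivWithin ℝ (x ∘ (extChartAt (𝓡∂ n) q).symm) (range (𝓡∂ n)) u w) /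
            (x ∘ (extChartAt (𝓡∂ n) q).symm) u ^ 4
      + localForm h q u v w / (x ∘ (extChartAt (𝓡∂ n) q).symm) u ^ 2 := by
  have hs := (extChartAt (𝓡∂ n) q).map_target hu
  rw [localForm_apply, hg.eq _ ((symm_mem_interior_iff q hu).2 h0),
    diff_eq_fderivWithin hg.bdf.smooth q hs, diff_eq_fderivWithin hg.bdf.smooth q hs,
    coord_frame q hu, coord_frame q hu, (extChartAt (𝓡∂ n) q).right_inv hu]
  rfl

theorem eventually_target (q : M) {u : EuclideanSpace ℝ (Fin n)}
    (hu : u ∈ (extChartAt (𝓡∂ n) q).target) (h0 : 0 < u 0) :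
    ∀ᶠ u' in 𝓝 u, u' ∈ (extChartAt (𝓡∂ n) q).target ∧ 0 < u' 0 := by
  refine (eventually_mem_set.2 (target_mem_nhds q hu h0)).and ?_
  have : Continuous fun u : EuclideanSpace ℝ (Fin n) => u 0 := by fun_prop
  exact this.continuousAt.eventually_const_lt h0

theorem contDiffAt_of_target {F : Type*} [NormedAddCommGroup F] [NormedSpace ℝ F]
    {f : EuclideanSpace ℝ (Fin n) → F} (q : M)
    (hf : ContDiffOn ℝ ∞ f (extChartAt (𝓡∂ n) q).target) {u : EuclideanSpace ℝ (Fin n)}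
    (hu : u ∈ (extChartAt (𝓡∂ n) q).target) (h0 : 0 < u 0) : ContDiffAt ℝ ∞ f u :=
  hf.contDiffAt (target_mem_nhds q hu h0)

theorem IsConical.eventually_localForm_eq (hg : IsConical g x a h) (q : M)
    {u : EuclideanSpace ℝ (Fin n)} (hu : u ∈ (extChartAt (𝓡∂ n) q).target) (h0 : 0 < u 0) :
    ∀ᶠ u' in 𝓝 u, ∀ v w, localForm g q u' v w =
      (fun u' => 1 + (x ∘ (extChartAt (𝓡∂ n) q).symm) u' * (a ∘ (extChartAt (𝓡∂ n) q).symm) u') u' *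
        (fderiv ℝ (x ∘ (extChartAt (𝓡∂ n) q).symm) u' v *
          fderiv ℝ (x ∘ (extChartAt (𝓡∂ n) q).symm) u' w) /
            (x ∘ (extChartAt (𝓡∂ n) q).symm) u' ^ 4
      + localForm h q u' v w / (x ∘ (extChartAt (𝓡∂ n) q).symm) u' ^ 2 := by
  filter_upwards [eventually_target q hu h0] with u' hu' v w
  rw [hg.localForm_eq q hu'.1 hu'.2, fderivWithin_of_mem_nhds (range_mem_nhds hu'.2)]

/-- No regularity of `g` is assumed directly; it is inherited from the smooth data in the normal
form. -/
theorem IsConical.differentiableAt_localForm (hg : IsConical g x a h) (q : M)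
    {u : EuclideanSpace ℝ (Fin n)} (hu : u ∈ (extChartAt (𝓡∂ n) q).target) (h0 : 0 < u 0) :
    DifferentiableAt ℝ (localForm g q) u := by
  have hX := contDiffAt_of_target q (contDiffOn_comp_symm hg.bdf.smooth q) hu h0
  have hA := (contDiffAt_of_target q (contDiffOn_comp_symm hg.smooth_left q) hu h0).differentiableAt
    (by simp)
  have hH := (contDiffAt_of_target q (contDiffOn_localForm hg.smooth_right q) hu h0).differentiableAt
    (by simp)
  have hdX : ContDiffAt ℝ ∞ (fderiv ℝ (x ∘ (extChartAt (𝓡∂ n) q).symm)) u :=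
    hX.fderiv_right (by simp)
  have hX0 : (x ∘ (extChartAt (𝓡∂ n) q).symm) u ≠ 0 :=
    (hg.bdf.pos ((symm_mem_interior_iff q hu).2 h0)).ne'
  have hXd := hX.differentiableAt (by simp)
  have hS := (hdX.smulRight hdX).differentiableAt (by simp)
  set X := x ∘ (extChartAt (𝓡∂ n) q).symm with hX_def
  set A := a ∘ (extChartAt (𝓡∂ n) q).symm with hA_def
  have hp4 : DifferentiableAt ℝ (fun u' => (X u' ^ 4)⁻¹) u :=
    (hXd.fun_pow 4).fun_inv (pow_ne_zero 4 hX0)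
  have hp2 : DifferentiableAt ℝ (fun u' => (X u' ^ 2)⁻¹) u :=
    (hXd.fun_pow 2).fun_inv (pow_ne_zero 2 hX0)
  have hXA : DifferentiableAt ℝ (fun u' => 1 + X u' * A u') u := (hXd.fun_mul hA).const_add 1
  have h1 : DifferentiableAt ℝ (fun u' =>
      ((1 + X u' * A u') * (X u' ^ 4)⁻¹) • (fderiv ℝ X u').smulRight (fderiv ℝ X u')
      + (X u' ^ 2)⁻¹ • localForm h q u') u :=
    ((hXA.fun_mul hp4).fun_smul hS).fun_add (hp2.fun_smul hH)
  refine h1.congr_of_eventuallyEq ?_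
  filter_upwards [hg.eventually_localForm_eq q hu h0] with u' hu'
  ext v w
  rw [hu']
  simp only [← hX_def, ← hA_def, add_apply, smul_apply, ContinuousLinearMap.smulRight_apply,
    smul_eq_mul]
  ring

end Conical

/-! ### Ellipticity of asymptotically conical metrics -/

section Elliptic

variable {n : ℕ} [NeZero n] {M : Type*} [TopologicalSpace M]
  [ChartedSpace (EuclideanHalfSpace n) M] [IsManifold (𝓡∂ n) ∞ M]
  {g h : ∀ p : M, TangentSpace (𝓡∂ n) p →L[ℝ] TangentSpace (𝓡∂ n) p →L[ℝ] ℝ} {x a : M → ℝ}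

/-- Multiply the metric by `x⁴`. Since `h` is positive on the kernel of `dx` at `p`, the form `h + Λ
dx²` is coercive near `p`. The cost `Λ x² dx²` of adding it is absorbed by `(1 + x a) dx²` for small
`x`, leaving `x⁴ g(v, v) ≥ dx(v)² / 2 + c x² ‖v‖² / 2`. -/
theorem IsConical.exists_elliptic (hg : IsConical g x a h) {p : M}
    (hp : p ∈ (𝓡∂ n).boundary M) :
    ∃ K, 1 ≤ K ∧ ∀ᶠ u in 𝓝[range (𝓡∂ n)] (extChartAt (𝓡∂ n) p p), 0 < u 0 →
      ∀ v : EuclideanSpace ℝ (Fin n),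
      ‖v‖ ≤ K * (x ∘ (extChartAt (𝓡∂ n) p).symm) u * √(localForm g p u v v) ∧
      |fderivWithin ℝ (x ∘ (extChartAt (𝓡∂ n) p).symm) (range (𝓡∂ n)) u v| ≤
        K * (x ∘ (extChartAt (𝓡∂ n) p).symm) u ^ 2 * √(localForm g p u v v) := by
  have hu := mem_extChartAt_target (I := 𝓡∂ n) p
  have hs := mem_extChartAt_source (I := 𝓡∂ n) p
  have h0 := (mem_boundary_iff p hs).1 hp
  have hm₀ : extChartAt (𝓡∂ n) p p ∈ range (𝓡∂ n) := mem_range_iff.2 h0.ge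
  have hz := eventually_symm_zero (fun p hp => (hg.bdf.zero_iff p).2 hp) p hu
  have hX := contDiffWithinAt_range p (contDiffOn_comp_symm hg.bdf.smooth p) hu
  have hA := contDiffWithinAt_range p (contDiffOn_comp_symm hg.smooth_left p) hu
  have hH := contDiffWithinAt_range p (contDiffOn_localForm hg.smooth_right p) hu
  have hdX := hX.fderivWithin_right (m := 0) (𝓡∂ n).uniqueDiffOn (by simp) hm₀
  obtain ⟨hd, -⟩ := normal_coordinate_le (hX.of_le (by norm_cast)) h0 hz
    (Eventually.of_forall fun u => hg.bdf.nonneg _) (hg.bdf.exists_fderivWithin_ne_zero hp)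
  have hX0 : (x ∘ (extChartAt (𝓡∂ n) p).symm) (extChartAt (𝓡∂ n) p p) = 0 := by
    simpa only [Function.comp, (extChartAt (𝓡∂ n) p).left_inv hs] using (hg.bdf.zero_iff p).2 hp
  have htan : ∀ w : EuclideanSpace ℝ (Fin n), w 0 = 0 → fderivWithin ℝ
      (x ∘ (extChartAt (𝓡∂ n) p).symm) (range (𝓡∂ n)) (extChartAt (𝓡∂ n) p p) w = 0 := fun w hw =>
    fderivWithin_tangent_eq_zero (hX.differentiableWithinAt (by simp)) h0 hz hw
  set X := x ∘ (extChartAt (𝓡∂ n) p).symm with hX_def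
  set A := a ∘ (extChartAt (𝓡∂ n) p).symm
  set u₀ := extChartAt (𝓡∂ n) p p with hu₀
  obtain ⟨Λ, c, hc, hΛ, hco⟩ := exists_coercive_add (localForm h p u₀)
    (fderivWithin ℝ X (range (𝓡∂ n)) u₀) (by
      intro v hv hv0
      have hv1 : v 0 = 0 := by
        have h1 := htan _ (boundaryProj_zero v)
        rw [boundaryProj, map_sub, map_smul, hv, zero_sub, neg_eq_zero, smul_eq_mul] at h1
        exact (mul_eq_zero.1 h1).resolve_right hd.ne'
      obtain ⟨v', rfl⟩ := exists_coord_eq p hs v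
      rw [hu₀, localForm_coord h p hs]
      exact hg.pos_boundary p hp v' hv1 (by rintro rfl; exact hv0 (map_zero _)))
  have hb : ContinuousWithinAt (fun u => localForm h p u + Λ •
      (fderivWithin ℝ X (range (𝓡∂ n)) u).smulRight (fderivWithin ℝ X (range (𝓡∂ n)) u))
      (range (𝓡∂ n)) u₀ :=
    hH.continuousWithinAt.add ((hdX.smulRight hdX).continuousWithinAt.const_smul Λ)
  have hev := eventually_coercive hc hb (by
    intro v
    refine (hco v).trans_eq ?_
    simp only [add_apply, smul_apply, ContinuousLinearMap.smulRight_apply, smul_eq_mul]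
    ring)
  have hα : ContinuousWithinAt (fun u => 1 + X u * A u - Λ * X u ^ 2) (range (𝓡∂ n)) u₀ :=
    ((hX.continuousWithinAt.mul hA.continuousWithinAt).const_add 1).sub
      ((hX.continuousWithinAt.pow 2).const_mul Λ)
  -- The square of `2 + 2 / c` exceeds both `2` and `2 / c`, which avoids square roots in the
  -- constant.
  refine ⟨2 + 2 / c, by have : 0 < 2 / c := by positivity
                        linarith, ?_⟩
  filter_upwards [hev, hα.eventually_const_lt (u := 1 / 2) (by simp [hX0]; norm_num),
    extChartAt_target_mem_nhdsWithin p] with u hu1 hu2 hu3 hu0 v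
  have hr : 0 < X u := hg.bdf.pos ((symm_mem_interior_iff p hu3).2 hu0)
  have e1 := hu1 v
  have e2 : localForm g p u v v = (1 + X u * A u) * (fderivWithin ℝ X (range (𝓡∂ n)) u v *
      fderivWithin ℝ X (range (𝓡∂ n)) u v) / X u ^ 4 + localForm h p u v v / X u ^ 2 :=
    hg.localForm_eq p hu3 hu0 v v
  simp only [add_apply, smul_apply, ContinuousLinearMap.smulRight_apply, smul_eq_mul] at e1
  set N := √(localForm g p u v v)
  have hN : N ^ 2 = localForm g p u v v :=
    Real.sq_sqrt (hg.metric_nonneg ((symm_mem_interior_iff p hu3).2 hu0) _)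
  have hN0 : 0 ≤ N := Real.sqrt_nonneg _
  rw [← hN] at e2
  set r := X u
  set D := fderivWithin ℝ X (range (𝓡∂ n)) u v
  set H := localForm h p u v v
  have e3 : r ^ 4 * N ^ 2 = (1 + r * A u) * D ^ 2 + r ^ 2 * H := by
    rw [e2]
    field_simp
  have e4 : 1 / 2 * D ^ 2 + c / 2 * (r * ‖v‖) ^ 2 ≤ r ^ 4 * N ^ 2 := by
    rw [e3]
    have : r ^ 2 * (c / 2 * ‖v‖ ^ 2) ≤ r ^ 2 * (H + Λ * (D * D)) :=
      mul_le_mul_of_nonneg_left e1 (sq_nonneg r)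
    have h3 : 1 / 2 * D ^ 2 ≤ (1 + r * A u - Λ * r ^ 2) * D ^ 2 :=
      mul_le_mul_of_nonneg_right hu2.le (sq_nonneg D)
    nlinarith
  have hy : 0 < 2 / c := by positivity
  have hcy : c * (2 / c) = 2 := by field_simp
  constructor
  · have h1 : ‖v‖ ^ 2 ≤ ((2 + 2 / c) * r * N) ^ 2 := by
      have h2 : c / 2 * (r * ‖v‖) ^ 2 ≤ r ^ 4 * N ^ 2 := by nlinarith [sq_nonneg D]
      have h3 : c / 2 * ‖v‖ ^ 2 ≤ r ^ 2 * N ^ 2 := by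
        refine le_of_mul_le_mul_left ?_ (pow_pos hr 2)
        linarith
      have h4 : ‖v‖ ^ 2 ≤ 2 / c * (r ^ 2 * N ^ 2) := by
        have h5 : ‖v‖ ^ 2 = 2 / c * (c / 2 * ‖v‖ ^ 2) := by field_simp
        rw [h5]
        exact mul_le_mul_of_nonneg_left h3 hy.le
      refine h4.trans ?_
      rw [mul_assoc, mul_pow, mul_pow]
      refine mul_le_mul_of_nonneg_right ?_ (by positivity)
      nlinarith
    have := abs_le_of_sq_le_sq h1 (by positivity)
    rwa [abs_of_nonneg (norm_nonneg v)] at this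
  · have h1 : D ^ 2 ≤ ((2 + 2 / c) * r ^ 2 * N) ^ 2 := by
      have h2 : 1 / 2 * D ^ 2 ≤ r ^ 4 * N ^ 2 := by
        have : 0 ≤ c / 2 * (r * ‖v‖) ^ 2 := by positivity
        linarith
      have h3 : 2 * (r ^ 4 * N ^ 2) ≤ (2 + 2 / c) ^ 2 * (r ^ 4 * N ^ 2) := by
        refine mul_le_mul_of_nonneg_right ?_ (by positivity)
        nlinarith
      calc D ^ 2 ≤ 2 * (r ^ 4 * N ^ 2) := by linarith
        _ ≤ _ := h3
        _ = _ := by ring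
    exact abs_le_of_sq_le_sq h1 (by positivity)

theorem tendsto_extChartAt_range (p : M) :
    Tendsto (extChartAt (𝓡∂ n) p) (𝓝 p) (𝓝[range (𝓡∂ n)] (extChartAt (𝓡∂ n) p p)) :=
  tendsto_nhdsWithin_of_tendsto_nhds_of_eventually_within _ (continuousAt_extChartAt p)
    (by filter_upwards [extChartAt_source_mem_nhds (I := 𝓡∂ n) p] with p' hp'
        exact extChartAt_target_subset_range p ((extChartAt (𝓡∂ n) p).map_source hp'))

theorem gnorm_eq_sqrt_localForm (q : M) {p : M} (hp : p ∈ (extChartAt (𝓡∂ n) q).source)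
    (v : TangentSpace (𝓡∂ n) p) :
    gnorm g p v = √(localForm g q (extChartAt (𝓡∂ n) q p) (coord q p v) (coord q p v)) := by
  rw [localForm_coord g q hp]; rfl

/-- Ellipticity bounds the differential of the metric's own `x`; the comparison of differentials
passes to `x'`, the error term being the product of the normal coordinate with `‖v‖ = O(x) ‖v‖_g`.
-/
theorem IsConical.eventually_diff_le_boundary (hg : IsConical g x a h) {x' : M → ℝ}
    (hx' : IsBoundaryDefining (n := n) x') {p : M} (hp : p ∈ (𝓡∂ n).boundary M) :
    ∃ C, 0 ≤ C ∧ ∀ᶠ p' in 𝓝 p, p' ∈ (𝓡∂ n).interior M → ∀ v : TangentSpace (𝓡∂ n) p',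
      |diff x' p' v| ≤ C * x' p' ^ 2 * gnorm g p' v := by
  obtain ⟨K, hK, h1⟩ := hg.exists_elliptic hp
  obtain ⟨C, hC, h2⟩ := hx'.exists_diff_comparison hg.bdf hp
  obtain ⟨_, K₁, _, hK₁, h3⟩ := hg.bdf.exists_comparison hp
  obtain ⟨c, _, hc, _, h4⟩ := hx'.exists_comparison hp
  have hK0 : 0 ≤ K := by linarith
  refine ⟨C * (K * K₁ ^ 2 + K * K₁) * (1 / c) ^ 2, by positivity, ?_⟩
  filter_upwards [(tendsto_extChartAt_range p).eventually (h1.and (h2.and (h3.and h4))),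
    extChartAt_source_mem_nhds (I := 𝓡∂ n) p] with p' ⟨e1, e2, e3, e4⟩ hs hi v
  have hu0 := (mem_interior_iff p hs).1 hi
  rw [diff_eq_fderivWithin hx'.smooth p hs, gnorm_eq_sqrt_localForm p hs]
  obtain ⟨f1, f2⟩ := e1 hu0 (coord p p' v)
  have f3 := e2 (coord p p' v)
  have f4 := e3.2
  have f5 := e4.1
  simp only [Function.comp, (extChartAt (𝓡∂ n) p).left_inv hs] at f1 f2 f4 f5
  set N := √(localForm g p (extChartAt (𝓡∂ n) p p') (coord p p' v) (coord p p' v))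
  set s := extChartAt (𝓡∂ n) p p' 0
  have hN : 0 ≤ N := Real.sqrt_nonneg _
  have hx0 : 0 < x p' := hg.bdf.pos hi
  have g1 : s ≤ 1 / c * x' p' := by
    rw [one_div, inv_mul_eq_div, le_div_iff₀ hc]; linarith
  have g2 : K * x p' ^ 2 * N ≤ K * (K₁ * s) ^ 2 * N := by gcongr
  have g3 : s * ‖coord p p' v‖ ≤ s * (K * (K₁ * s) * N) := by
    refine mul_le_mul_of_nonneg_left (f1.trans ?_) hu0.le
    gcongr
  refine f3.trans ?_
  calc _ ≤ C * (K * (K₁ * s) ^ 2 * N + s * (K * (K₁ * s) * N)) := by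
        refine mul_le_mul_of_nonneg_left (add_le_add (f2.trans g2) g3) hC
    _ = C * (K * K₁ ^ 2 + K * K₁) * s ^ 2 * N := by ring
    _ ≤ C * (K * K₁ ^ 2 + K * K₁) * (1 / c * x' p') ^ 2 * N := by
        have := hu0.le
        gcongr
    _ = _ := by ring

/-- Away from the boundary nothing degenerates: `g` is locally coercive and `x'` is locally bounded
below. -/
theorem IsConical.eventually_diff_le_interior (hg : IsConical g x a h) {x' : M → ℝ}
    (hx' : IsBoundaryDefining (n := n) x') {p : M} (hp : p ∈ (𝓡∂ n).interior M) :
    ∃ C, 0 ≤ C ∧ ∀ᶠ p' in 𝓝 p, p' ∈ (𝓡∂ n).interior M → ∀ v : TangentSpace (𝓡∂ n) p',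
      |diff x' p' v| ≤ C * x' p' ^ 2 * gnorm g p' v := by
  have hu := mem_extChartAt_target (I := 𝓡∂ n) p
  have hs := mem_extChartAt_source (I := 𝓡∂ n) p
  have h0 := (mem_interior_iff p hs).1 hp
  have hm₀ : extChartAt (𝓡∂ n) p p ∈ range (𝓡∂ n) := mem_range_iff.2 h0.le
  have hX := contDiffWithinAt_range p (contDiffOn_comp_symm hx'.smooth p) hu
  have hdX := hX.fderivWithin_right (m := 0) (𝓡∂ n).uniqueDiffOn (by simp) hm₀
  obtain ⟨_, c, hc, _, hco⟩ := exists_coercive_add (localForm g p (extChartAt (𝓡∂ n) p p)) 0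
    (fun v _ hv => hg.localForm_pos p hu h0 v hv)
  have h1 := eventually_coercive hc (hg.differentiableAt_localForm p hu h0).continuousAt.continuousWithinAt
    (s := range (𝓡∂ n)) (by simpa using hco)
  have hX0 : 0 < (x' ∘ (extChartAt (𝓡∂ n) p).symm) (extChartAt (𝓡∂ n) p p) :=
    hx'.pos ((symm_mem_interior_iff p hu).2 h0)
  set X := x' ∘ (extChartAt (𝓡∂ n) p).symm with hX_def
  set u₀ := extChartAt (𝓡∂ n) p p
  have h2 := hdX.continuousWithinAt.norm.eventually_lt_const (lt_add_one _)
  have h3 := hX.continuousWithinAt.eventually_const_lt (half_lt_self hX0)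
  set B := ‖fderivWithin ℝ X (range (𝓡∂ n)) u₀‖ + 1 with hB
  have hB0 : 0 ≤ B := by positivity
  refine ⟨B * (1 + 2 / c) * (2 / X u₀) ^ 2, by positivity, ?_⟩
  filter_upwards [(tendsto_extChartAt_range p).eventually (h1.and (h2.and h3)),
    extChartAt_source_mem_nhds (I := 𝓡∂ n) p] with p' ⟨e1, e2, e3⟩ hs' hi v
  rw [diff_eq_fderivWithin hx'.smooth p hs', gnorm_eq_sqrt_localForm p hs']
  have e4 := e1 (coord p p' v)
  set w := coord p p' v
  set N := √(localForm g p (extChartAt (𝓡∂ n) p p') w w)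
  have hN : 0 ≤ N := Real.sqrt_nonneg _
  have hN2 : N ^ 2 = localForm g p (extChartAt (𝓡∂ n) p p') w w := by
    refine Real.sq_sqrt ?_
    rw [localForm_coord g p hs']
    exact hg.metric_nonneg hi v
  rw [← hN2] at e4
  simp only [hX_def, Function.comp_apply, (extChartAt (𝓡∂ n) p).left_inv hs'] at e3
  have hy : 0 < 2 / c := by positivity
  have f1 : ‖w‖ ≤ (1 + 2 / c) * N := by
    have h5 : ‖w‖ ^ 2 = 2 / c * (c / 2 * ‖w‖ ^ 2) := by field_simp
    have h6 : ‖w‖ ^ 2 ≤ ((1 + 2 / c) * N) ^ 2 := by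
      rw [h5]
      calc _ ≤ 2 / c * N ^ 2 := mul_le_mul_of_nonneg_left e4 hy.le
        _ ≤ (1 + 2 / c) ^ 2 * N ^ 2 := mul_le_mul_of_nonneg_right (by nlinarith) (sq_nonneg _)
        _ = _ := by ring
    have := abs_le_of_sq_le_sq h6 (by positivity)
    rwa [abs_of_nonneg (norm_nonneg w)] at this
  have f2 : 1 ≤ (2 / X u₀) ^ 2 * x' p' ^ 2 := by
    rw [← mul_pow]
    refine one_le_pow₀ ?_
    rw [div_mul_eq_mul_div, one_le_div hX0]
    have : X u₀ / 2 < x' p' := e3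
    linarith
  calc _ ≤ B * ‖w‖ := ContinuousLinearMap.le_of_opNorm_le _ e2.le w
    _ ≤ B * ((1 + 2 / c) * N) := by gcongr
    _ = B * ((1 + 2 / c) * N) * 1 := by ring
    _ ≤ B * ((1 + 2 / c) * N) * ((2 / X u₀) ^ 2 * x' p' ^ 2) := by gcongr
    _ = _ := by ring

/-- Equivalently, `1 / x'` has bounded gradient. A covering argument turns the local estimates at
interior and boundary points into a global one. -/
theorem IsConical.exists_diff_le [CompactSpace M] (hg : IsConical g x a h) {x' : M → ℝ}
    (hx' : IsBoundaryDefining (n := n) x') :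
    ∃ C, 0 ≤ C ∧ ∀ p ∈ (𝓡∂ n).interior M, ∀ v : TangentSpace (𝓡∂ n) p,
      |diff x' p v| ≤ C * x' p ^ 2 * gnorm g p v := by
  have key := isCompact_univ (X := M).induction_on
    (p := fun s => ∃ C, 0 ≤ C ∧ ∀ p ∈ s, p ∈ (𝓡∂ n).interior M → ∀ v : TangentSpace (𝓡∂ n) p,
      |diff x' p v| ≤ C * x' p ^ 2 * gnorm g p v)
    ⟨0, le_rfl, by simp⟩
    (fun s t hst ⟨C, hC, H⟩ => ⟨C, hC, fun p hp => H p (hst hp)⟩)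
    (fun s t ⟨C, hC, H⟩ ⟨C', hC', H'⟩ => ⟨C + C', by positivity, fun p hp hi v => by
      have hn : 0 ≤ x' p ^ 2 * gnorm g p v := mul_nonneg (sq_nonneg _) (Real.sqrt_nonneg _)
      rcases hp with hp | hp
      · have := H p hp hi v
        nlinarith
      · have := H' p hp hi v
        nlinarith⟩)
    (fun p _ => by
      rcases (𝓡∂ n).isInteriorPoint_or_isBoundaryPoint p with hp | hp
      · obtain ⟨C, hC, H⟩ := hg.eventually_diff_le_interior hx' hp
        exact ⟨_, mem_nhdsWithin_of_mem_nhds H, C, hC, fun p hp => hp⟩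
      · obtain ⟨C, hC, H⟩ := hg.eventually_diff_le_boundary hx' hp
        exact ⟨_, mem_nhdsWithin_of_mem_nhds H, C, hC, fun p hp => hp⟩)
  obtain ⟨C, hC, H⟩ := key
  exact ⟨C, hC, fun p hp => H p (mem_univ p) hp⟩

end Elliptic

/-! ### Estimates along a curve that starts at the boundary -/

section CurveEstimates

variable {n : ℕ} [NeZero n] {M : Type*} [TopologicalSpace M]
  [ChartedSpace (EuclideanHalfSpace n) M] [IsManifold (𝓡∂ n) ∞ M]
  {F : Type*} [NormedAddCommGroup F] [NormedSpace ℝ F]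

theorem nhdsGT_le_nhdsWithin_Ico {ε : ℝ} (hε : 0 < ε) : 𝓝[>] (0 : ℝ) ≤ 𝓝[Ico 0 ε] 0 := by
  rw [← nhdsWithin_Ioo_eq_nhdsGT hε]
  exact nhdsWithin_mono _ Ioo_subset_Ico_self

theorem tendsto_curve {τ : ℝ → M} {p : M} {ε : ℝ} (hε : 0 < ε)
    (hτ : ContMDiffWithinAt 𝓘(ℝ, ℝ) (𝓡∂ n) ∞ τ (Ico 0 ε) 0) (hτ0 : τ 0 = p) :
    Tendsto τ (𝓝[>] 0) (𝓝 p) := by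
  rw [← hτ0]
  exact hτ.continuousWithinAt.tendsto.mono_left (nhdsGT_le_nhdsWithin_Ico hε)

theorem isBigO_one_along {τ : ℝ → M} {p : M} (hτ : Tendsto τ (𝓝[>] 0) (𝓝 p))
    {f : EuclideanSpace ℝ (Fin n) → F}
    (hf : ContinuousWithinAt f (range (𝓡∂ n)) (extChartAt (𝓡∂ n) p p)) :
    (fun t => f (extChartAt (𝓡∂ n) p (τ t))) =O[𝓝[>] 0] (fun _ => (1 : ℝ)) :=
  (hf.tendsto.comp ((tendsto_extChartAt_range p).comp hτ)).isBigO_one ℝ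

/-- The function along the curve is differentiable from the right at `0` and vanishes there. -/
theorem isBigO_id_along {τ : ℝ → M} {p : M} {ε : ℝ} (hε : 0 < ε)
    (hτ : ContMDiffWithinAt 𝓘(ℝ, ℝ) (𝓡∂ n) ∞ τ (Ico 0 ε) 0) (hτ0 : τ 0 = p)
    {f : EuclideanSpace ℝ (Fin n) → F}
    (hf : DifferentiableWithinAt ℝ f (range (𝓡∂ n)) (extChartAt (𝓡∂ n) p p))
    (hf0 : f (extChartAt (𝓡∂ n) p p) = 0) :
    (fun t => f (extChartAt (𝓡∂ n) p (τ t))) =O[𝓝[>] 0] (fun t => t) := by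
  subst hτ0
  have h1 : ContMDiffWithinAt 𝓘(ℝ, ℝ) 𝓘(ℝ, EuclideanSpace ℝ (Fin n)) ∞
      (fun t => extChartAt (𝓡∂ n) (τ 0) (τ t)) (Ico 0 ε) 0 :=
    (contMDiffAt_extChartAt (I := 𝓡∂ n) (n := ∞) (x := τ 0)).comp_contMDiffWithinAt 0 hτ
  have h2 := (contMDiffWithinAt_iff_contDiffWithinAt.1 h1).differentiableWithinAt (by simp)
  -- The parameters are restricted to the chart domain so that the coordinates stay in the
  -- half-space, the only set within which `f` is known to be differentiable.
  set s := Ico 0 ε ∩ τ ⁻¹' (extChartAt (𝓡∂ n) (τ 0)).source with hs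
  have hmaps : MapsTo (fun t => extChartAt (𝓡∂ n) (τ 0) (τ t)) s (range (𝓡∂ n)) := fun t ht =>
    extChartAt_target_subset_range _ ((extChartAt (𝓡∂ n) (τ 0)).map_source ht.2)
  have h3 := (DifferentiableWithinAt.comp (0 : ℝ) hf (h2.mono inter_subset_left) hmaps).isBigO_sub
  have hle : 𝓝[>] (0 : ℝ) ≤ 𝓝[s] 0 := by
    have hmem : τ ⁻¹' (extChartAt (𝓡∂ n) (τ 0)).source ∈ 𝓝[Ico 0 ε] (0 : ℝ) :=
      hτ.continuousWithinAt (extChartAt_source_mem_nhds (I := 𝓡∂ n) (τ 0))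
    rw [hs, inter_comm, nhdsWithin_inter_of_mem hmem]
    exact nhdsGT_le_nhdsWithin_Ico hε
  simpa only [Function.comp_def, hf0, sub_zero] using h3.mono hle

theorem localField_extChartAt (W : ∀ p : M, TangentSpace (𝓡∂ n) p) (q : M) {p : M}
    (hp : p ∈ (extChartAt (𝓡∂ n) q).source) :
    localField W q (extChartAt (𝓡∂ n) q p) = coord q p (W p) := by
  obtain ⟨u, hu, rfl⟩ : ∃ u ∈ (extChartAt (𝓡∂ n) q).target, (extChartAt (𝓡∂ n) q).symm u = p :=
    ⟨_, (extChartAt (𝓡∂ n) q).map_source hp, (extChartAt (𝓡∂ n) q).left_inv hp⟩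
  rw [(extChartAt (𝓡∂ n) q).right_inv hu]
  rfl

theorem IsBField.fderivWithin_eq_zero {W : ∀ p : M, TangentSpace (𝓡∂ n) p} (hW : IsBField W)
    {x : M → ℝ} (hx : ContMDiff (𝓡∂ n) 𝓘(ℝ, ℝ) ∞ x) (hx0 : ∀ p ∈ (𝓡∂ n).boundary M, x p = 0)
    {p : M} (hp : p ∈ (𝓡∂ n).boundary M) :
    fderivWithin ℝ (x ∘ (extChartAt (𝓡∂ n) p).symm) (range (𝓡∂ n)) (extChartAt (𝓡∂ n) p p)
      (localField W p (extChartAt (𝓡∂ n) p p)) = 0 := by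
  have hs := mem_extChartAt_source (I := 𝓡∂ n) p
  rw [localField_extChartAt W p hs, ← diff_eq_fderivWithin hx p hs]
  exact diff_eq_zero_of_tangent hx hx0 hp (hW.2 p hp)

theorem contDiffWithinAt_fderivWithin_apply {f : EuclideanSpace ℝ (Fin n) → F}
    {W : EuclideanSpace ℝ (Fin n) → EuclideanSpace ℝ (Fin n)} {u : EuclideanSpace ℝ (Fin n)}
    (hf : ContDiffWithinAt ℝ ∞ f (range (𝓡∂ n)) u) (hW : ContDiffWithinAt ℝ ∞ W (range (𝓡∂ n)) u)
    (hu : u ∈ range (𝓡∂ n)) :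
    ContDiffWithinAt ℝ ∞ (fun u => fderivWithin ℝ f (range (𝓡∂ n)) u (W u)) (range (𝓡∂ n)) u :=
  (hf.fderivWithin_right (m := ∞) (𝓡∂ n).uniqueDiffOn (by simp) hu).clm_apply hW

theorem isBigO_clm_apply {ι F' : Type*} [NormedAddCommGroup F'] [NormedSpace ℝ F'] {l : Filter ι}
    {L : ι → F →L[ℝ] F'} {v : ι → F} {r₁ r₂ : ι → ℝ} (hL : L =O[l] r₁) (hv : v =O[l] r₂) :
    (fun t => L t (v t)) =O[l] fun t => r₁ t * r₂ t := by
  have h1 : (fun t => L t (v t)) =O[l] fun t => ‖L t‖ * ‖v t‖ :=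
    Asymptotics.isBigO_of_le _ fun t => by
      rw [Real.norm_of_nonneg (by positivity)]
      exact (L t).le_opNorm _
  exact h1.trans (hL.norm_left.mul hv.norm_left)

/-- A scattering field along a curve issuing from the boundary: its components are `O(t)`, and
the component of `dx` along it is `O(t²)`. -/
theorem IsScatteringField.isBigO_along {V : ∀ p : M, TangentSpace (𝓡∂ n) p}
    (hV : IsScatteringField V) {x : M → ℝ} (hx : ContMDiff (𝓡∂ n) 𝓘(ℝ, ℝ) ∞ x)
    (hx0 : ∀ p ∈ (𝓡∂ n).boundary M, x p = 0)
    {p : M} (hp : p ∈ (𝓡∂ n).boundary M) {τ : ℝ → M} {ε : ℝ} (hε : 0 < ε)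
    (hτ : ContMDiffWithinAt 𝓘(ℝ, ℝ) (𝓡∂ n) ∞ τ (Ico 0 ε) 0) (hτ0 : τ 0 = p) :
    (fun t => localField V p (extChartAt (𝓡∂ n) p (τ t))) =O[𝓝[>] 0] (fun t => t) ∧
    (fun t => fderivWithin ℝ (x ∘ (extChartAt (𝓡∂ n) p).symm) (range (𝓡∂ n))
      (extChartAt (𝓡∂ n) p (τ t)) (localField V p (extChartAt (𝓡∂ n) p (τ t))))
        =O[𝓝[>] 0] (fun t => t ^ 2) ∧
    ∃ f : EuclideanSpace ℝ (Fin n) → ℝ,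
      (∀ u, fderivWithin ℝ (x ∘ (extChartAt (𝓡∂ n) p).symm) (range (𝓡∂ n)) u (localField V p u)
        = f u) ∧
      (∀ u ∈ (extChartAt (𝓡∂ n) p).target, ContDiffWithinAt ℝ ∞ f (range (𝓡∂ n)) u) ∧
      (fun t => fderivWithin ℝ f (range (𝓡∂ n)) (extChartAt (𝓡∂ n) p (τ t)))
        =O[𝓝[>] 0] (fun t => t) := by
  obtain ⟨y, W, hy, hW, hVW⟩ := hV
  have hu := mem_extChartAt_target (I := 𝓡∂ n) p
  have hs := mem_extChartAt_source (I := 𝓡∂ n) p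
  have hm : ∀ u ∈ (extChartAt (𝓡∂ n) p).target, u ∈ range (𝓡∂ n) :=
    fun u hu => extChartAt_target_subset_range p hu
  have hYc := fun u (hu : u ∈ (extChartAt (𝓡∂ n) p).target) =>
    contDiffWithinAt_range p (contDiffOn_comp_symm hy.smooth p) hu
  have hXc := fun u (hu : u ∈ (extChartAt (𝓡∂ n) p).target) =>
    contDiffWithinAt_range p (contDiffOn_comp_symm hx p) hu
  have hWc := fun u (hu : u ∈ (extChartAt (𝓡∂ n) p).target) =>
    contDiffWithinAt_range p (contDiffOn_localField hW.1 p) hu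
  have hX0 := hW.fderivWithin_eq_zero hx hx0 hp
  have hY0 : (y ∘ (extChartAt (𝓡∂ n) p).symm) (extChartAt (𝓡∂ n) p p) = 0 := by
    simpa only [Function.comp, (extChartAt (𝓡∂ n) p).left_inv hs] using (hy.zero_iff p).2 hp
  have hVe : ∀ u, localField V p u =
      (y ∘ (extChartAt (𝓡∂ n) p).symm) u • localField W p u := by
    intro u
    rw [localField, hVW, map_smul]
    rfl
  set X := x ∘ (extChartAt (𝓡∂ n) p).symm
  set Y := y ∘ (extChartAt (𝓡∂ n) p).symm
  -- With `V = Y W`, one has `dX(V) = Y f₂`, where `f₂ = dX(W)` vanishes at `p` because `W` is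
  -- tangent to the boundary. Both factors are `O(t)` along the curve, so the product is `O(t²)` and
  -- its differential is `O(t)`.
  set f₂ : EuclideanSpace ℝ (Fin n) → ℝ := fun u =>
    fderivWithin ℝ X (range (𝓡∂ n)) u (localField W p u) with hf₂
  have hf₂c : ∀ u ∈ (extChartAt (𝓡∂ n) p).target, ContDiffWithinAt ℝ ∞ f₂ (range (𝓡∂ n)) u :=
    fun u hu => contDiffWithinAt_fderivWithin_apply (hXc u hu) (hWc u hu) (hm u hu)
  have hτt := tendsto_curve hε hτ hτ0
  have OY := isBigO_id_along hε hτ hτ0 ((hYc _ hu).differentiableWithinAt (by simp)) hY0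
  have Of := isBigO_id_along hε hτ hτ0 ((hf₂c _ hu).differentiableWithinAt (by simp)) hX0
  have OW := isBigO_one_along hτt (hWc _ hu).continuousWithinAt
  have ODY := isBigO_one_along hτt ((hYc _ hu).fderivWithin_right (m := 0) (𝓡∂ n).uniqueDiffOn
    (by simp) (hm _ hu)).continuousWithinAt
  have ODf := isBigO_one_along hτt ((hf₂c _ hu).fderivWithin_right (m := 0) (𝓡∂ n).uniqueDiffOn
    (by simp) (hm _ hu)).continuousWithinAt
  have hfe : ∀ u, fderivWithin ℝ X (range (𝓡∂ n)) u (localField V p u) = Y u * f₂ u := by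
    intro u
    rw [hVe, map_smul, smul_eq_mul]
  refine ⟨?_, ?_, fun u => Y u * f₂ u, hfe, fun u hu => (hYc u hu).mul (hf₂c u hu), ?_⟩
  · simp only [hVe]
    simpa using OY.smul OW
  · simp only [hfe, sq]
    exact OY.mul Of
  · have h1 := (OY.smul ODf).add (Of.smul ODY)
    refine Asymptotics.IsBigO.congr' h1 ?_ (by simp)
    filter_upwards [hτt (extChartAt_source_mem_nhds (I := 𝓡∂ n) p)] with t ht
    have hut := (extChartAt (𝓡∂ n) p).map_source ht
    rw [fderivWithin_fun_mul ((𝓡∂ n).uniqueDiffOn _ (hm _ hut))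
      ((hYc _ hut).differentiableWithinAt (by simp)) ((hf₂c _ hut).differentiableWithinAt (by simp))]

end CurveEstimates

/-! ### Push-forward of scattering fields -/

section PushForward

variable {m n : ℕ} [NeZero m] [NeZero n]
  {X : Type*} [TopologicalSpace X] [ChartedSpace (EuclideanHalfSpace m) X] [IsManifold (𝓡∂ m) ∞ X]
  {X' : Type*} [TopologicalSpace X'] [ChartedSpace (EuclideanHalfSpace n) X']
  [IsManifold (𝓡∂ n) ∞ X']

/-- Since `dx(dφ Z) = d(x ∘ φ)(Z)` and `x ∘ φ` vanishes on `∂X`, the second estimate is the one for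
`Z` on `X` with `x ∘ φ` in place of `x`. The first multiplies the components of `Z` by the locally
bounded Jacobian of `φ`. -/
theorem IsScatteringField.isBigO_pushforward {Z : ∀ p : X, TangentSpace (𝓡∂ m) p}
    (hZ : IsScatteringField Z) {φ : X → X'} (hφ : ContMDiff (𝓡∂ m) (𝓡∂ n) ∞ φ)
    (hφb : ∀ p ∈ (𝓡∂ m).boundary X, φ p ∈ (𝓡∂ n).boundary X')
    {x : X' → ℝ} (hx : ContMDiff (𝓡∂ n) 𝓘(ℝ, ℝ) ∞ x) (hx0 : ∀ p ∈ (𝓡∂ n).boundary X', x p = 0)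
    {y : X} (hy : y ∈ (𝓡∂ m).boundary X) {σ : ℝ → X} {ε : ℝ} (hε : 0 < ε)
    (hσ : ContMDiffWithinAt 𝓘(ℝ, ℝ) (𝓡∂ m) ∞ σ (Ico 0 ε) 0) (hσ0 : σ 0 = y) :
    (fun t => coord (φ y) (φ (σ t)) (mfderiv (𝓡∂ m) (𝓡∂ n) φ (σ t) (Z (σ t))))
      =O[𝓝[>] 0] (fun t => t) ∧
    (fun t => fderivWithin ℝ (x ∘ (extChartAt (𝓡∂ n) (φ y)).symm) (range (𝓡∂ n))
      (extChartAt (𝓡∂ n) (φ y) (φ (σ t)))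
      (coord (φ y) (φ (σ t)) (mfderiv (𝓡∂ m) (𝓡∂ n) φ (σ t) (Z (σ t)))))
        =O[𝓝[>] 0] (fun t => t ^ 2) := by
  have hσt := tendsto_curve hε hσ hσ0
  have hφt := (hφ y).continuousAt.tendsto.comp hσt
  have hsrc := hσt (extChartAt_source_mem_nhds (I := 𝓡∂ m) y)
  have hsrc' := hφt (extChartAt_source_mem_nhds (I := 𝓡∂ n) (φ y))
  obtain ⟨h1, h2, -⟩ := hZ.isBigO_along (hx.comp hφ) (fun p hp => hx0 _ (hφb p hp)) hy hε hσ hσ0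
  have hchart : ∀ p, φ p ∈ (extChartAt (𝓡∂ n) (φ y)).source →
      ContMDiffAt (𝓡∂ m) 𝓘(ℝ, EuclideanSpace ℝ (Fin n)) ∞ (extChartAt (𝓡∂ n) (φ y) ∘ φ) p :=
    fun p hp => (contMDiffAt_extChartAt' (by simpa using hp)).comp p (hφ p)
  have hcomp : ∀ p, φ p ∈ (extChartAt (𝓡∂ n) (φ y)).source → ∀ v : TangentSpace (𝓡∂ m) p,
      coord (φ y) (φ p) (mfderiv (𝓡∂ m) (𝓡∂ n) φ p v) =
        mfderiv (𝓡∂ m) 𝓘(ℝ, EuclideanSpace ℝ (Fin n)) (extChartAt (𝓡∂ n) (φ y) ∘ φ) p v := by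
    intro p hp v
    have hd : MDifferentiableAt (𝓡∂ n) 𝓘(ℝ, EuclideanSpace ℝ (Fin n))
        (extChartAt (𝓡∂ n) (φ y)) (φ p) :=
      mdifferentiableAt_extChartAt (by simpa using hp)
    rw [mfderiv_comp p hd ((hφ p).mdifferentiableAt (by simp))]
    rfl
  constructor
  · have hΦ : ContDiffWithinAt ℝ ∞ ((extChartAt (𝓡∂ n) (φ y) ∘ φ) ∘ (extChartAt (𝓡∂ m) y).symm)
        (range (𝓡∂ m)) (extChartAt (𝓡∂ m) y y) := by
      rw [← contMDiffWithinAt_iff_contDiffWithinAt]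
      refine ContMDiffAt.comp_contMDiffWithinAt _ ?_
        (contMDiffWithinAt_extChartAt_symm_range y (mem_extChartAt_target y))
      rw [extChartAt_to_inv]
      exact hchart y (mem_extChartAt_source _)
    have hL := isBigO_one_along hσt ((hΦ.fderivWithin_right (m := 0) (𝓡∂ m).uniqueDiffOn
      (by simp) (extChartAt_target_subset_range y (mem_extChartAt_target y))).continuousWithinAt)
    refine (isBigO_clm_apply hL h1).congr' ?_ (by simp)
    filter_upwards [hsrc, hsrc'] with t ht ht'
    rw [hcomp _ ht', mfderiv_apply_eq_fderivWithin y ht ((hchart _ ht').mdifferentiableAt (by simp)),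
      localField_extChartAt Z y ht]
  · refine h2.congr' ?_ (by rfl)
    filter_upwards [hsrc, hsrc'] with t ht ht'
    replace ht' : φ (σ t) ∈ (extChartAt (𝓡∂ n) (φ y)).source := ht'
    rw [localField_extChartAt Z y ht, ← diff_eq_fderivWithin (hx.comp hφ) y ht,
      ← diff_eq_fderivWithin hx (φ y) ht', diff, diff,
      mfderiv_comp (σ t) ((hx _).mdifferentiableAt (by simp)) ((hφ _).mdifferentiableAt (by simp))]
    rfl

end PushForward

/-! ### Boundedness of the initial data -/

section Initial

theorem sqrt_conical_le {r K α D H G : ℝ} (hr : 0 < r) (hK : 1 ≤ K) (hα : |α| ≤ K)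
    (hD : |D| ≤ K * r ^ 2) (hH : |H| ≤ K * (K * r) * (K * r))
    (hG : G = α * (D * D) / r ^ 4 + H / r ^ 2) : √G ≤ 2 * K ^ 3 := by
  have hK0 : 0 ≤ K := by linarith
  have h1 : α * (D * D) / r ^ 4 ≤ K ^ 3 := by
    rw [div_le_iff₀ (by positivity)]
    have h2 : D * D ≤ (K * r ^ 2) * (K * r ^ 2) := by
      rw [← abs_mul_abs_self D]
      exact mul_self_le_mul_self (abs_nonneg _) hD
    calc α * (D * D) ≤ K * (K * r ^ 2 * (K * r ^ 2)) :=
          mul_le_mul ((le_abs_self _).trans hα) h2 (mul_self_nonneg _) hK0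
      _ = _ := by ring
  have h2 : H / r ^ 2 ≤ K ^ 3 := by
    rw [div_le_iff₀ (by positivity)]
    calc H ≤ _ := (le_abs_self _).trans hH
      _ = _ := by ring
  have h3 : 1 ≤ K ^ 3 := one_le_pow₀ hK
  rw [Real.sqrt_le_left (by positivity)]
  nlinarith

variable {m n : ℕ} [NeZero m] [NeZero n]
  {X : Type*} [TopologicalSpace X] [ChartedSpace (EuclideanHalfSpace m) X] [IsManifold (𝓡∂ m) ∞ X]
  {X' : Type*} [TopologicalSpace X'] [ChartedSpace (EuclideanHalfSpace n) X']
  [IsManifold (𝓡∂ n) ∞ X']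

/-- All estimates are made along `φ ∘ σ` in the single chart at `φ y`, first as powers of `t`, then
as powers of the function `x₀` that appears in the metric. -/
theorem IsConical.exists_initial_bound
    {g h : ∀ p : X', TangentSpace (𝓡∂ n) p →L[ℝ] TangentSpace (𝓡∂ n) p →L[ℝ] ℝ} {x₀ a : X' → ℝ}
    (hg : IsConical g x₀ a h) {x : X' → ℝ} (hx : IsBoundaryDefining (n := n) x)
    {V : ∀ p : X', TangentSpace (𝓡∂ n) p} (hV : IsScatteringField V)
    {φ : X → X'} (hφ : ContMDiff (𝓡∂ m) (𝓡∂ n) ∞ φ)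
    (hφb : ∀ p ∈ (𝓡∂ m).boundary X, φ p ∈ (𝓡∂ n).boundary X')
    {Z : ∀ p : X, TangentSpace (𝓡∂ m) p} (hZ : IsScatteringField Z)
    {y : X} (hy : y ∈ (𝓡∂ m).boundary X) {σ : ℝ → X} {ε : ℝ} (hε : 0 < ε)
    (hσ : ContMDiffWithinAt 𝓘(ℝ, ℝ) (𝓡∂ m) ∞ σ (Ico 0 ε) 0) (hσ0 : σ 0 = y)
    (hσx : ∀ t ∈ Ico 0 ε, x (φ (σ t)) = t) :
    ∃ C, ∀ᶠ t in 𝓝[>] (0 : ℝ), gnorm g (φ (σ t)) (V (φ (σ t))) ≤ C ∧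
      gnorm g (φ (σ t)) (mfderiv (𝓡∂ m) (𝓡∂ n) φ (σ t) (Z (σ t))) ≤ C ∧
      ∀ w, IsCovDerivAt g V (φ (σ t)) (mfderiv (𝓡∂ m) (𝓡∂ n) φ (σ t) (Z (σ t))) w →
        gnorm g (φ (σ t)) w ≤ C := by
  have hp := hφb y hy
  set p := φ y with hp_def
  have hu := mem_extChartAt_target (I := 𝓡∂ n) p
  have hs := mem_extChartAt_source (I := 𝓡∂ n) p
  have hm : ∀ u ∈ (extChartAt (𝓡∂ n) p).target, u ∈ range (𝓡∂ n) :=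
    fun u hu => extChartAt_target_subset_range p hu
  set τ : ℝ → X' := fun t => φ (σ t) with hτ_def
  have hτ : ContMDiffWithinAt 𝓘(ℝ, ℝ) (𝓡∂ n) ∞ τ (Ico 0 ε) 0 :=
    (hφ _).comp_contMDiffWithinAt 0 hσ
  have hτ0 : τ 0 = p := by rw [hτ_def, hp_def, ← hσ0]
  have hτt := tendsto_curve hε hτ hτ0
  have hzero : ∀ p ∈ (𝓡∂ n).boundary X', x₀ p = 0 := fun p hp => (hg.bdf.zero_iff p).2 hp
  have hXc := fun u (hu : u ∈ (extChartAt (𝓡∂ n) p).target) =>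
    contDiffWithinAt_range p (contDiffOn_comp_symm hg.bdf.smooth p) hu
  have hAc := fun u (hu : u ∈ (extChartAt (𝓡∂ n) p).target) =>
    contDiffWithinAt_range p (contDiffOn_comp_symm hg.smooth_left p) hu
  have hHc := fun u (hu : u ∈ (extChartAt (𝓡∂ n) p).target) =>
    contDiffWithinAt_range p (contDiffOn_localForm hg.smooth_right p) hu
  obtain ⟨xV, WV, hxV, hWV, hVW⟩ := id hV
  have hVc : ContDiffWithinAt ℝ ∞ (localField V p) (range (𝓡∂ n)) (extChartAt (𝓡∂ n) p p) := by
    have h1 := (contDiffWithinAt_range p (contDiffOn_comp_symm hxV.smooth p) hu).smul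
      (contDiffWithinAt_range p (contDiffOn_localField hWV.1 p) hu)
    refine h1.congr_of_mem (fun u _ => ?_) (hm _ hu)
    rw [localField, hVW, map_smul]
    rfl
  have hVd : ∀ u ∈ (extChartAt (𝓡∂ n) p).target, 0 < u 0 →
      DifferentiableAt ℝ (localField V p) u := by
    intro u hu h0
    have h1 := ((contDiffAt_of_target p (contDiffOn_comp_symm hxV.smooth p) hu h0).smul
      (contDiffAt_of_target p (contDiffOn_localField hWV.1 p) hu h0)).differentiableAt (by simp)
    refine h1.congr_of_eventuallyEq (Eventually.of_forall fun u => ?_)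
    simp only [localField, hVW, map_smul]
    rfl
  have hX0 : (x₀ ∘ (extChartAt (𝓡∂ n) p).symm) (extChartAt (𝓡∂ n) p p) = 0 := by
    simpa only [Function.comp, (extChartAt (𝓡∂ n) p).left_inv hs] using hzero p hp
  obtain ⟨OV, OXV, f, hf, hfc, ODf⟩ := hV.isBigO_along hg.bdf.smooth hzero hp hε hτ hτ0
  obtain ⟨Ov, OXv⟩ := hZ.isBigO_pushforward hφ hφb hg.bdf.smooth hzero hy hε hσ hσ0
  obtain ⟨K₀, hK₀, hell⟩ := hg.exists_elliptic hp
  obtain ⟨_, K₁, _, hK₁, hcx⟩ := hx.exists_comparison hp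
  obtain ⟨c₁, _, hc₁, _, hcx₀⟩ := hg.bdf.exists_comparison hp
  set Xc := x₀ ∘ (extChartAt (𝓡∂ n) p).symm with hXc_def
  set Ac := a ∘ (extChartAt (𝓡∂ n) p).symm with hAc_def
  set αc : EuclideanSpace ℝ (Fin n) → ℝ := fun u => 1 + Xc u * Ac u with hαc_def
  set u : ℝ → EuclideanSpace ℝ (Fin n) := fun t => extChartAt (𝓡∂ n) p (τ t) with hu_def
  set v : ℝ → EuclideanSpace ℝ (Fin n) := fun t =>
    coord p (φ (σ t)) (mfderiv (𝓡∂ m) (𝓡∂ n) φ (σ t) (Z (σ t))) with hv_def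
  have hαc : ∀ u ∈ (extChartAt (𝓡∂ n) p).target, ContDiffWithinAt ℝ ∞ αc (range (𝓡∂ n)) u :=
    fun u hu => contDiffWithinAt_const.add ((hXc u hu).mul (hAc u hu))
  have Oα := isBigO_one_along hτt (hαc _ hu).continuousWithinAt
  have ODα := isBigO_one_along hτt ((hαc _ hu).fderivWithin_right (m := 0) (𝓡∂ n).uniqueDiffOn
    (by simp) (hm _ hu)).continuousWithinAt
  have Oh := isBigO_one_along hτt (hHc _ hu).continuousWithinAt
  have ODh := isBigO_one_along hτt ((hHc _ hu).fderivWithin_right (m := 0) (𝓡∂ n).uniqueDiffOn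
    (by simp) (hm _ hu)).continuousWithinAt
  have ODV := isBigO_clm_apply (isBigO_one_along hτt ((hVc.fderivWithin_right (m := 0)
    (𝓡∂ n).uniqueDiffOn (by simp) (hm _ hu)).continuousWithinAt)) Ov
  simp only [one_mul] at ODV
  have OF : (fun t => fderivWithin ℝ f (range (𝓡∂ n)) (u t) (v t)) =O[𝓝[>] 0] fun t => t ^ 2 := by
    simp only [sq]
    exact isBigO_clm_apply ODf Ov
  have hIoo : ∀ᶠ t in 𝓝[>] (0 : ℝ), t ∈ Ioo 0 ε := Ioo_mem_nhdsGT hε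
  have hint : ∀ t ∈ Ioo 0 ε, τ t ∈ (𝓡∂ n).interior X' := by
    intro t ht
    rw [← (𝓡∂ n).compl_boundary]
    intro hb
    have := hσx t ⟨ht.1.le, ht.2⟩
    rw [(hx.zero_iff _).2 hb] at this
    exact ht.1.ne this
  have hsrc := hτt (extChartAt_source_mem_nhds (I := 𝓡∂ n) p)
  have hev := (tendsto_extChartAt_range (n := n) p).comp hτt
  -- Here `t` is the value of `x` on the curve, at most `K₁` times the normal coordinate, which in
  -- turn is at most `x₀ / c₁`.
  have Or : (fun t : ℝ => t) =O[𝓝[>] 0] fun t => Xc (u t) := by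
    refine Asymptotics.IsBigO.of_bound (K₁ / c₁) ?_
    filter_upwards [hIoo, hsrc, hev.eventually hcx, hev.eventually hcx₀] with t ht hts h1 h2
    have e1 : x ((extChartAt (𝓡∂ n) p).symm (extChartAt (𝓡∂ n) p (τ t))) = t := by
      rw [(extChartAt (𝓡∂ n) p).left_inv hts]
      exact hσx t ⟨ht.1.le, ht.2⟩
    have h3 : t ≤ K₁ * u t 0 := by
      have := h1.2
      rwa [Function.comp, e1] at this
    have h4 : c₁ * u t 0 ≤ Xc (u t) := h2.1
    have h5 : 0 ≤ Xc (u t) := hg.bdf.nonneg _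
    rw [Real.norm_of_nonneg ht.1.le, Real.norm_of_nonneg h5, div_mul_eq_mul_div,
      le_div_iff₀ hc₁]
    nlinarith
  have Or2 : (fun t : ℝ => t ^ 2) =O[𝓝[>] 0] fun t => Xc (u t) ^ 2 := Or.pow 2
  have hXlt : ∀ᶠ t in 𝓝[>] (0 : ℝ), Xc (u t) < 1 :=
    ((hXc _ hu).continuousWithinAt.tendsto.comp hev).eventually_lt_const (by rw [hX0]; norm_num)
  -- A big-O bound holds with every sufficiently large constant, so one `K` serves all the
  -- estimates.
  obtain ⟨K, hK1, hK2, bV, bXV, bv, bXv, bα, bDα, bh, bDh, bDV, bF⟩ :=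
    ((eventually_ge_atTop (1 : ℝ)).and <| (eventually_ge_atTop K₀).and <|
      (Asymptotics.isBigO_iff_eventually.1 (OV.trans Or)).and <|
      (Asymptotics.isBigO_iff_eventually.1 (OXV.trans Or2)).and <|
      (Asymptotics.isBigO_iff_eventually.1 (Ov.trans Or)).and <|
      (Asymptotics.isBigO_iff_eventually.1 (OXv.trans Or2)).and <|
      (Asymptotics.isBigO_iff_eventually.1 Oα).and <|
      (Asymptotics.isBigO_iff_eventually.1 ODα).and <|
      (Asymptotics.isBigO_iff_eventually.1 Oh).and <|
      (Asymptotics.isBigO_iff_eventually.1 ODh).and <|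
      (Asymptotics.isBigO_iff_eventually.1 (ODV.trans Or)).and <|
      (Asymptotics.isBigO_iff_eventually.1 (OF.trans Or2))).exists
  refine ⟨2 * K ^ 3 + 10 * (K ^ 4) ^ 4, ?_⟩
  filter_upwards [hIoo, hsrc, hXlt, hev.eventually hell, bV, bXV, bv, bXv, bα, bDα, bh, bDh, bDV,
    bF] with t ht hts hX1 hell bV bXV bv bXv bα bDα bh bDh bDV bF
  clear OV OXV ODf Ov OXv Oα ODα Oh ODh ODV OF Or Or2
  have hti := hint t ht
  have hut := (extChartAt (𝓡∂ n) p).map_source hts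
  have h0 : 0 < u t 0 := (mem_interior_iff p hts).1 hti
  have hr := range_mem_nhds h0
  have hX0' : 0 < Xc (u t) := hg.bdf.pos ((symm_mem_interior_iff p hut).2 h0)
  have hK0 : 0 ≤ K := by linarith
  have hK3 : 0 ≤ 2 * K ^ 3 := by positivity
  have hK4 : 0 ≤ 10 * (K ^ 4) ^ 4 := by positivity
  have nX : ‖Xc (u t)‖ = Xc (u t) := Real.norm_of_nonneg hX0'.le
  simp only [norm_one, mul_one, norm_pow, nX, Real.norm_eq_abs] at bV bXV bv bXv bα bDα bh bDh bDV bF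
  have bh2 : ∀ a b, |localForm h p (u t) a b| ≤ K * ‖a‖ * ‖b‖ := fun a b =>
    ContinuousLinearMap.le_of_opNorm_le _ (ContinuousLinearMap.le_of_opNorm_le _ bh a) b
  have bDh3 : ∀ a b c, |fderivWithin ℝ (localForm h p) (range (𝓡∂ n)) (u t) a b c| ≤
      K * ‖a‖ * ‖b‖ * ‖c‖ := fun a b c =>
    ContinuousLinearMap.le_of_opNorm_le _ (ContinuousLinearMap.le_of_opNorm_le _
      (ContinuousLinearMap.le_of_opNorm_le _ bDh a) b) c
  have bHV : |localForm h p (u t) (localField V p (u t)) (localField V p (u t))| ≤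
      K * (K * Xc (u t)) * (K * Xc (u t)) := (bh2 _ _).trans (by gcongr)
  have bHv : |localForm h p (u t) (v t) (v t)| ≤
      K * (K * Xc (u t)) * (K * Xc (u t)) := (bh2 _ _).trans (by gcongr)
  have hellK : ∀ ξ, ‖ξ‖ ≤ K * Xc (u t) * √(localForm g p (u t) ξ ξ) ∧
      |fderivWithin ℝ Xc (range (𝓡∂ n)) (u t) ξ| ≤
        K * Xc (u t) ^ 2 * √(localForm g p (u t) ξ ξ) := by
    intro ξ
    have e1 : ‖ξ‖ ≤ K₀ * Xc (u t) * √(localForm g p (u t) ξ ξ) := (hell h0 ξ).1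
    have e2 : |fderivWithin ℝ Xc (range (𝓡∂ n)) (u t) ξ| ≤
      K₀ * Xc (u t) ^ 2 * √(localForm g p (u t) ξ ξ) := (hell h0 ξ).2
    exact ⟨e1.trans (by gcongr), e2.trans (by gcongr)⟩
  -- For `t > 0` the curve lies in the interior, where derivatives within the half-space are
  -- ordinary derivatives.
  have hfe : (fun u' => fderiv ℝ Xc u' (localField V p u')) =ᶠ[𝓝 (u t)] f := by
    filter_upwards [eventually_target p hut h0] with u' hu'
    rw [← hf, fderivWithin_of_mem_nhds (range_mem_nhds hu'.2)]
  refine ⟨?_, ?_, fun w hw => ?_⟩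
  · rw [gnorm_eq_sqrt_localForm p hts, ← localField_extChartAt V p hts]
    have := sqrt_conical_le hX0' hK1 bα bXV bHV (hg.localForm_eq p hut h0 _ _)
    linarith
  · rw [gnorm_eq_sqrt_localForm p hts]
    have := sqrt_conical_le hX0' hK1 bα bXv bHv (hg.localForm_eq p hut h0 _ _)
    linarith
  · have e1 : coord p (τ t) w = fderiv ℝ (localField V p) (u t) (v t) +
        christoffel (chartMetric g (chartAt (EuclideanHalfSpace n) p)) (u t) (v t)
          (coord p (τ t) (V (τ t))) :=
      hw _ (IsManifold.chart_mem_maximalAtlas p) (by rwa [extChartAt_source] at hts)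
    rw [← localField_extChartAt V p hts] at e1
    rw [gnorm_eq_sqrt_localForm p hts, e1]
    replace bDα : ‖fderivWithin ℝ αc (range (𝓡∂ n)) (u t)‖ ≤ K := bDα
    replace bXV : |fderivWithin ℝ Xc (range (𝓡∂ n)) (u t) (localField V p (u t))| ≤
      K * Xc (u t) ^ 2 := bXV
    replace bXv : |fderivWithin ℝ Xc (range (𝓡∂ n)) (u t) (v t)| ≤ K * Xc (u t) ^ 2 := bXv
    replace bDV : ‖fderivWithin ℝ (localField V p) (range (𝓡∂ n)) (u t) (v t)‖ ≤
      K * Xc (u t) := bDV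
    simp only [fderivWithin_of_mem_nhds hr] at bXV bXv bDα bDh3 bDV bF hellK
    have := sqrt_covDeriv_le (hg.differentiableAt_localForm p hut h0)
      (hg.localForm_symm p hut h0) (hg.localForm_pos p hut h0)
      (m := chartMetric g (chartAt (EuclideanHalfSpace n) p)) (fun u i j => chartMetric_chartAt g p u i j)
      ((contDiffAt_of_target p (contDiffOn_comp_symm hg.bdf.smooth p) hut h0).of_le (by norm_cast))
      (((hαc _ hut).contDiffAt hr).differentiableAt (by simp))
      (((hHc _ hut).contDiffAt hr).differentiableAt (by simp))
      (hVd _ hut h0) (hg.eventually_localForm_eq p hut h0) hK1 hX0' hX1.le (v t) bα bDα bh2 bDh3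
      bv bV bDV bXv bXV (by rw [hfe.fderiv_eq]; exact bF) (fun ξ => (hellK ξ).1)
      (fun ξ => (hellK ξ).2)
    refine this.trans ?_
    linarith

end Initial

/-! ### Differential inequalities on the unit interval -/

theorem le_of_deriv_le {f f' : ℝ → ℝ} {M s : ℝ} (hf : ∀ s, HasDerivAt f (f' s) s)
    (hb : ∀ s ∈ Icc (0 : ℝ) 1, f' s ≤ M) (hs : s ∈ Icc (0 : ℝ) 1) : f s ≤ f 0 + M * s := by
  have := (convex_Icc (0 : ℝ) 1).image_sub_le_mul_sub_of_deriv_le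
    (fun s _ => (hf s).continuousAt.continuousWithinAt)
    (fun s _ => (hf s).differentiableAt.differentiableWithinAt)
    (fun s hs => by rw [(hf s).deriv]; exact hb s (interior_subset hs))
    0 ⟨le_rfl, zero_le_one⟩ s hs hs.1
  linarith

/-- The square root is not differentiable at zeros of `f`, so `√(f + δ²)` is used instead and `δ` is
arbitrary. -/
theorem sqrt_le_of_deriv_le {f f' : ℝ → ℝ} {M s : ℝ} (hM : 0 ≤ M)
    (hf : ∀ s, HasDerivAt f (f' s) s) (h0 : ∀ s, 0 ≤ f s)
    (hb : ∀ s ∈ Icc (0 : ℝ) 1, f' s ≤ 2 * M * √(f s)) (hs : s ∈ Icc (0 : ℝ) 1) :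
    √(f s) ≤ √(f 0) + M * s := by
  refine le_of_forall_pos_le_add fun δ hδ => ?_
  have hδ2 : 0 < δ ^ 2 := by positivity
  have h1 : ∀ s, HasDerivAt (fun s => √(f s + δ ^ 2)) (f' s / (2 * √(f s + δ ^ 2))) s := fun s =>
    ((hf s).add_const _).sqrt (by have := h0 s; positivity)
  have h2 := le_of_deriv_le h1 (M := M) (fun s hs => by
    have h3 : 0 < √(f s + δ ^ 2) := Real.sqrt_pos.2 (by have := h0 s; positivity)
    rw [div_le_iff₀ (by positivity)]
    have h4 : √(f s) ≤ √(f s + δ ^ 2) := Real.sqrt_le_sqrt (by linarith)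
    nlinarith [hb s hs, mul_le_mul_of_nonneg_left h4 hM]) hs
  have h5 : √(f s) ≤ √(f s + δ ^ 2) := Real.sqrt_le_sqrt (by linarith)
  have h6 : √(f 0 + δ ^ 2) ≤ √(f 0) + δ := by
    rw [Real.sqrt_le_left (by positivity)]
    nlinarith [Real.sq_sqrt (h0 0), Real.sqrt_nonneg (f 0)]
  linarith

/-- Gronwall: `f(s) exp(-K s)` does not increase. -/
theorem le_exp_of_deriv_le {f f' : ℝ → ℝ} {K s : ℝ} (hf : ∀ s, HasDerivAt f (f' s) s)
    (hb : ∀ s ∈ Icc (0 : ℝ) 1, f' s ≤ K * f s) (hs : s ∈ Icc (0 : ℝ) 1) :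
    f s ≤ f 0 * Real.exp (K * s) := by
  have h1 : ∀ s, HasDerivAt (fun s => f s * Real.exp (-(K * s)))
      (f' s * Real.exp (-(K * s)) + f s * (Real.exp (-(K * s)) * -(K * 1))) s := fun s =>
    (hf s).fun_mul (((hasDerivAt_id s).const_mul K).fun_neg.exp)
  have h2 := le_of_deriv_le h1 (M := 0) (fun s hs => by
    nlinarith [hb s hs, Real.exp_pos (-(K * s)),
      mul_nonneg (sub_nonneg.2 (hb s hs)) (Real.exp_pos (-(K * s))).le]) hs
  have h3 : Real.exp (-(K * s)) * Real.exp (K * s) = 1 := by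
    rw [← Real.exp_add]; simp
  simp only [mul_zero, neg_zero, Real.exp_zero, mul_one, zero_mul, add_zero] at h2
  calc f s = f s * Real.exp (-(K * s)) * Real.exp (K * s) := by rw [mul_assoc, h3, mul_one]
    _ ≤ _ := mul_le_mul_of_nonneg_right h2 (Real.exp_pos _).le

/-! ### Vector fields along curves -/

section Curves

variable {n : ℕ} [NeZero n] {M : Type*} [TopologicalSpace M]
  [ChartedSpace (EuclideanHalfSpace n) M] [IsManifold (𝓡∂ n) ∞ M]
  {g h : ∀ p : M, TangentSpace (𝓡∂ n) p →L[ℝ] TangentSpace (𝓡∂ n) p →L[ℝ] ℝ} {x a : M → ℝ}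

theorem gnorm_nonneg (g : ∀ p : M, TangentSpace (𝓡∂ n) p →L[ℝ] TangentSpace (𝓡∂ n) p →L[ℝ] ℝ)
    (p : M) (v : TangentSpace (𝓡∂ n) p) : 0 ≤ gnorm g p v :=
  Real.sqrt_nonneg _

theorem gnorm_neg (g : ∀ p : M, TangentSpace (𝓡∂ n) p →L[ℝ] TangentSpace (𝓡∂ n) p →L[ℝ] ℝ)
    (p : M) (v : TangentSpace (𝓡∂ n) p) : gnorm g p (-v) = gnorm g p v := by
  simp [gnorm]

theorem IsConical.sq_gnorm (hg : IsConical g x a h) {p : M} (hp : p ∈ (𝓡∂ n).interior M)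
    (v : TangentSpace (𝓡∂ n) p) : gnorm g p v ^ 2 = g p v v :=
  Real.sq_sqrt (hg.metric_nonneg hp v)

theorem IsConical.abs_metric_le (hg : IsConical g x a h) {p : M} (hp : p ∈ (𝓡∂ n).interior M)
    (v w : TangentSpace (𝓡∂ n) p) : |g p v w| ≤ gnorm g p v * gnorm g p w := by
  have h1 : ∀ t : ℝ, 0 ≤ g p w w * (t * t) + 2 * g p v w * t + g p v v := fun t => by
    have := hg.metric_nonneg hp (v + t • w)
    simp only [map_add, map_smul, add_apply, smul_apply, smul_eq_mul, hg.metric_symm hp w v] at this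
    linarith
  have h2 := discrim_le_zero h1
  rw [discrim] at h2
  refine abs_le_of_sq_le_sq (b := gnorm g p v * gnorm g p w) ?_
    (mul_nonneg (gnorm_nonneg _ _ _) (gnorm_nonneg _ _ _))
  rw [mul_pow, hg.sq_gnorm hp, hg.sq_gnorm hp]
  linarith

theorem hasDerivAt_extChartAt_comp {γ : ℝ → M} (q : M) {s : ℝ}
    (hγ : MDifferentiableAt 𝓘(ℝ, ℝ) (𝓡∂ n) γ s) (hs : γ s ∈ (extChartAt (𝓡∂ n) q).source) :
    HasDerivAt (fun s => extChartAt (𝓡∂ n) q (γ s)) (coord q (γ s) (velocity γ s)) s := by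
  have := isManifold_one (n := n) (M := M)
  have h1 : MDifferentiableAt (𝓡∂ n) 𝓘(ℝ, EuclideanSpace ℝ (Fin n)) (extChartAt (𝓡∂ n) q) (γ s) :=
    mdifferentiableAt_extChartAt (by rwa [extChartAt_source] at hs)
  have h2 : HasFDerivAt (fun s => extChartAt (𝓡∂ n) q (γ s))
      (ContinuousLinearMap.comp (coord q (γ s)) (mfderiv 𝓘(ℝ, ℝ) (𝓡∂ n) γ s) :
        ℝ →L[ℝ] EuclideanSpace ℝ (Fin n)) s :=
    (h1.hasMFDerivAt.comp s hγ.hasMFDerivAt).hasFDerivAt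
  exact h2.hasDerivAt

theorem hasDerivAt_comp_velocity {f : M → ℝ} (hf : ContMDiff (𝓡∂ n) 𝓘(ℝ, ℝ) ∞ f) {γ : ℝ → M}
    {s : ℝ} (hγ : MDifferentiableAt 𝓘(ℝ, ℝ) (𝓡∂ n) γ s) :
    HasDerivAt (fun s => f (γ s)) (diff f (γ s) (velocity (n := n) γ s)) s := by
  have h1 : HasFDerivAt (fun s => f (γ s))
      (ContinuousLinearMap.comp (mfderiv (𝓡∂ n) 𝓘(ℝ, ℝ) f (γ s))
        (mfderiv 𝓘(ℝ, ℝ) (𝓡∂ n) γ s) : ℝ →L[ℝ] ℝ) s :=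
    ((hf.mdifferentiable (by simp) (γ s)).hasMFDerivAt.comp s hγ.hasMFDerivAt).hasFDerivAt
  exact h1.hasDerivAt

/-- Metric compatibility. In the Koszul formula with both other slots equal to `Y` the last two
terms cancel, so the Christoffel terms absorb the derivative of the coefficients of `g` along `γ`.
-/
theorem IsCovDerivAlong.hasDerivAt_metric (hg : IsConical g x a h) {γ : ℝ → M}
    (hγ : MDifferentiable 𝓘(ℝ, ℝ) (𝓡∂ n) γ) (hi : ∀ s, γ s ∈ (𝓡∂ n).interior M)
    {Y DY : ∀ s, TangentSpace (𝓡∂ n) (γ s)} (hY : IsCovDerivAlong g γ Y DY) (s : ℝ) :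
    HasDerivAt (fun s => g (γ s) (Y s) (Y s)) (2 * g (γ s) (DY s) (Y s)) s := by
  set q := γ s with hq
  have hs : γ s ∈ (extChartAt (𝓡∂ n) q).source := mem_extChartAt_source q
  have hu := (extChartAt (𝓡∂ n) q).map_source hs
  have h0 := (mem_interior_iff q hs).1 (hi s)
  have hy := hY _ (IsManifold.chart_mem_maximalAtlas q) s (by rwa [extChartAt_source] at hs)
  have hG := hg.differentiableAt_localForm q hu h0
  have h1 := hG.hasFDerivAt.comp_hasDerivAt s (hasDerivAt_extChartAt_comp q (hγ s) hs)
  have h2 := (h1.clm_apply hy).clm_apply hy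
  have h3 : (fun s' => g (γ s') (Y s') (Y s')) =ᶠ[𝓝 s] fun s' =>
      localForm g q (extChartAt (𝓡∂ n) q (γ s')) (coord q (γ s') (Y s')) (coord q (γ s') (Y s')) := by
    filter_upwards [(hγ s).continuousAt.preimage_mem_nhds (extChartAt_source_mem_nhds (I := 𝓡∂ n) q)]
      with s' hs'
    rw [localForm_coord g q hs']
  refine (h2.congr_of_eventuallyEq h3).congr_deriv ?_
  have hk := koszul_christoffel hG (hg.localForm_symm q hu h0) (hg.localForm_pos q hu h0)
    (fun u i j => chartMetric_chartAt g q u i j) (coord q (γ s) (velocity γ s))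
    (coord q (γ s) (Y s)) (coord q (γ s) (Y s))
  have h4 := localForm_coord g q hs (DY s) (Y s)
  have h5 := hg.localForm_symm q hu h0 (coord q (γ s) (Y s))
  simp only [Function.comp_apply, add_apply, map_sub, sub_apply, chartVec_chartAt]
  rw [← h4]
  have h6 := h5 (coord q (γ s) (DY s))
  have h7 := h5 (christoffel (chartMetric g (chartAt (EuclideanHalfSpace n) q))
    (extChartAt (𝓡∂ n) q (γ s)) (coord q (γ s) (velocity γ s)) (coord q (γ s) (Y s)))
  change _ + (_ - localForm g q (extChartAt (𝓡∂ n) q (γ s))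
    (christoffel (chartMetric g (chartAt (EuclideanHalfSpace n) q)) (extChartAt (𝓡∂ n) q (γ s))
      (coord q (γ s) (velocity γ s)) (coord q (γ s) (Y s))) _) +
    (_ - localForm g q (extChartAt (𝓡∂ n) q (γ s)) _ (christoffel
      (chartMetric g (chartAt (EuclideanHalfSpace n) q)) (extChartAt (𝓡∂ n) q (γ s))
      (coord q (γ s) (velocity γ s)) (coord q (γ s) (Y s)))) = _
  linarith

theorem IsCovDerivAlong.gnorm_le (hg : IsConical g x a h) {γ : ℝ → M}
    (hγ : MDifferentiable 𝓘(ℝ, ℝ) (𝓡∂ n) γ) (hi : ∀ s, γ s ∈ (𝓡∂ n).interior M)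
    {Y DY : ∀ s, TangentSpace (𝓡∂ n) (γ s)} (hY : IsCovDerivAlong g γ Y DY) {B : ℝ}
    (hB : ∀ s ∈ Icc (0 : ℝ) 1, gnorm g (γ s) (DY s) ≤ B) {s : ℝ} (hs : s ∈ Icc (0 : ℝ) 1) :
    gnorm g (γ s) (Y s) ≤ gnorm g (γ 0) (Y 0) + B * s := by
  refine sqrt_le_of_deriv_le ((gnorm_nonneg _ _ _).trans (hB 0 ⟨le_rfl, zero_le_one⟩))
    (hY.hasDerivAt_metric hg hγ hi) (fun s => hg.metric_nonneg (hi s) _) (fun s hs => ?_) hs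
  have h1 := (le_abs_self _).trans (hg.abs_metric_le (hi s) (DY s) (Y s))
  have h2 := mul_le_mul_of_nonneg_right (hB s hs) (gnorm_nonneg g (γ s) (Y s))
  change _ ≤ 2 * B * gnorm g (γ s) (Y s)
  linarith

/-- A vector field along a curve and its covariant derivative grow at most exponentially, if the
second covariant derivative is bounded by the field. -/
theorem IsCovDerivAlong.exists_gnorm_le (hg : IsConical g x a h) {γ : ℝ → M}
    (hγ : MDifferentiable 𝓘(ℝ, ℝ) (𝓡∂ n) γ) (hi : ∀ s, γ s ∈ (𝓡∂ n).interior M)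
    {Y DY DDY : ∀ s, TangentSpace (𝓡∂ n) (γ s)} (hY : IsCovDerivAlong g γ Y DY)
    (hDY : IsCovDerivAlong g γ DY DDY) {B C : ℝ} (hB0 : 0 ≤ B) (hC : 0 ≤ C)
    (hB : ∀ s ∈ Icc (0 : ℝ) 1, gnorm g (γ s) (DDY s) ≤ B * gnorm g (γ s) (Y s))
    (h0 : gnorm g (γ 0) (Y 0) ≤ C) (h1 : gnorm g (γ 0) (DY 0) ≤ C) {s : ℝ}
    (hs : s ∈ Icc (0 : ℝ) 1) :
    gnorm g (γ s) (Y s) ≤ 2 * C * Real.exp (1 + B) := by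
  -- The energy `‖Y‖² + ‖DY‖²` has derivative at most `2 (1 + B) ‖Y‖ ‖DY‖`, hence at most `1 + B`
  -- times itself.
  have e1 := le_exp_of_deriv_le (K := 1 + B)
    (fun s => (hY.hasDerivAt_metric hg hγ hi s).fun_add (hDY.hasDerivAt_metric hg hγ hi s))
    (fun s hs => by
      have f1 := (le_abs_self _).trans (hg.abs_metric_le (hi s) (DY s) (Y s))
      have f2 := (le_abs_self _).trans (hg.abs_metric_le (hi s) (DDY s) (DY s))
      have f3 := mul_le_mul_of_nonneg_right (hB s hs) (gnorm_nonneg g (γ s) (DY s))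
      rw [← hg.sq_gnorm (hi s), ← hg.sq_gnorm (hi s)]
      nlinarith [mul_nonneg (add_nonneg zero_le_one hB0)
        (sq_nonneg (gnorm g (γ s) (Y s) - gnorm g (γ s) (DY s)))]) hs
  rw [← hg.sq_gnorm (hi s), ← hg.sq_gnorm (hi s), ← hg.sq_gnorm (hi 0), ← hg.sq_gnorm (hi 0)] at e1
  have e2 : Real.exp ((1 + B) * s) ≤ Real.exp (1 + B) :=
    Real.exp_le_exp.2 (mul_le_of_le_one_right (by linarith) hs.2)
  have e3 : 1 ≤ Real.exp (1 + B) := Real.one_le_exp (by linarith)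
  have e4 : gnorm g (γ 0) (Y 0) ^ 2 + gnorm g (γ 0) (DY 0) ^ 2 ≤ C ^ 2 + C ^ 2 :=
    add_le_add (pow_le_pow_left₀ (gnorm_nonneg _ _ _) h0 2)
      (pow_le_pow_left₀ (gnorm_nonneg _ _ _) h1 2)
  refine le_of_sq_le_sq ?_ (by positivity)
  calc gnorm g (γ s) (Y s) ^ 2 ≤ (C ^ 2 + C ^ 2) * Real.exp (1 + B) := by
        nlinarith [mul_le_mul e4 e2 (Real.exp_pos _).le (by positivity), sq_nonneg (gnorm g (γ s) (DY s))]
    _ ≤ (2 * C * Real.exp (1 + B)) ^ 2 := by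
        nlinarith [mul_le_mul_of_nonneg_left e3 (mul_nonneg (sq_nonneg C) (Real.exp_pos (1 + B)).le),
          mul_nonneg (sq_nonneg C) (Real.exp_pos (1 + B)).le]

theorem christoffel_sub (G : EuclideanSpace ℝ (Fin n) → Matrix (Fin n) (Fin n) ℝ)
    (u v w w' : EuclideanSpace ℝ (Fin n)) :
    christoffel G u v (w - w') = christoffel G u v w - christoffel G u v w' := by
  ext k
  simp [christoffel, mul_sub, Finset.sum_sub_distrib]

theorem christoffel_smul (G : EuclideanSpace ℝ (Fin n) → Matrix (Fin n) (Fin n) ℝ)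
    (u v w : EuclideanSpace ℝ (Fin n)) (r : ℝ) :
    christoffel G u v (r • w) = r • christoffel G u v w := by
  ext k
  simp only [christoffel, PiLp.smul_apply, smul_eq_mul, Finset.mul_sum]
  exact Finset.sum_congr rfl fun i _ => Finset.sum_congr rfl fun j _ => by ring

theorem chartVec_sub (e : OpenPartialHomeomorph M (EuclideanHalfSpace n)) (p : M)
    (v w : TangentSpace (𝓡∂ n) p) : chartVec e p (v - w) = chartVec e p v - chartVec e p w :=
  map_sub (mfderiv (𝓡∂ n) 𝓘(ℝ, EuclideanSpace ℝ (Fin n)) (e.extend (𝓡∂ n)) p) v w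

theorem chartVec_smul (e : OpenPartialHomeomorph M (EuclideanHalfSpace n)) (p : M) (r : ℝ)
    (v : TangentSpace (𝓡∂ n) p) : chartVec e p (r • v) = r • chartVec e p v :=
  map_smul (mfderiv (𝓡∂ n) 𝓘(ℝ, EuclideanSpace ℝ (Fin n)) (e.extend (𝓡∂ n)) p) r v

theorem chartVec_zero (e : OpenPartialHomeomorph M (EuclideanHalfSpace n)) (p : M) :
    chartVec e p 0 = 0 :=
  map_zero (mfderiv (𝓡∂ n) 𝓘(ℝ, EuclideanSpace ℝ (Fin n)) (e.extend (𝓡∂ n)) p)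

theorem IsCovDerivAlong.sub {γ : ℝ → M} {Y DY Y' DY' : ∀ s, TangentSpace (𝓡∂ n) (γ s)}
    (hY : IsCovDerivAlong g γ Y DY) (hY' : IsCovDerivAlong g γ Y' DY') :
    IsCovDerivAlong g γ (fun s => Y s - Y' s) fun s => DY s - DY' s := by
  intro e he s hs
  simp only [chartVec_sub, christoffel_sub]
  exact ((hY e he s hs).fun_sub (hY' e he s hs)).congr_deriv (by abel)

theorem IsParallelAlong.smul_id {γ : ℝ → M} {Y : ∀ s, TangentSpace (𝓡∂ n) (γ s)}
    (hY : IsParallelAlong g γ Y) : IsCovDerivAlong g γ (fun s => s • Y s) Y := by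
  intro e he s hs
  simp only [chartVec_smul, christoffel_smul]
  refine ((hasDerivAt_id s).fun_smul (hY e he s hs)).congr_deriv ?_
  rw [chartVec_zero, id, one_smul, zero_sub, smul_neg, sub_eq_add_neg, add_comm]

end Curves

/-! ### Jacobi fields with bounded initial data -/

section Jacobi

variable {n : ℕ} [NeZero n] {M : Type*} [TopologicalSpace M]
  [ChartedSpace (EuclideanHalfSpace n) M] [IsManifold (𝓡∂ n) ∞ M]
  {g h : ∀ p : M, TangentSpace (𝓡∂ n) p →L[ℝ] TangentSpace (𝓡∂ n) p →L[ℝ] ℝ} {x₀ a : M → ℝ}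

theorem gnorm_zero (g : ∀ p : M, TangentSpace (𝓡∂ n) p →L[ℝ] TangentSpace (𝓡∂ n) p →L[ℝ] ℝ)
    (p : M) : gnorm g p 0 = 0 := by
  simp [gnorm]

/-- The derivative of `1/x` along `γ` is `-dx(γ') / x²`, so the factor `x²` in the gradient estimate
cancels. -/
theorem IsBoundaryDefining.abs_inv_sub_inv_le {x : M → ℝ} (hx : IsBoundaryDefining (n := n) x)
    {C : ℝ} (hC0 : 0 ≤ C) (hC : ∀ p ∈ (𝓡∂ n).interior M, ∀ v : TangentSpace (𝓡∂ n) p,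
      |diff x p v| ≤ C * x p ^ 2 * gnorm g p v) {γ : ℝ → M}
    (hγ : MDifferentiable 𝓘(ℝ, ℝ) (𝓡∂ n) γ) (hi : ∀ s, γ s ∈ (𝓡∂ n).interior M) {B : ℝ}
    (hB : ∀ s ∈ Icc (0 : ℝ) 1, gnorm g (γ s) (velocity γ s) ≤ B) {s : ℝ}
    (hs : s ∈ Icc (0 : ℝ) 1) : |1 / x (γ s) - 1 / x (γ 0)| ≤ C * B := by
  have h1 : ∀ s, HasDerivAt (fun s => (x (γ s))⁻¹)
      (-diff x (γ s) (velocity γ s) / x (γ s) ^ 2) s := fun s =>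
    (hasDerivAt_comp_velocity hx.smooth (hγ s)).fun_inv (hx.pos (hi s)).ne'
  have h2 : 0 ≤ B := (gnorm_nonneg _ _ _).trans (hB 0 ⟨le_rfl, zero_le_one⟩)
  have h3 := (convex_Icc (0 : ℝ) 1).norm_image_sub_le_of_norm_hasDerivWithin_le (C := C * B)
    (fun s _ => (h1 s).hasDerivWithinAt) (fun s hs => by
      have h4 : 0 < x (γ s) ^ 2 := pow_pos (hx.pos (hi s)) 2
      rw [Real.norm_eq_abs, abs_div, abs_neg, abs_of_pos h4, div_le_iff₀ h4]
      refine (hC _ (hi s) _).trans ?_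
      rw [mul_right_comm]
      exact mul_le_mul_of_nonneg_right (mul_le_mul_of_nonneg_left (hB s hs) hC0) h4.le)
    (⟨le_rfl, zero_le_one⟩ : (0 : ℝ) ∈ Icc (0 : ℝ) 1) hs
  rw [one_div, one_div, ← Real.norm_eq_abs]
  refine h3.trans (mul_le_of_le_one_right (by positivity) ?_)
  rw [sub_zero, Real.norm_of_nonneg hs.1]
  exact hs.2

/-- The deviation of a Jacobi field from the affine field with the same initial data is bounded by
the curvature along the geodesic. -/
theorem IsJacobiField.gnorm_sub_le (hg : IsConical g x₀ a h) {γ : ℝ → M} (hγ : IsGeodesic g γ)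
    {J DJ : ∀ s, TangentSpace (𝓡∂ n) (γ s)} (hJ : IsJacobiField g γ J DJ) {C R E : ℝ}
    (hv : ∀ s ∈ Icc (0 : ℝ) 1, gnorm g (γ s) (velocity γ s) ≤ C)
    (hJ0 : gnorm g (γ 0) (J 0) ≤ C) (hDJ0 : gnorm g (γ 0) (DJ 0) ≤ C) {κ : ℝ → ℝ}
    (hκ : ∀ s ∈ Icc (0 : ℝ) 1, CurvatureNormLE g (γ s) (κ s))
    (hκR : ∀ s ∈ Icc (0 : ℝ) 1, 0 ≤ κ s ∧ κ s ≤ R ∧ κ s ≤ E)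
    {A B : ∀ s, TangentSpace (𝓡∂ n) (γ s)} (hA : IsParallelAlong g γ A) (hA0 : A 0 = J 0)
    (hB : IsParallelAlong g γ B) (hB0 : B 0 = DJ 0) {s : ℝ} (hs : s ∈ Icc (0 : ℝ) 1) :
    gnorm g (γ s) (J s - A s - s • B s) ≤
      E * (2 * C * Real.exp (1 + R * C ^ 2)) * C ^ 2 := by
  have h0 : (0 : ℝ) ∈ Icc (0 : ℝ) 1 := ⟨le_rfl, zero_le_one⟩
  have hγd := hγ.1.mdifferentiable (by simp)
  have hC : 0 ≤ C := (gnorm_nonneg _ _ _).trans hJ0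
  have hR : 0 ≤ R := (hκR 0 h0).1.trans (hκR 0 h0).2.1
  have hE : 0 ≤ E := (hκR 0 h0).1.trans (hκR 0 h0).2.2
  have hcurv : ∀ s ∈ Icc (0 : ℝ) 1, gnorm g (γ s)
      (-curvature g (γ s) (J s) (velocity γ s) (velocity γ s)) ≤
        κ s * gnorm g (γ s) (J s) * C ^ 2 := by
    intro s hs
    have e1 := gnorm_nonneg g (γ s) (velocity γ s)
    have e2 := gnorm_nonneg g (γ s) (J s)
    have e3 := hv s hs
    have e4 := (hκR s hs).1
    rw [gnorm_neg]
    refine (hκ s hs _ _ _).trans ?_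
    rw [sq, ← mul_assoc]
    gcongr
  -- The crude curvature bound `R` enters only the exponent; the sharp bound `E` is kept for the
  -- final double integration.
  have hJs : ∀ s ∈ Icc (0 : ℝ) 1,
      gnorm g (γ s) (J s) ≤ 2 * C * Real.exp (1 + R * C ^ 2) := fun s hs =>
    hJ.1.exists_gnorm_le hg hγd hγ.2.1 hJ.2 (by positivity) hC (fun s hs => by
      refine (hcurv s hs).trans ?_
      rw [mul_right_comm]
      have e2 := gnorm_nonneg g (γ s) (J s)
      have e3 := (hκR s hs).2.1
      gcongr) hJ0 hDJ0 hs
  -- The `0` is the covariant derivative of `A`; this is the form in which the derivative of `J - A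
  -- - s B` arises below.
  have hDQ : IsCovDerivAlong g γ (fun s => DJ s - 0 - B s) fun s =>
      -curvature g (γ s) (J s) (velocity γ s) (velocity γ s) - 0 := by
    simp only [sub_zero (DJ _)]
    exact hJ.2.sub hB
  set D := E * (2 * C * Real.exp (1 + R * C ^ 2)) * C ^ 2 with hD
  have hD0 : 0 ≤ D := by positivity
  have h1 : ∀ s ∈ Icc (0 : ℝ) 1, gnorm g (γ s) (DJ s - 0 - B s) ≤ D := fun s hs => by
    refine (hDQ.gnorm_le hg hγd hγ.2.1 (B := D) (fun s hs => ?_) hs).trans ?_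
    · rw [sub_zero]
      refine (hcurv s hs).trans ?_
      have e2 := gnorm_nonneg g (γ s) (J s)
      have e3 := (hκR s hs).2.2
      have e4 := hJs s hs
      rw [hD]
      gcongr
    · rw [hB0, sub_zero, sub_self, gnorm_zero, zero_add]
      exact mul_le_of_le_one_right hD0 hs.2
  refine (((hJ.1.sub hA).sub hB.smul_id).gnorm_le hg hγd hγ.2.1 h1 hs).trans ?_
  rw [hA0, sub_self, zero_smul, sub_self, gnorm_zero, zero_add]
  exact mul_le_of_le_one_right hD0 hs.2

end Jacobi

end ScGeom

end

/-! ### The main theorem -/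

open ScGeom in
theorem mainTheorem8 {n m : ℕ} [NeZero n] [NeZero m]
    {X' : Type*} [TopologicalSpace X'] [T2Space X'] [CompactSpace X']
    [ChartedSpace (EuclideanHalfSpace n) X'] [IsManifold (𝓡∂ n) ∞ X']
    {X : Type*} [TopologicalSpace X] [T2Space X] [CompactSpace X]
    [ChartedSpace (EuclideanHalfSpace m) X] [IsManifold (𝓡∂ m) ∞ X]
    (g : ∀ p : X', TangentSpace (𝓡∂ n) p →L[ℝ] TangentSpace (𝓡∂ n) p →L[ℝ] ℝ)
    (hg : IsAsymptoticallyConical g)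
    (x : X' → ℝ) (hx : IsBoundaryDefining (n := n) x)
    (V : ∀ p : X', TangentSpace (𝓡∂ n) p) (hV : IsScatteringField V)
    (ε : ℝ) (hε : 0 < ε)
    -- the curvature estimate, for points near the boundary
    (ρ : ℝ → ℝ) (c : ℝ)
    (hρ_pos : ∀ t ∈ Ioo 0 ε, 0 < ρ t)
    (hρ_le : ∀ t ∈ Ioo 0 ε, ρ t ^ 2 ≤ c * t ^ 2)
    (hR : ∀ p ∈ (𝓡∂ n).interior X', x p < ε → CurvatureNormLE g p (ρ (x p) ^ 2))
    -- `ρ` is comparable at points whose values of `1/x` differ by a bounded amount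
    (hρ_slow : ∀ K : ℝ, ∃ L : ℝ, ∀ᶠ t in 𝓝[>] (0 : ℝ), ∀ t' > 0, |1 / t' - 1 / t| ≤ K →
      ρ t' ≤ L * ρ t)
    -- the b-immersion, the field `Z` and the coordinate line `t ↦ (t, y)` in `X`
    (φ : X → X') (hφ : IsBImmersion (m := m) (n := n) φ)
    (Z : ∀ p : X, TangentSpace (𝓡∂ m) p) (hZ : IsScatteringField Z)
    (y : X) (hy : y ∈ (𝓡∂ m).boundary X)
    (σ : ℝ → X) (hσ : ContMDiffOn 𝓘(ℝ, ℝ) (𝓡∂ m) ∞ σ (Ico 0 ε)) (hσ_zero : σ 0 = y)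
    (hσx : ∀ t ∈ Ico 0 ε, x (φ (σ t)) = t)
    (hZ_ne : ∀ t ∈ Ioo 0 ε, Z (σ t) ≠ 0) :
    ∃ C : ℝ, ∀ᶠ t in 𝓝[>] (0 : ℝ),
      -- the geodesic `γ` with initial velocity `V`
      ∀ γ : ℝ → X', IsGeodesic g γ → γ 0 = φ (σ t) → velocity γ 0 = V (γ 0) →
      -- the Jacobi field `J` with `J(0) = Z` and `∇_s J(0) = ∇_Z V`
      ∀ J DJ : ∀ s, TangentSpace (𝓡∂ n) (γ s), IsJacobiField g γ J DJ →
        (⟨γ 0, J 0⟩ : TangentBundle (𝓡∂ n) X') = tangentMap (𝓡∂ m) (𝓡∂ n) φ ⟨σ t, Z (σ t)⟩ →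
        IsCovDerivAt g V (γ 0) (J 0) (DJ 0) →
      -- the parallel extensions `A` of `Z` and `B` of `∇_Z V`
      ∀ A B : ∀ s, TangentSpace (𝓡∂ n) (γ s),
        IsParallelAlong g γ A → A 0 = J 0 → IsParallelAlong g γ B → B 0 = DJ 0 →
      ∃ Q : ∀ s, TangentSpace (𝓡∂ n) (γ s),
        (∀ s, J s = A s + s • B s + Q s) ∧
        ∀ s ∈ Icc (0 : ℝ) 1, gnorm g (γ s) (Q s) ≤ C * (ρ t * t) := by
  obtain ⟨x₀, a, h, hg⟩ := hg.exists_isConical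
  obtain ⟨C₁, hC₁, hdiff⟩ := hg.exists_diff_le hx
  obtain ⟨C, hinit⟩ := hg.exists_initial_bound hx hV hφ.smooth hφ.map_boundary hZ hy hε
    (hσ 0 ⟨le_rfl, hε⟩) hσ_zero hσx
  -- `C₁` bounds the gradient of `1/x` and `|C|` the speed, so `1/x` varies by at most `C₁ |C|` in
  -- unit time.
  obtain ⟨L, hL⟩ := hρ_slow (C₁ * |C|)
  set b := √|c| with hb
  have hb0 : 0 ≤ b := Real.sqrt_nonneg _
  have hb2 : b ^ 2 = |c| := Real.sq_sqrt (abs_nonneg c)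
  have hρb : ∀ t ∈ Ioo 0 ε, ρ t ≤ b * t := fun t ht => by
    refine le_of_sq_le_sq ?_ (mul_nonneg hb0 ht.1.le)
    rw [mul_pow, hb2]
    exact (hρ_le t ht).trans (mul_le_mul_of_nonneg_right (le_abs_self c) (sq_nonneg t))
  refine ⟨|L| * (b * 2) * (2 * |C| * Real.exp (1 + (b * ε) ^ 2 * |C| ^ 2)) * |C| ^ 2, ?_⟩
  -- The second bound makes the variation of `1/x` at most half of `1/t`, so `x ≤ 2t` along the
  -- geodesic; the first then keeps `x < ε`, where the curvature estimate applies.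
  have hsmall : ∀ᶠ t in 𝓝[>] (0 : ℝ), t ∈ Ioo 0 (min (ε / 2) (1 / (2 * (C₁ * |C| + 1)))) :=
    Ioo_mem_nhdsGT (by positivity)
  filter_upwards [hinit, hL, hsmall] with t hinit hL ht γ hγ hγ0 hγV J DJ hJ hJ0 hDJ0 A B hA hA0
    hB hB0
  refine ⟨fun s => J s - A s - s • B s, fun s => by simp only [sub_sub, add_sub_cancel], fun s hs => ?_⟩
  have htε : t < ε / 2 := ht.2.trans_le (min_le_left _ _)
  have htK : t * (2 * (C₁ * |C| + 1)) < 1 := by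
    have := ht.2.trans_le (min_le_right _ _)
    rwa [lt_div_iff₀ (by positivity)] at this
  have ht0 : t ∈ Ioo 0 ε := ⟨ht.1, by linarith⟩
  -- Stated for a free base point, so that the equality in the tangent bundle can be eliminated.
  have hbound : ∀ (p : X') (j : TangentSpace (𝓡∂ n) p),
      (⟨p, j⟩ : TangentBundle (𝓡∂ n) X') = tangentMap (𝓡∂ m) (𝓡∂ n) φ ⟨σ t, Z (σ t)⟩ →
      gnorm g p (V p) ≤ |C| ∧ gnorm g p j ≤ |C| ∧
        ∀ w, IsCovDerivAt g V p j w → gnorm g p w ≤ |C| := by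
    intro p j hj
    injection hj with h1 h2
    subst h1
    cases h2
    exact ⟨hinit.1.trans (le_abs_self C), hinit.2.1.trans (le_abs_self C),
      fun w hw => (hinit.2.2 w hw).trans (le_abs_self C)⟩
  obtain ⟨hV0, hJ0', hDJ0'⟩ := hbound _ _ hJ0
  have hγd := hγ.1.mdifferentiable (by simp)
  have hv : ∀ s ∈ Icc (0 : ℝ) 1, gnorm g (γ s) (velocity γ s) ≤ |C| := fun s hs => by
    have := hγ.2.2.gnorm_le hg hγd hγ.2.1 (B := 0) (fun s _ => (gnorm_zero g (γ s)).le) hs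
    rw [hγV, zero_mul, add_zero] at this
    exact this.trans hV0
  have hxγ0 : x (γ 0) = t := by rw [hγ0]; exact hσx t ⟨ht.1.le, ht0.2⟩
  have hinv : ∀ s ∈ Icc (0 : ℝ) 1, |1 / x (γ s) - 1 / t| ≤ C₁ * |C| := fun s hs => by
    rw [← hxγ0]
    exact hx.abs_inv_sub_inv_le hC₁ hdiff hγd hγ.2.1 hv hs
  have hpos : ∀ s, 0 < x (γ s) := fun s => hx.pos (hγ.2.1 s)
  have hle : ∀ s ∈ Icc (0 : ℝ) 1, x (γ s) ≤ 2 * t := fun s hs => by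
    have e1 := (abs_le.1 (hinv s hs)).1
    have e2 : 1 / (2 * t) ≤ 1 / x (γ s) := by
      have e3 : C₁ * |C| ≤ 1 / (2 * t) := by
        rw [le_div_iff₀ (by linarith [ht.1])]
        linarith [ht.1]
      have e4 : 1 / t = 1 / (2 * t) + 1 / (2 * t) := by
        have := ht.1.ne'
        field_simp
        norm_num
      linarith
    exact (one_div_le_one_div (by linarith [ht.1]) (hpos s)).1 e2
  have hmem : ∀ s ∈ Icc (0 : ℝ) 1, x (γ s) ∈ Ioo 0 ε := fun s hs =>
    ⟨hpos s, by linarith [hle s hs]⟩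
  have hρt := hρ_pos t ht0
  -- `R` comes from `ρ ≤ b x ≤ b ε` and does not depend on `t`. In `E` the two factors of `ρ²` are
  -- treated differently: comparability gives `|L| ρ(t)`, and `ρ ≤ b x ≤ 2 b t` gives the factor
  -- `t`.
  have hQ := hJ.gnorm_sub_le hg hγ hv hJ0' (hDJ0' _ hDJ0) (R := (b * ε) ^ 2)
    (E := |L| * ρ t * (b * (2 * t))) (fun s hs => hR _ (hγ.2.1 s) (hmem s hs).2)
    (fun s hs => by
      have e1 := hρ_pos _ (hmem s hs)
      have e2 := hρb _ (hmem s hs)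
      refine ⟨sq_nonneg _, pow_le_pow_left₀ e1.le (e2.trans ?_) 2, ?_⟩
      · exact mul_le_mul_of_nonneg_left (hmem s hs).2.le hb0
      · rw [sq]
        refine mul_le_mul ?_ (e2.trans (mul_le_mul_of_nonneg_left (hle s hs) hb0)) e1.le
          (by positivity)
        exact (hL _ (hpos s) (hinv s hs)).trans
          (mul_le_mul_of_nonneg_right (le_abs_self L) hρt.le))
    hA hA0 hB hB0 hs
  refine hQ.trans (le_of_eq ?_)
  ring
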